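/- **Definitions.** Let $X$ be a finite-dimensional CAT(0) cube complex with countably many vertices, i.e. a cubical complex (any two cubes that meet do so in a common face) whose geometric realization $|X|$, with the $\ell^2$ path metric, is a CAT(0) space. Let $\mathrm{Isom}(X)$ be its group of cubical isometries (permutations of the vertices mapping cubes to cubes) and let $\mathfrak H$ be its set of half-spaces, i.e. of complementary components of hyperplanes, viewed as sets of vertices. For a vertex $v$ put $U_v=\{h\in\mathfrak H : v\in h\}$. The Roller compactification $\overline X$ is the closure of $\{U_v\}$ in $2^{\mathfrak H}$, and the Roller boundary is $\partial X=\overline X\setminus\{U_v\}$; for $\xi \in\overline X$ write $U_\xi\subseteq\mathfrak H$ for the corresponding collection of half-spaces. - The action of $\mathrm{Isom}(X)$ is *essential* if for no half-space $h$ and vertex $x$ the set $\mathrm{Isom}(X)x\cap h$ is at bounded combinatorial distance from the complement of $h$. It is *non-elementary* if it has no finite orbit in $|X|$ or in the visual boundary of $|X|$. - A point $\xi\in\partial X$ is *non-terminating* if for every $h\in U_\xi$ there is $k\in U_\xi$ with $k\subsetneq h$. The boundary $B(X)$ is the closure in $\overline X$ of the set of non-terminating points. - Half-spaces $h,k$ are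 *transverse* if the four intersections of $h$ or its complement with $k$ or its complement are nonempty, and *strongly separated* if no half-space is transverse to both. If $X$ is irreducible, $\xi\in\partial X$ is *regular* if for all $h_1,h_2\in U_\xi$ there is $k\in U_\xi$ with $k\subseteq h_1\cap h_2$ and $k$ strongly separated from $h_1$ and from $h_2$; in general, $\xi$ is regular if its projection to each irreducible factor is regular. The boundary $R(X)$ is the closure in $\overline X$ of the set of regular points. **Proposition 6.13.** Let $\mathbb Z^2*\mathbb Z=\langle a,b\rangle*\langle c\rangle$. There is an $\ell^1$-convex full subcomplex $X$ of the universal cover of the Salvetti complex of $\mathbb Z^2*\mathbb Z$ which is a finite-dimensional CAT(0) cube complex with countably many vertices, on which $\mathrm{Isom}(X)$ acts essentially and non-elementarily, and such that $R(X)\neq B(X)$. In particular, the action of $\mathrm{Isom}(X)$ on $B(X)$ is not minimal: some orbit in $B(X)$ is not dense in $B(X)$. -/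

import Mathlib

open scoped ENNReal NNReal

noncomputable section

/-! # Geodesics, CAT(0) spaces, visual boundary, elementary actions -/

/-- `γ`, restricted to `[0, L]`, is a geodesic segment (parametrised by arc length). -/
def IsGeodesicSegment {M : Type*} [PseudoEMetricSpace M] (γ : ℝ → M) (L : ℝ) : Prop :=
  0 ≤ L ∧ ∀ s ∈ Set.Icc 0 L, ∀ t ∈ Set.Icc 0 L, edist (γ s) (γ t) = ENNReal.ofReal |s - t|

/-- A CAT(0) space: a geodesic metric space in which, for every geodesic segment `γ` and every
point `p`, the distance from `p` to a point of `γ` is at most the corresponding distance in the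
comparison triangle of the Euclidean plane. The latter distance is computed by Stewart's formula
`L * d(p̄, γ̄ t)² = (L - t) * d(p, γ 0)² + t * d(p, γ L)² - t * (L - t) * L`. -/
structure IsCAT0 (M : Type*) [PseudoEMetricSpace M] : Prop where
  edist_ne_top : ∀ p q : M, edist p q ≠ ⊤
  eq_of_edist_eq_zero : ∀ p q : M, edist p q = 0 → p = q
  exists_geodesic : ∀ p q : M, ∃ (γ : ℝ → M) (L : ℝ),
    IsGeodesicSegment γ L ∧ γ 0 = p ∧ γ L = q
  comparison : ∀ (γ : ℝ → M) (L : ℝ), IsGeodesicSegment γ L → ∀ (p : M), ∀ t ∈ Set.Icc 0 L,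
    L * (edist p (γ t)).toReal ^ 2 ≤
      (L - t) * (edist p (γ 0)).toReal ^ 2 + t * (edist p (γ L)).toReal ^ 2 - t * (L - t) * L

/-- Geodesic rays. -/
abbrev GeodesicRay (M : Type*) [PseudoEMetricSpace M] : Type _ :=
  {γ : ℝ≥0 → M // Isometry γ}

/-- Two rays are asymptotic if they stay at bounded distance from each other. -/
instance asymptoticSetoid (M : Type*) [PseudoEMetricSpace M] : Setoid (GeodesicRay M) where
  r γ δ := ∃ C : ℝ≥0, ∀ t, edist (γ.1 t) (δ.1 t) ≤ C
  iseqv :=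
    { refl := fun γ => ⟨0, fun t => by simp⟩
      symm := fun ⟨C, h⟩ => ⟨C, fun t => by rw [edist_comm]; exact h t⟩
      trans := fun {γ δ ε} ⟨C, h⟩ ⟨D, k⟩ => ⟨C + D, fun t => by
        rw [ENNReal.coe_add]
        exact (edist_triangle _ (δ.1 t) _).trans (add_le_add (h t) (k t))⟩ }

/-- The visual boundary: asymptoty classes of geodesic rays. -/
def VisualBoundary (M : Type*) [PseudoEMetricSpace M] : Type _ :=
  Quotient (asymptoticSetoid M)

instance VisualBoundary.mulAction (Γ M : Type*) [Group Γ] [PseudoEMetricSpace M] [MulAction Γ M]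
    [IsIsometricSMul Γ M] : MulAction Γ (VisualBoundary M) where
  smul g := Quotient.map
    (fun γ => (⟨fun t => g • γ.1 t, (isometry_smul M g).comp γ.2⟩ : GeodesicRay M))
    (fun _ _ ⟨C, h⟩ => ⟨C, fun t => by simpa only [edist_smul_left] using h t⟩)
  one_smul ξ := by
    induction ξ using Quotient.inductionOn with
    | h γ => exact congrArg _ (Subtype.ext (funext fun t => one_smul Γ (γ.1 t)))
  mul_smul g k ξ := by
    induction ξ using Quotient.inductionOn with
    | h γ => exact congrArg _ (Subtype.ext (funext fun t => mul_smul g k (γ.1 t)))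

/-- An isometric action is elementary if it has a finite orbit in the space or in the visual
boundary. -/
def IsElementaryAction (Γ M : Type*) [Group Γ] [PseudoEMetricSpace M] [MulAction Γ M]
    [IsIsometricSMul Γ M] : Prop :=
  (∃ p : M, (MulAction.orbit Γ p).Finite) ∨
    ∃ ξ : VisualBoundary M, (MulAction.orbit Γ ξ).Finite

/-! # Cubical complexes -/

/-- The combinatorial data of a cubical complex with vertex set `V`: each cube is recorded by its
set of vertices. The laws are in `CubeFamily.IsCubicalComplex`. -/
@[ext] structure CubeFamily (V : Type*) where
  cubes : Set (Set V)

/-- The face of the combinatorial cube `{0,1}ⁿ` obtained by fixing the coordinates in `I`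
to be those of `a`. -/
def cubeFace {n : ℕ} (I : Set (Fin n)) (a : Fin n → Bool) : Set (Fin n → Bool) :=
  {ε | ∀ i ∈ I, ε i = a i}

namespace CubeFamily

variable {V : Type*}

/-- `φ` identifies `{0,1}ⁿ` with the vertex set of an `n`-cube of `X`, in such a way that the
cubes of `X` contained in this cube are exactly its faces. -/
structure IsChart (X : CubeFamily V) {n : ℕ} (φ : (Fin n → Bool) → V) : Prop where
  injective : Function.Injective φ
  range_mem : Set.range φ ∈ X.cubes
  mem_cubes_iff : ∀ t : Set V, t ⊆ Set.range φ →
    (t ∈ X.cubes ↔ ∃ (I : Set (Fin n)) (a : Fin n → Bool), t = φ '' cubeFace I a)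

/-- Cubical complex: every vertex is a cube, every cube is a
combinatorial cube of some dimension together with all its faces, and two cubes which meet do so
in a common face. -/
structure IsCubicalComplex (X : CubeFamily V) : Prop where
  singleton_mem : ∀ v : V, {v} ∈ X.cubes
  exists_chart : ∀ s ∈ X.cubes, ∃ (n : ℕ) (φ : (Fin n → Bool) → V),
    X.IsChart φ ∧ s = Set.range φ
  inter_mem : ∀ s ∈ X.cubes, ∀ t ∈ X.cubes, (s ∩ t).Nonempty → s ∩ t ∈ X.cubes

/-- The dimension of the cubes is bounded. -/
def IsFiniteDimensional (X : CubeFamily V) : Prop :=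
  ∃ N : ℕ, ∀ (n : ℕ) (φ : (Fin n → Bool) → V), X.IsChart φ → n ≤ N

/-- The full subcomplex spanned by a set of vertices. -/
def induce (X : CubeFamily V) (S : Set V) : CubeFamily S where
  cubes := {t | Subtype.val '' t ∈ X.cubes}

/-- The 1-skeleton. -/
def graph (X : CubeFamily V) : SimpleGraph V where
  Adj v w := v ≠ w ∧ {v, w} ∈ X.cubes
  symm := ⟨fun v w h => ⟨h.1.symm, by rw [Set.pair_comm]; exact h.2⟩⟩
  loopless := ⟨fun _ h => h.1 rfl⟩

/-- A set of vertices is (`ℓ¹`-)convex if it contains the interval between any two of its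
points, for the combinatorial distance. -/
def IsConvex (X : CubeFamily V) (S : Set V) : Prop :=
  ∀ x ∈ S, ∀ y ∈ S, ∀ z, X.graph.dist x z + X.graph.dist z y = X.graph.dist x y → z ∈ S

/-! ## Geometric realization

A point of the cube `[0,1]ⁿ` is recorded by the product probability measure on `{0,1}ⁿ` having
that point as barycentre, pushed forward to the vertices of the complex. This is compatible with
passing to faces, so that the realization is the union of the cubes, glued along common faces. -/

open Classical in
/-- The point with coordinates `x ∈ [0,1]ⁿ` in the cube with chart `φ`. -/
def cubePoint {n : ℕ} (φ : (Fin n → Bool) → V) (x : EuclideanSpace ℝ (Fin n)) : V → ℝ :=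
  fun v => ∑ ε : Fin n → Bool,
    if φ ε = v then ∏ i, (if ε i = true then x i else 1 - x i) else 0

/-- The geometric realization of a cubical complex. -/
def Realization (X : CubeFamily V) : Type _ :=
  {p : V → ℝ // ∃ (n : ℕ) (φ : (Fin n → Bool) → V) (x : EuclideanSpace ℝ (Fin n)),
    X.IsChart φ ∧ (∀ i, x i ∈ Set.Icc (0 : ℝ) 1) ∧ p = cubePoint φ x}

/-- `p` and `q` lie in a common cube, in which their Euclidean distance is `r`. -/
def IsStep (X : CubeFamily V) (p q : X.Realization) (r : ℝ≥0∞) : Prop :=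
  ∃ (n : ℕ) (φ : (Fin n → Bool) → V) (x y : EuclideanSpace ℝ (Fin n)),
    X.IsChart φ ∧ (∀ i, x i ∈ Set.Icc (0 : ℝ) 1) ∧ (∀ i, y i ∈ Set.Icc (0 : ℝ) 1) ∧
    p.1 = cubePoint φ x ∧ q.1 = cubePoint φ y ∧ r = edist x y

/-- There is a string from `p` to `q` of total length `l`: a finite sequence of points starting
at `p` and ending at `q`, any two successive ones lying in a common cube. -/
inductive IsString (X : CubeFamily V) : X.Realization → X.Realization → ℝ≥0∞ → Prop
  | nil (p : X.Realization) : IsString X p p 0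
  | cons {p q t : X.Realization} {r l : ℝ≥0∞} :
      X.IsStep p q r → IsString X q t l → IsString X p t (r + l)

theorem IsStep.symm {X : CubeFamily V} {p q : X.Realization} {r : ℝ≥0∞}
    (h : X.IsStep p q r) : X.IsStep q p r := by
  obtain ⟨n, φ, x, y, hφ, hx, hy, hp, hq, hr⟩ := h
  exact ⟨n, φ, y, x, hφ, hy, hx, hq, hp, by rw [hr, edist_comm]⟩

theorem IsString.append {X : CubeFamily V} {p q t : X.Realization} {l m : ℝ≥0∞}
    (h : X.IsString p q l) (k : X.IsString q t m) : X.IsString p t (l + m) := by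
  induction h with
  | nil p => simpa using k
  | cons s _ ih => rw [add_assoc]; exact .cons s (ih k)

theorem IsString.symm {X : CubeFamily V} {p q : X.Realization} {l : ℝ≥0∞}
    (h : X.IsString p q l) : X.IsString q p l := by
  induction h with
  | nil p => exact .nil p
  | @cons p q t r l s _ ih =>
    have := ih.append (IsString.cons s.symm (.nil p))
    rwa [add_zero, add_comm] at this

/-- The `ℓ²` path metric: the infimum of the lengths of strings (infinite if there are none). -/
instance (X : CubeFamily V) : PseudoEMetricSpace X.Realization where
  edist p q := sInf {l | X.IsString p q l}
  edist_self p := le_antisymm (sInf_le (IsString.nil p)) bot_le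
  edist_comm p q := by
    congr 1
    ext l
    exact ⟨IsString.symm, IsString.symm⟩
  edist_triangle p q t := by
    rw [ENNReal.sInf_add]
    refine le_iInf₂ fun l hl => ?_
    rw [add_comm, ENNReal.sInf_add]
    refine le_iInf₂ fun m hm => ?_
    rw [add_comm]
    exact sInf_le (IsString.append hl hm)

/-- A CAT(0) cube complex: a cubical complex whose geometric realization, with its `ℓ²` path
metric, is a CAT(0) space. -/
def IsCAT0CubeComplex (X : CubeFamily V) : Prop :=
  X.IsCubicalComplex ∧ IsCAT0 X.Realization

/-! ## Automorphisms -/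

/-- The group of isometries of the complex, that is, of permutations of the vertices mapping cubes
to cubes. -/
def isom (X : CubeFamily V) : Subgroup (Equiv.Perm V) where
  carrier := {g | ∀ s : Set V, g '' s ∈ X.cubes ↔ s ∈ X.cubes}
  one_mem' := fun s => by simp
  mul_mem' := fun {g k} hg hk s => by
    rw [Equiv.Perm.coe_mul, Set.image_comp, hg, hk]
  inv_mem' := fun {g} hg s => by
    rw [← hg, ← Set.image_comp, ← Equiv.Perm.coe_mul, mul_inv_cancel, Equiv.Perm.coe_one,
      Set.image_id]

theorem IsChart.isom {X : CubeFamily V} {n : ℕ} {φ : (Fin n → Bool) → V} (h : X.IsChart φ)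
    (g : X.isom) : X.IsChart (fun ε => g.1 (φ ε)) where
  injective := g.1.injective.comp h.injective
  range_mem := by
    have : Set.range (fun ε => g.1 (φ ε)) = g.1 '' Set.range φ := Set.range_comp g.1 φ
    rw [this]
    exact (g.2 _).2 h.range_mem
  mem_cubes_iff := fun t ht => by
    have hg : g.1 '' (g.1 ⁻¹' t) = t := Set.image_preimage_eq t g.1.surjective
    have hsub : g.1 ⁻¹' t ⊆ Set.range φ := by
      intro v hv
      obtain ⟨ε, hε⟩ := ht hv
      exact ⟨ε, g.1.injective hε⟩
    rw [← hg, g.2, h.mem_cubes_iff _ hsub]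
    refine exists_congr fun I => exists_congr fun a => ?_
    have : (fun ε => g.1 (φ ε)) '' cubeFace I a = g.1 '' (φ '' cubeFace I a) :=
      Set.image_comp g.1 φ _
    rw [this, Set.image_eq_image g.1.injective]

theorem cubePoint_isom {n : ℕ} (g : Equiv.Perm V) (φ : (Fin n → Bool) → V)
    (x : EuclideanSpace ℝ (Fin n)) :
    (fun v => cubePoint φ x (g⁻¹ v)) = cubePoint (fun ε => g (φ ε)) x := by
  funext v
  unfold cubePoint
  refine Finset.sum_congr rfl fun ε _ => ?_
  have : φ ε = g⁻¹ v ↔ g (φ ε) = v := Equiv.Perm.eq_inv_iff_eq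
  by_cases h : g (φ ε) = v
  · rw [if_pos h, if_pos (this.2 h)]
  · rw [if_neg h, if_neg (mt this.1 h)]

/-- The action on the geometric realization which is the linear extension of the action on
vertices. -/
instance (X : CubeFamily V) : MulAction X.isom X.Realization where
  smul g p := ⟨fun v => p.1 (g.1⁻¹ v), by
    obtain ⟨n, φ, x, hφ, hx, hp⟩ := p.2
    exact ⟨n, _, x, hφ.isom g, hx, by rw [hp]; exact cubePoint_isom g.1 φ x⟩⟩
  one_smul _ := rfl
  mul_smul _ _ _ := rfl

theorem IsStep.smul {X : CubeFamily V} {p q : X.Realization} {r : ℝ≥0∞}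
    (h : X.IsStep p q r) (g : X.isom) : X.IsStep (g • p) (g • q) r := by
  obtain ⟨n, φ, x, y, hφ, hx, hy, hp, hq, hr⟩ := h
  refine ⟨n, _, x, y, hφ.isom g, hx, hy, ?_, ?_, hr⟩
  · rw [← cubePoint_isom, ← hp]; rfl
  · rw [← cubePoint_isom, ← hq]; rfl

theorem IsString.smul {X : CubeFamily V} {p q : X.Realization} {l : ℝ≥0∞}
    (h : X.IsString p q l) (g : X.isom) : X.IsString (g • p) (g • q) l := by
  induction h with
  | nil p => exact .nil _
  | cons s _ ih => exact .cons (s.smul g) ih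

instance (X : CubeFamily V) : IsIsometricSMul X.isom X.Realization where
  isometry_smul g p q := by
    change sInf _ = sInf _
    congr 1
    ext l
    refine ⟨fun h => ?_, fun h => h.smul g⟩
    have := IsString.smul h g⁻¹
    rwa [inv_smul_smul, inv_smul_smul] at this

/-! ## Hyperplanes and half-spaces -/

/-- `e` and `f` are opposite edges of a square of `X`. -/
def AreOpposite (X : CubeFamily V) (e f : Sym2 V) : Prop :=
  ∃ v w v' w' : V, e = s(v, w) ∧ f = s(v', w') ∧ v ≠ w' ∧ w ≠ v' ∧
    X.graph.Adj v w ∧ X.graph.Adj v' w' ∧ X.graph.Adj v v' ∧ X.graph.Adj w w' ∧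
    {v, w, v', w'} ∈ X.cubes

/-- The set of edges crossed by the hyperplane (wall) dual to `e`: the class of `e` for the
equivalence relation generated by being opposite in a square. -/
def wall (X : CubeFamily V) (e : Sym2 V) : Set (Sym2 V) :=
  {f | Relation.EqvGen X.AreOpposite e f}

/-- Half-spaces (as sets of vertices): the connected components of the complement of a
hyperplane. -/
def IsHalfSpace (X : CubeFamily V) (h : Set V) : Prop :=
  ∃ e ∈ X.graph.edgeSet, ∃ v : V,
    h = {u | (X.graph.deleteEdges (X.wall e)).Reachable v u}

/-- The collection of half-spaces. -/
abbrev HalfSpace (X : CubeFamily V) : Type _ := {h : Set V // X.IsHalfSpace h}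

theorem graph_adj_isom {X : CubeFamily V} (g : X.isom) {v w : V} (h : X.graph.Adj v w) :
    X.graph.Adj (g.1 v) (g.1 w) :=
  ⟨fun e => h.1 (g.1.injective e), by
    have := (g.2 {v, w}).2 h.2
    rwa [Set.image_pair] at this⟩

theorem AreOpposite.isom {X : CubeFamily V} (g : X.isom) {e f : Sym2 V} (h : X.AreOpposite e f) :
    X.AreOpposite (e.map g.1) (f.map g.1) := by
  obtain ⟨v, w, v', w', rfl, rfl, h1, h2, h3, h4, h5, h6, h7⟩ := h
  refine ⟨g.1 v, g.1 w, g.1 v', g.1 w', rfl, rfl, fun e => h1 (g.1.injective e),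
    fun e => h2 (g.1.injective e), graph_adj_isom g h3, graph_adj_isom g h4, graph_adj_isom g h5,
    graph_adj_isom g h6, ?_⟩
  have := (g.2 _).2 h7
  simpa only [Set.image_insert_eq, Set.image_singleton] using this

theorem wall_isom {X : CubeFamily V} (g : X.isom) {e f : Sym2 V} (h : f ∈ X.wall e) :
    f.map g.1 ∈ X.wall (e.map g.1) := by
  change Relation.EqvGen _ _ _
  induction (show Relation.EqvGen X.AreOpposite e f from h) with
  | rel _ _ ho => exact .rel _ _ (AreOpposite.isom g ho)
  | refl _ => exact .refl _
  | symm _ _ hh ih => exact .symm _ _ (ih hh)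
  | trans _ _ _ h1 h2 ih1 ih2 => exact .trans _ _ _ (ih1 h1) (ih2 h2)

theorem reachable_isom {X : CubeFamily V} (g : X.isom) {e : Sym2 V} {v u : V}
    (h : (X.graph.deleteEdges (X.wall e)).Reachable v u) :
    (X.graph.deleteEdges (X.wall (e.map g.1))).Reachable (g.1 v) (g.1 u) := by
  refine h.map (⟨g.1, fun {a b} hab => ?_⟩ :
    X.graph.deleteEdges (X.wall e) →g X.graph.deleteEdges (X.wall (e.map g.1)))
  rw [SimpleGraph.deleteEdges_adj] at hab ⊢
  refine ⟨graph_adj_isom g hab.1, fun hw => hab.2 ?_⟩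
  have := wall_isom g⁻¹ hw
  have hinv : ∀ x : V, (g⁻¹ : X.isom).1 (g.1 x) = x := fun x => g.1.symm_apply_apply x
  have hmap : (e.map g.1).map (g⁻¹ : X.isom).1 = e := by
    induction e with
    | h x y => simp only [Sym2.map_mk, hinv]
  rw [hmap] at this
  simpa only [Sym2.map_mk, hinv] using this

theorem IsHalfSpace.isom {X : CubeFamily V} (g : X.isom) {h : Set V} (hh : X.IsHalfSpace h) :
    X.IsHalfSpace (g.1 '' h) := by
  obtain ⟨e, he, v, rfl⟩ := hh
  refine ⟨e.map g.1, ?_, g.1 v, ?_⟩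
  · induction e with
    | h x y => exact graph_adj_isom g he
  · have hinv : ∀ x : V, (g⁻¹ : X.isom).1 (g.1 x) = x := fun x => g.1.symm_apply_apply x
    have hmap : (e.map g.1).map (g⁻¹ : X.isom).1 = e := by
      induction e with
      | h x y => simp only [Sym2.map_mk, hinv]
    ext u
    constructor
    · rintro ⟨w, hw, rfl⟩
      exact reachable_isom g hw
    · intro hu
      have := reachable_isom g⁻¹ hu
      rw [hmap, hinv] at this
      exact ⟨_, this, g.1.apply_symm_apply u⟩

/-- The action on half-spaces. -/
instance (X : CubeFamily V) : MulAction X.isom X.HalfSpace where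
  smul g h := ⟨g.1 '' h.1, h.2.isom g⟩
  one_smul h := Subtype.ext (Set.image_id h.1)
  mul_smul g k h := Subtype.ext (Set.image_comp g.1 k.1 h.1)

/-- Transversality: the four intersections are nonempty. -/
def Transverse (X : CubeFamily V) (h k : X.HalfSpace) : Prop :=
  (h.1 ∩ k.1).Nonempty ∧ (h.1 ∩ k.1ᶜ).Nonempty ∧ (h.1ᶜ ∩ k.1).Nonempty ∧ (h.1ᶜ ∩ k.1ᶜ).Nonempty

/-- `h` is shallow for the action of the isometry group: for some vertex `x`, the part of the
orbit of `x` contained in `h` is at bounded combinatorial distance from the complement of `h`. -/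
def IsShallow (X : CubeFamily V) (h : X.HalfSpace) : Prop :=
  ∃ (x : V) (R : ℕ), ∀ g : X.isom, g.1 x ∈ h.1 → ∃ y ∈ h.1ᶜ, X.graph.dist (g.1 x) y ≤ R

/-- The action of the isometry group is essential: no half-space is shallow. -/
def IsEssential (X : CubeFamily V) : Prop :=
  ∀ h : X.HalfSpace, ¬ X.IsShallow h

/-! ## Roller compactification and boundaries

`2^𝔥` is the compact space `X.HalfSpace → Bool` with the product topology; a point `ξ` of it is
identified with the collection `U_ξ = {h | ξ h = true}`. -/

open Classical in
/-- The point of `2^𝔥` attached to the vertex `v`, that is the collection of half-spaces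
containing `v`. -/
def vertexPoint (X : CubeFamily V) (v : V) : X.HalfSpace → Bool :=
  fun h => decide (v ∈ h.1)

/-- The Roller compactification. -/
def rollerCompactification (X : CubeFamily V) : Set (X.HalfSpace → Bool) :=
  closure (Set.range X.vertexPoint)

/-- The Roller boundary. -/
def rollerBoundary (X : CubeFamily V) : Set (X.HalfSpace → Bool) :=
  X.rollerCompactification \ Set.range X.vertexPoint

/-- Non-terminating points: points of the Roller boundary such that every half-space of `U_ξ`
properly contains another one. -/
def nonterminatingPoints (X : CubeFamily V) : Set (X.HalfSpace → Bool) :=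
  {ξ | ξ ∈ X.rollerBoundary ∧
    ∀ h : X.HalfSpace, ξ h = true → ∃ k : X.HalfSpace, ξ k = true ∧ k.1 ⊂ h.1}

/-- The Nevo–Sageev boundary `B(X)`. -/
def nonterminatingBoundary (X : CubeFamily V) : Set (X.HalfSpace → Bool) :=
  closure X.nonterminatingPoints

/-- `h` and `k` come from the same irreducible factor of `X`. The decomposition of `X` into
irreducible factors corresponds to the finest partition of the set of half-spaces such that
half-spaces in different parts are transverse, that is, to the partition into classes of the
equivalence relation generated by non-transversality. -/
def SameFactor (X : CubeFamily V) (h k : X.HalfSpace) : Prop :=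
  Relation.EqvGen (fun h k => ¬ X.Transverse h k) h k

/-- Two half-spaces of one irreducible factor are strongly separated in this factor: no
half-space of the factor is transverse to both. (If `X` is irreducible, the condition on factors
is empty.) -/
def StronglySeparated (X : CubeFamily V) (h k : X.HalfSpace) : Prop :=
  ¬ ∃ m : X.HalfSpace, X.SameFactor m h ∧ X.Transverse m h ∧ X.Transverse m k

/-- Regular points. The point `ξ` of the Roller boundary is regular if its projection to each
irreducible factor is a regular point of the Roller boundary of this factor. Explicitly: in the
factor containing a given half-space `h₀`, the projection of `ξ` is not a vertex, and for all
`h₁, h₂ ∈ U_ξ` in one factor there is `k ∈ U_ξ` in this factor contained in `h₁ ∩ h₂` and strongly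
separated from both. If `X` is irreducible, there is only one factor, and this says that `ξ` is
in the Roller boundary and that for all `h₁, h₂ ∈ U_ξ` there is `k ∈ U_ξ` contained in `h₁ ∩ h₂`
and strongly separated from both. -/
def regularPoints (X : CubeFamily V) : Set (X.HalfSpace → Bool) :=
  {ξ | ξ ∈ X.rollerBoundary ∧
    (∀ (h₀ : X.HalfSpace) (v : V), ∃ h, X.SameFactor h₀ h ∧ ξ h ≠ X.vertexPoint v h) ∧
    ∀ h₁ h₂ : X.HalfSpace, X.SameFactor h₁ h₂ → ξ h₁ = true → ξ h₂ = true →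
      ∃ k : X.HalfSpace, X.SameFactor h₁ k ∧ ξ k = true ∧ k.1 ⊆ h₁.1 ∩ h₂.1 ∧
        X.StronglySeparated k h₁ ∧ X.StronglySeparated k h₂}

/-- The regular boundary `R(X)`. -/
def regularBoundary (X : CubeFamily V) : Set (X.HalfSpace → Bool) :=
  closure X.regularPoints

/-- The orbit of `ξ ∈ 2^𝔥` under the isometry group: `U_{gξ} = g U_ξ`. -/
def rollerOrbit (X : CubeFamily V) (ξ : X.HalfSpace → Bool) : Set (X.HalfSpace → Bool) :=
  Set.range fun (g : X.isom) (h : X.HalfSpace) => ξ (g⁻¹ • h)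

/-- The action of the isometry group on an invariant set `A ⊆ 2^𝔥` is minimal: every orbit in `A`
is dense in `A`. -/
def IsMinimalOn (X : CubeFamily V) (A : Set (X.HalfSpace → Bool)) : Prop :=
  ∀ ξ ∈ A, A ⊆ closure (X.rollerOrbit ξ)

end CubeFamily

/-! # The universal cover of the Salvetti complex of `ℤ² * ℤ` -/

namespace SalvettiExample

/-- The group `ℤ² * ℤ`. -/
abbrev Z2Z : Type := Monoid.Coprod (Multiplicative (ℤ × ℤ)) (Multiplicative ℤ)

/-- The first generator of `ℤ²`. -/
def a : Z2Z := Monoid.Coprod.inl (Multiplicative.ofAdd (1, 0))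

/-- The second generator of `ℤ²`. -/
def b : Z2Z := Monoid.Coprod.inl (Multiplicative.ofAdd (0, 1))

/-- The generator `c` of `ℤ`. -/
def c : Z2Z := Monoid.Coprod.inr (Multiplicative.ofAdd 1)

/-- The universal cover of the Salvetti complex of `ℤ² * ℤ = ⟨a, b⟩ * ⟨c⟩`. The Salvetti complex
is the wedge of the torus made of one square with sides labelled `a, b` and of the circle
labelled `c`, so the vertices of its universal cover are the elements of the group, its edges are
`{g, gs}` with `s ∈ {a, b, c}` and its squares are `{g, ga, gb, gab}`. -/
def salvettiCover : CubeFamily Z2Z where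
  cubes := {s | ∃ g : Z2Z, s = {g} ∨ s = {g, g * a} ∨ s = {g, g * b} ∨ s = {g, g * c} ∨
    s = {g, g * a, g * b, g * a * b}}

end SalvettiExample

end

noncomputable section

namespace DiagonalPlanes

/-! # Functions on the free group on two generators -/

/-- The free group on `t` and `c`. -/
abbrev F2 : Type := FreeGroup Bool

/-- The first generator. -/
def t : F2 := FreeGroup.of false

/-- The second generator. -/
def c : F2 := FreeGroup.of true

/-- Drop the last letter of the reduced word. -/
theorem exists_shorter {g : F2} (hg : g ≠ 1) : ∃ g' : F2, g'.norm < g.norm ∧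
    (g = g' * t ∨ g = g' * t⁻¹ ∨ g = g' * c ∨ g = g' * c⁻¹) := by
  have hL : g.toWord ≠ [] := fun h => hg (FreeGroup.toWord_eq_nil_iff.1 h)
  refine ⟨FreeGroup.mk g.toWord.dropLast, ?_, ?_⟩
  · refine lt_of_le_of_lt FreeGroup.norm_mk_le ?_
    rw [List.length_dropLast, FreeGroup.norm]
    have := List.length_pos_iff.2 hL
    omega
  · have h : g = FreeGroup.mk g.toWord.dropLast * FreeGroup.mk [g.toWord.getLast hL] := by
      rw [FreeGroup.mul_mk, List.dropLast_append_getLast, FreeGroup.mk_toWord]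
    have ht : (FreeGroup.mk [(false, false)] : F2) = t⁻¹ := by
      simp [t, FreeGroup.of, FreeGroup.inv_mk, FreeGroup.invRev]
    have hc : (FreeGroup.mk [(true, false)] : F2) = c⁻¹ := by
      simp [c, FreeGroup.of, FreeGroup.inv_mk, FreeGroup.invRev]
    rcases hl : g.toWord.getLast hL with ⟨_ | _, _ | _⟩ <;> rw [hl] at h
    · exact .inr (.inl (ht ▸ h))
    · exact .inl h
    · exact .inr (.inr (.inr (hc ▸ h)))
    · exact .inr (.inr (.inl h))

theorem induction_right {P : F2 → Prop} (h1 : P 1) (ht : ∀ u, P u → P (u * t))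
    (ht' : ∀ u, P u → P (u * t⁻¹)) (hc : ∀ u, P u → P (u * c)) (hc' : ∀ u, P u → P (u * c⁻¹))
    (u : F2) : P u := by
  induction hn : u.norm using Nat.strong_induction_on generalizing u with
  | _ n ih =>
    by_cases hu : u = 1
    · rwa [hu]
    obtain ⟨g, hg, h⟩ := exists_shorter hu
    have := ih _ (hn ▸ hg) g rfl
    rcases h with rfl | rfl | rfl | rfl
    exacts [ht _ this, ht' _ this, hc _ this, hc' _ this]

/-- Connectedness of the Cayley graph. With `α = Prop` it propagates reachability and finiteness of
distances; applied to a difference it proves that two functions with equal increments agree. -/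
theorem eq_of_invariant {α : Type*} {f : F2 → α} (ht : ∀ u, f (u * t) = f u)
    (hc : ∀ u, f (u * c) = f u) (u : F2) : f u = f 1 := by
  induction u using induction_right with
  | h1 => rfl
  | ht u h => rw [ht, h]
  | ht' u h => rw [← ht, inv_mul_cancel_right, h]
  | hc u h => rw [hc, h]
  | hc' u h => rw [← hc, inv_mul_cancel_right, h]

/-- The lift of right multiplication by `s` to `F2 × ℤ` with increments given by `p`. -/
def liftStep (s : F2) (p : F2 → ℤ) : Equiv.Perm (F2 × ℤ) where
  toFun x := (x.1 * s, x.2 + p x.1)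
  invFun x := (x.1 * s⁻¹, x.2 - p (x.1 * s⁻¹))
  left_inv x := by simp
  right_inv x := by simp

/-- Since the Cayley graph of a free group is a tree, every function on its edges is a
coboundary. -/
theorem exists_primitive (p q : F2 → ℤ) : ∃ f : F2 → ℤ, f 1 = 0 ∧
    (∀ u, f (u * t) = f u + p u) ∧ ∀ u, f (u * c) = f u + q u := by
  -- By freeness, the two lifted steps define a right action, hence the opposite group. Following
  -- the orbit of `(1, 0)` lifts paths from the tree to `F2 × ℤ`.
  let Φ : F2 →* (Equiv.Perm (F2 × ℤ))ᵐᵒᵖ :=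
    FreeGroup.lift fun i => MulOpposite.op (if i then liftStep c q else liftStep t p)
  have Φt : Φ t = MulOpposite.op (liftStep t p) := by simp [Φ, t]
  have Φc : Φ c = MulOpposite.op (liftStep c q) := by simp [Φ, c]
  let F : F2 → F2 × ℤ := fun u => (Φ u).unop (1, 0)
  have Ft : ∀ u, F (u * t) = liftStep t p (F u) := fun u => by simp [F, Φt]
  have Fc : ∀ u, F (u * c) = liftStep c q (F u) := fun u => by simp [F, Φc]
  -- The first coordinate recovers `u`, so the second one is a well-defined function with the
  -- prescribed increments.
  have h1 : ∀ u, (F u).1 = u := by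
    have key := eq_of_invariant (f := fun u => (F u).1 * u⁻¹)
      (fun u => by simp only [Ft, liftStep, Equiv.coe_fn_mk]; group)
      (fun u => by simp only [Fc, liftStep, Equiv.coe_fn_mk]; group)
    intro u
    have := key u
    simpa [F, mul_inv_eq_one] using this
  refine ⟨fun u => (F u).2, by simp [F], fun u => ?_, fun u => ?_⟩
  · simp only [Ft, liftStep, Equiv.coe_fn_mk, h1]
  · simp only [Fc, liftStep, Equiv.coe_fn_mk, h1]

/-! ### The axis of `t` and the projection to it -/

/-- The subgroup generated by `t`. -/
abbrev T : Subgroup F2 := Subgroup.zpowers t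

theorem t_zpow_mem (n : ℤ) : t ^ n ∈ T := ⟨n, rfl⟩

theorem mul_t_mem {u : F2} : u * t ∈ T ↔ u ∈ T :=
  Subgroup.mul_mem_cancel_right _ (Subgroup.mem_zpowers t)

theorem mul_zpow_mem {u : F2} {n : ℤ} : u * t ^ n ∈ T ↔ u ∈ T :=
  Subgroup.mul_mem_cancel_right _ (t_zpow_mem n)

theorem c_notMem : c ∉ T := by
  rintro ⟨n, hn⟩
  -- The exponent sum of `c` vanishes on `T` and equals one at `c`.
  have := congrArg (FreeGroup.lift fun i => Multiplicative.ofAdd (if i then (1 : ℤ) else 0)) hn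
  simp only [t, c, map_zpow, FreeGroup.lift_apply_of] at this
  simp at this
  exact absurd this (by decide)

theorem mul_c_notMem {u : F2} (h : u ∈ T) : u * c ∉ T := fun h' =>
  c_notMem ((Subgroup.mul_mem_cancel_left _ h).1 h')

-- Increment one on the `t`-edges contained in `T` and zero on all other edges: each branch hanging
-- off the axis is collapsed to its attaching point.
open Classical in
theorem exists_tau : ∃ f : F2 → ℤ, f 1 = 0 ∧ (∀ u, f (u * t) = f u + if u ∈ T then 1 else 0) ∧
    ∀ u, f (u * c) = f u + 0 :=
  exists_primitive _ fun _ => 0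

/-- The projection to the axis of `t`. -/
def tau : F2 → ℤ := exists_tau.choose

open Classical in
theorem tau_spec : tau 1 = 0 ∧ (∀ u, tau (u * t) = tau u + if u ∈ T then 1 else 0) ∧
    ∀ u, tau (u * c) = tau u + 0 :=
  exists_tau.choose_spec

theorem tau_one : tau 1 = 0 := tau_spec.1

theorem tau_mul_c (u : F2) : tau (u * c) = tau u := by
  simpa using tau_spec.2.2 u

theorem tau_mul_c_inv (u : F2) : tau (u * c⁻¹) = tau u := by
  rw [← tau_mul_c, inv_mul_cancel_right]

theorem tau_mul_t_of_mem {u : F2} (h : u ∈ T) : tau (u * t) = tau u + 1 := by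
  simpa [h] using tau_spec.2.1 u

theorem tau_mul_t_of_notMem {u : F2} (h : u ∉ T) : tau (u * t) = tau u := by
  simpa [h] using tau_spec.2.1 u

theorem tau_mul_zpow_of_mem {u : F2} (h : u ∈ T) (n : ℤ) : tau (u * t ^ n) = tau u + n := by
  induction n using Int.induction_on with
  | zero => simp
  | succ n ih =>
    rw [zpow_add_one, ← mul_assoc, tau_mul_t_of_mem (mul_zpow_mem.2 h), ih, add_assoc]
  | pred n ih =>
    have := tau_mul_t_of_mem (mul_zpow_mem (n := -(n : ℤ) - 1) |>.2 h)
    rw [mul_assoc, ← zpow_add_one, sub_add_cancel, ih] at this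
    omega

theorem tau_zpow (n : ℤ) : tau (t ^ n) = n := by
  simpa [tau_one] using tau_mul_zpow_of_mem (one_mem T) n

theorem eq_zpow_tau {u : F2} (h : u ∈ T) : u = t ^ tau u := by
  obtain ⟨n, rfl⟩ := h
  exact congrArg (t ^ ·) (tau_zpow n).symm

theorem tau_mul_zpow_of_notMem {u : F2} (h : u ∉ T) (n : ℤ) : tau (u * t ^ n) = tau u := by
  induction n using Int.induction_on with
  | zero => simp
  | succ n ih => rw [zpow_add_one, ← mul_assoc, tau_mul_t_of_notMem (mt mul_zpow_mem.1 h), ih]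
  | pred n ih =>
    rw [← ih, ← tau_mul_t_of_notMem (mt (mul_zpow_mem (n := -(n : ℤ) - 1)).1 h), mul_assoc,
      ← zpow_add_one, sub_add_cancel]

/-- Left multiplication by `t ^ n` preserves `T`, so both sides have the same increments along
edges. -/
theorem tau_zpow_mul (n : ℤ) (u : F2) : tau (t ^ n * u) = tau u + n := by
  have hm : ∀ u : F2, t ^ n * u ∈ T ↔ u ∈ T := fun u =>
    Subgroup.mul_mem_cancel_left _ (t_zpow_mem n)
  have := eq_of_invariant (f := fun u => tau (t ^ n * u) - tau u) (fun u => ?_) (fun u => ?_) u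
  · simp only [mul_one, tau_one, tau_zpow] at this
    omega
  · by_cases h : u ∈ T
    · rw [← mul_assoc, tau_mul_t_of_mem h, tau_mul_t_of_mem ((hm u).2 h)]; ring
    · rw [← mul_assoc, tau_mul_t_of_notMem h, tau_mul_t_of_notMem (mt (hm u).1 h)]
  · rw [← mul_assoc, tau_mul_c, tau_mul_c]

theorem t_zpow_injective : Function.Injective fun n : ℤ => t ^ n := fun m n h => by
  simpa [tau_zpow] using congrArg tau h

theorem mul_t_ne (u : F2) : u * t ≠ u := fun h => by
  have := t_zpow_injective (a₁ := 1) (a₂ := 0) (by simpa using h)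
  omega

theorem mul_t_mul_t_ne (u : F2) : u * t * t ≠ u := fun h => by
  have := t_zpow_injective (a₁ := 2) (a₂ := 0) (by
    rw [mul_assoc, mul_eq_left] at h
    change t ^ (2 : ℤ) = t ^ (0 : ℤ)
    rw [zpow_two, h, zpow_zero])
  omega

theorem c_ne_one : c ≠ 1 := fun h => c_notMem (h ▸ one_mem T)

theorem mul_c_ne (u : F2) : u * c ≠ u := fun h => c_ne_one (by simpa using h)

/-! ### The side of the edge from `1` to `c` -/

open Classical in
theorem exists_z : ∃ f : F2 → ℤ, f 1 = 0 ∧ (∀ u, f (u * t) = f u + 0) ∧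
    ∀ u, f (u * c) = f u + if u = 1 then 1 else 0 :=
  exists_primitive (fun _ => 0) _

/-- The indicator function of the set of elements separated from `1` by the edge `{1, c}`. -/
def z : F2 → ℤ := exists_z.choose

open Classical in
theorem z_spec : z 1 = 0 ∧ (∀ u, z (u * t) = z u + 0) ∧
    ∀ u, z (u * c) = z u + if u = 1 then 1 else 0 :=
  exists_z.choose_spec

theorem z_one : z 1 = 0 := z_spec.1

theorem z_mul_t (u : F2) : z (u * t) = z u := by simpa using z_spec.2.1 u

theorem z_mul_zpow (u : F2) (n : ℤ) : z (u * t ^ n) = z u := by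
  induction n using Int.induction_on with
  | zero => simp
  | succ n ih => rw [zpow_add_one, ← mul_assoc, z_mul_t, ih]
  | pred n ih => rw [← ih, ← z_mul_t, mul_assoc, ← zpow_add_one, sub_add_cancel]

theorem z_c : z c = 1 := by simpa [z_one] using z_spec.2.2 1

theorem z_mul_c {u : F2} (h : u ≠ 1) : z (u * c) = z u := by
  simpa [h] using z_spec.2.2 u

theorem z_eq_zero_or_one (u : F2) : z u = 0 ∨ z u = 1 := by
  induction u using induction_right with
  | h1 => exact .inl z_one
  | ht u h => rwa [z_mul_t]
  | ht' u h => rwa [← z_mul_t, inv_mul_cancel_right]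
  | hc u h =>
    by_cases hu : u = 1
    · rw [hu, one_mul, z_c]; simp
    · rwa [z_mul_c hu]
  | hc' u h =>
    by_cases hu : u * c⁻¹ = 1
    · rw [hu, z_one]; simp
    · rwa [← z_mul_c hu, inv_mul_cancel_right]

/-- A function whose changes along edges all take place over the point `s` of the axis of `t`
takes a single value on the elements that project elsewhere. -/
theorem eq_of_tau_ne {α : Type*} {f : F2 → α} {s : ℤ}
    (ht : ∀ u, f (u * t) = f u ∨ tau u = s ∧ tau (u * t) = s)
    (hc : ∀ u, f (u * c) = f u ∨ tau u = s) {u : F2} (hu : tau u ≠ s) : f u = f (t ^ s) := by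
  classical
  have hT : ∀ u, u ∈ T → tau u = s → u = t ^ s := fun u h h' => h' ▸ eq_zpow_tau h
  -- Replacing `f` on the whole fibre over `s` by its value at `t ^ s` yields an invariant function:
  -- an edge entering or leaving the fibre is an edge of the axis, and its end in the fibre is `t ^
  -- s`.
  have := eq_of_invariant (f := fun u => if tau u = s then f (t ^ s) else f u)
    (fun u => ?_) (fun u => ?_) u
  · simp only [hu, if_false, tau_one] at this
    rw [this]
    split_ifs with h
    · rfl
    -- The constant is now `f 1`. To compare it with `f (t ^ s)`, walk along the axis: the two ends
    -- of an axis edge never both project to `s`, so `f` does not change.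
    · rcases lt_or_gt_of_ne h with h | h
      · obtain ⟨n, rfl⟩ := Int.eq_ofNat_of_zero_le h.le
        have : ∀ m : ℕ, m ≤ n → f (t ^ (m : ℤ)) = f 1 := by
          intro m
          induction m with
          | zero => simp
          | succ m ih =>
            intro hm
            have := ht (t ^ (m : ℤ))
            rw [← zpow_add_one, tau_zpow, tau_zpow] at this
            rw [Nat.cast_succ, ← ih (by omega)]
            exact this.resolve_right (by omega)
        exact (this n le_rfl).symm
      · obtain ⟨n, hn⟩ := Int.eq_ofNat_of_zero_le (neg_pos.2 h).le
        have : ∀ m : ℕ, m ≤ n → f (t ^ (-m : ℤ)) = f 1 := by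
          intro m
          induction m with
          | zero => simp
          | succ m ih =>
            intro hm
            have := ht (t ^ (-(m + 1 : ℕ) : ℤ))
            rw [← zpow_add_one, tau_zpow, tau_zpow] at this
            rw [← this.resolve_right (by omega), ← ih (by omega)]
            congr 2
            push_cast
            ring
        have h2 := this n le_rfl
        rw [← h2]
        congr 2
        omega
  · by_cases h1 : tau u = s <;> by_cases h2 : tau (u * t) = s
    · simp [h1, h2]
    · have hm : u ∈ T := by
        by_contra hm
        exact h2 ((tau_mul_t_of_notMem hm).trans h1)
      have := (ht u).resolve_right (fun h => h2 h.2)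
      simp only [h1, h2, if_true, if_false]
      rw [this, hT u hm h1]
    · have hm : u ∈ T := by
        by_contra hm
        exact h1 ((tau_mul_t_of_notMem hm).symm.trans h2)
      have := (ht u).resolve_right (fun h => h1 h.1)
      simp only [h1, h2, if_true, if_false]
      rw [← this, hT _ (mul_t_mem.2 hm) h2]
    · simp only [h1, h2, if_false]
      exact (ht u).resolve_right (fun h => h1 h.1)
  · simp only [tau_mul_c]
    split_ifs with h
    · rfl
    · exact (hc u).resolve_right h

/-- The edge from `w` to `w * c` lies over the point `tau w` of the axis, so all elements projecting
elsewhere are on the same side of it as the axis. -/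
theorem z_inv_mul_eq_of_tau_ne {u w : F2} (h : tau u ≠ tau w) :
    z (w⁻¹ * u) = z (w⁻¹ * t ^ tau w) := by
  refine eq_of_tau_ne (f := fun u => z (w⁻¹ * u)) (fun u => .inl ?_) (fun u => ?_) h
  · rw [← mul_assoc, z_mul_t]
  · by_cases hu : w⁻¹ * u = 1
    · exact .inr (by rw [inv_mul_eq_one.1 hu])
    · exact .inl (by rw [← mul_assoc, z_mul_c hu])

theorem z_eq_zero_of_tau_ne {u : F2} (h : tau u ≠ 0) : z u = 0 := by
  simpa [tau_one, z_one] using z_inv_mul_eq_of_tau_ne (u := u) (w := 1) (by rwa [tau_one])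

theorem z_c_mul_eq_one_of_tau_ne {u : F2} (h : tau u ≠ 0) : z (c * u) = 1 := by
  have hc : tau c⁻¹ = 0 := by simpa [tau_one] using tau_mul_c_inv 1
  simpa [hc, z_c] using z_inv_mul_eq_of_tau_ne (u := u) (w := c⁻¹) (by rwa [hc])

theorem tau_eq_of_inv_mul_mem {u w : F2} (hw : w ∉ T) (h : w⁻¹ * u ∈ T) : tau u = tau w := by
  obtain ⟨n, hn⟩ := h
  rw [eq_inv_mul_iff_mul_eq] at hn
  rw [← hn]
  exact tau_mul_zpow_of_notMem hw n

/-- The axis `w T` differs from `T`, so it lies over the single point `tau w`, and elements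
projecting elsewhere have the same projection to it. -/
theorem tau_inv_mul_eq_of_tau_ne {u w : F2} (hw : w ∉ T) (h : tau u ≠ tau w) :
    tau (w⁻¹ * u) = tau (w⁻¹ * t ^ tau w) := by
  refine eq_of_tau_ne (f := fun u => tau (w⁻¹ * u)) (fun u => ?_) (fun u => .inl ?_) h
  · by_cases hu : w⁻¹ * u ∈ T
    · refine .inr ⟨tau_eq_of_inv_mul_mem hw hu, tau_eq_of_inv_mul_mem hw ?_⟩
      rwa [← mul_assoc, mul_t_mem]
    · exact .inl (by rw [← mul_assoc, tau_mul_t_of_notMem hu])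
  · rw [← mul_assoc, tau_mul_c]

/-- Here `z (h * ·)` changes only along the edge from `h⁻¹` to `h⁻¹ * c`. One end of it lies outside
the open ball of radius `N`, and the reduced path from `1` to `u` stays inside. -/
theorem z_mul_eq_of_norm_lt {h : F2} {N : ℕ} (hN : N ≤ h⁻¹.norm ∨ N ≤ (h⁻¹ * c).norm) {u : F2}
    (hu : u.norm < N) : z (h * u) = z h := by
  induction hn : u.norm using Nat.strong_induction_on generalizing u with
  | _ n ih =>
    by_cases hu1 : u = 1
    · rw [hu1, mul_one]
    obtain ⟨g, hg, hgu⟩ := exists_shorter hu1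
    have h1 := ih _ (hn ▸ hg) (hg.trans hu) rfl
    rcases hgu with rfl | rfl | rfl | rfl
    · rw [← mul_assoc, z_mul_t, h1]
    · rw [← h1, ← z_mul_t, mul_assoc, inv_mul_cancel_right]
    · rw [← mul_assoc, z_mul_c, h1]
      intro hh
      rw [mul_eq_one_iff_inv_eq] at hh
      rw [hh] at hN
      omega
    · rw [← h1, ← z_mul_c, mul_assoc, inv_mul_cancel_right]
      intro hh
      rw [mul_eq_one_iff_inv_eq] at hh
      rw [hh, inv_mul_cancel_right] at hN
      omega

theorem z_inv_eq_zero {g : F2} (h : g.norm < (g * c).norm) : z g⁻¹ = 0 := by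
  rw [← z_mul_eq_of_norm_lt (.inr (by rw [inv_inv])) h, inv_mul_cancel, z_one]

theorem z_c_mul_inv_eq_one {g : F2} (h : g.norm < (g * c⁻¹).norm) : z (c * g⁻¹) = 1 := by
  rw [← z_mul_eq_of_norm_lt (h := c * g⁻¹) (.inl (by simp)) h, inv_mul_cancel_right, z_c]

end DiagonalPlanes

end

noncomputable section

namespace DiagonalPlanes

/-! # The complex made of planes joined by edges at their diagonal vertices -/

variable {V : Type*} {X : CubeFamily V}

/-- An identification of `X` with the complex obtained from a family of squared planes, indexed by
the cosets of `T` in `F2`, by joining the diagonal vertices `w` and `w * c` by edges, for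
`w : F2`. The coordinates in the plane `w * T` of the vertex `(w * t ^ n, k)` are `(n + k, n)`. -/
structure DiagModel (X : CubeFamily V) where
  e : F2 × ℤ ≃ V
  mem_cubes_iff : ∀ s : Set V, s ∈ X.cubes ↔ ∃ (w : F2) (k : ℤ), s = {e (w, k)} ∨
    s = {e (w, k), e (w, k + 1)} ∨ s = {e (w, k), e (w * t, k - 1)} ∨ s = {e (w, 0), e (w * c, 0)} ∨
    s = {e (w, k), e (w, k + 1), e (w * t, k - 1), e (w * t, k)}

namespace DiagModel

variable (D : DiagModel X)

/-- The vertices. -/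
def pt (w : F2) (k : ℤ) : V := D.e (w, k)

@[simp] theorem pt_inj {w w' : F2} {k k' : ℤ} : D.pt w k = D.pt w' k' ↔ w = w' ∧ k = k' := by
  simp [pt]

theorem exists_pt (v : V) : ∃ w k, v = D.pt w k :=
  ⟨(D.e.symm v).1, (D.e.symm v).2, (D.e.apply_symm_apply v).symm⟩

/-- The vertex set of a square. -/
def square (w : F2) (k : ℤ) : Set V :=
  {D.pt w k, D.pt w (k + 1), D.pt (w * t) (k - 1), D.pt (w * t) k}

theorem mem_cubes_iff' (s : Set V) : s ∈ X.cubes ↔ ∃ (w : F2) (k : ℤ), s = {D.pt w k} ∨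
    s = {D.pt w k, D.pt w (k + 1)} ∨ s = {D.pt w k, D.pt (w * t) (k - 1)} ∨
    s = {D.pt w 0, D.pt (w * c) 0} ∨ s = D.square w k :=
  D.mem_cubes_iff s

theorem singleton_mem (D : DiagModel X) (v : V) : {v} ∈ X.cubes := by
  obtain ⟨w, k, rfl⟩ := D.exists_pt v
  exact (D.mem_cubes_iff' _).2 ⟨w, k, .inl rfl⟩

theorem edge_x_mem (w : F2) (k : ℤ) : {D.pt w k, D.pt w (k + 1)} ∈ X.cubes :=
  (D.mem_cubes_iff' _).2 ⟨w, k, .inr (.inl rfl)⟩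

theorem edge_y_mem (w : F2) (k : ℤ) : {D.pt w k, D.pt (w * t) (k - 1)} ∈ X.cubes :=
  (D.mem_cubes_iff' _).2 ⟨w, k, .inr (.inr (.inl rfl))⟩

theorem edge_c_mem (w : F2) : {D.pt w 0, D.pt (w * c) 0} ∈ X.cubes :=
  (D.mem_cubes_iff' _).2 ⟨w, 0, .inr (.inr (.inr (.inl rfl)))⟩

theorem square_mem (w : F2) (k : ℤ) : D.square w k ∈ X.cubes :=
  (D.mem_cubes_iff' _).2 ⟨w, k, .inr (.inr (.inr (.inr rfl)))⟩

theorem edge_x_mem' (w : F2) (k : ℤ) : {D.pt (w * t) (k - 1), D.pt (w * t) k} ∈ X.cubes := by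
  simpa using D.edge_x_mem (w * t) (k - 1)

theorem edge_y_mem' (w : F2) (k : ℤ) : {D.pt w (k + 1), D.pt (w * t) k} ∈ X.cubes := by
  simpa using D.edge_y_mem w (k + 1)

theorem ne_x (w : F2) (k : ℤ) : D.pt w k ≠ D.pt w (k + 1) := by simp

theorem ne_y (w u : F2) (k l : ℤ) (h : u = w * t) : D.pt w k ≠ D.pt u l := by
  simp [h, (mul_t_ne w).symm]

theorem ne_c (w : F2) (k l : ℤ) : D.pt w k ≠ D.pt (w * c) l := by
  simp [(mul_c_ne w).symm]

/-- Oriented edges. -/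
def Edge (u v : V) : Prop :=
  ∃ w k, u = D.pt w k ∧ (v = D.pt w (k + 1) ∨ v = D.pt (w * t) (k - 1) ∨ k = 0 ∧ v = D.pt (w * c) 0)

theorem adj_iff {u v : V} : X.graph.Adj u v ↔ D.Edge u v ∨ D.Edge v u := by
  constructor
  · rintro ⟨hne, hc⟩
    obtain ⟨w, k, h | h | h | h | h⟩ := (D.mem_cubes_iff' _).1 hc
    · have hu : u ∈ ({D.pt w k} : Set V) := h ▸ Set.mem_insert _ _
      have hv : v ∈ ({D.pt w k} : Set V) := h ▸ Set.mem_insert_of_mem _ rfl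
      exact absurd (hu.trans hv.symm) hne
    · rcases Set.pair_eq_pair_iff.1 h with ⟨h1, h2⟩ | ⟨h1, h2⟩
      · exact .inl ⟨w, k, h1, .inl h2⟩
      · exact .inr ⟨w, k, h2, .inl h1⟩
    · rcases Set.pair_eq_pair_iff.1 h with ⟨h1, h2⟩ | ⟨h1, h2⟩
      · exact .inl ⟨w, k, h1, .inr (.inl h2)⟩
      · exact .inr ⟨w, k, h2, .inr (.inl h1)⟩
    · rcases Set.pair_eq_pair_iff.1 h with ⟨h1, h2⟩ | ⟨h1, h2⟩
      · exact .inl ⟨w, 0, h1, .inr (.inr ⟨rfl, h2⟩)⟩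
      · exact .inr ⟨w, 0, h2, .inr (.inr ⟨rfl, h1⟩)⟩
    · have hA : D.pt w k ∈ ({u, v} : Set V) := h ▸ by simp [square]
      have hB : D.pt w (k + 1) ∈ ({u, v} : Set V) := h ▸ by simp [square]
      have hC : D.pt (w * t) k ∈ ({u, v} : Set V) := h ▸ by simp [square]
      have h1 := D.ne_x w k
      have h2 := D.ne_y w _ k k rfl
      have h3 := D.ne_y w _ (k + 1) k rfl
      simp only [Set.mem_insert_iff, Set.mem_singleton_iff] at hA hB hC
      grind
  · have key : ∀ {u v : V}, D.Edge u v → X.graph.Adj u v := by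
      rintro u v ⟨w, k, rfl, rfl | rfl | ⟨rfl, rfl⟩⟩
      · exact ⟨D.ne_x w k, D.edge_x_mem w k⟩
      · exact ⟨D.ne_y _ _ _ _ rfl, D.edge_y_mem w k⟩
      · exact ⟨D.ne_c _ _ _, D.edge_c_mem w⟩
    rintro (h | h)
    · exact key h
    · exact (key h).symm

theorem adj_x (w : F2) (k : ℤ) : X.graph.Adj (D.pt w k) (D.pt w (k + 1)) :=
  D.adj_iff.2 (.inl ⟨w, k, rfl, .inl rfl⟩)

theorem adj_y (w : F2) (k : ℤ) : X.graph.Adj (D.pt w k) (D.pt (w * t) (k - 1)) :=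
  D.adj_iff.2 (.inl ⟨w, k, rfl, .inr (.inl rfl)⟩)

theorem adj_c (w : F2) : X.graph.Adj (D.pt w 0) (D.pt (w * c) 0) :=
  D.adj_iff.2 (.inl ⟨w, 0, rfl, .inr (.inr ⟨rfl, rfl⟩)⟩)

/-- A cube containing two opposite vertices of a square is this square. -/
theorem eq_square_of_mem {s : Set V} (hs : s ∈ X.cubes) {w : F2} {k : ℤ}
    (h : D.pt w k ∈ s ∧ D.pt (w * t) k ∈ s ∨ D.pt w (k + 1) ∈ s ∧ D.pt (w * t) (k - 1) ∈ s) :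
    s = D.square w k := by
  have h0 := mul_t_ne
  have h0' := fun w => (mul_t_ne w).symm
  have h2 := mul_t_mul_t_ne
  have h2' := fun w => (mul_t_mul_t_ne w).symm
  have hc : ∀ w, w * t ≠ w * c := fun w h => c_notMem (by
    rw [← mul_left_cancel h]; exact Subgroup.mem_zpowers t)
  have hc' : ∀ w, w * c * t ≠ w := fun w h => c_notMem (by
    rw [mul_assoc, mul_eq_left, mul_eq_one_iff_eq_inv] at h
    rw [h]; exact inv_mem (Subgroup.mem_zpowers t))
  obtain ⟨w', k', h' | h' | h' | h' | h'⟩ := (D.mem_cubes_iff' _).1 hs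
  · subst h'
    simp only [Set.mem_singleton_iff, pt_inj] at h
    grind
  · subst h'
    simp only [Set.mem_insert_iff, Set.mem_singleton_iff, pt_inj] at h
    grind
  · subst h'
    simp only [Set.mem_insert_iff, Set.mem_singleton_iff, pt_inj] at h
    grind
  · subst h'
    simp only [Set.mem_insert_iff, Set.mem_singleton_iff, pt_inj] at h
    grind
  · subst h'
    have : w' = w ∧ k' = k := by
      simp only [square, Set.mem_insert_iff, Set.mem_singleton_iff, pt_inj] at h
      grind
    rw [this.1, this.2]

theorem square_corners_ne (w : F2) (k : ℤ) :
    D.pt w k ≠ D.pt w (k + 1) ∧ D.pt w k ≠ D.pt (w * t) (k - 1) ∧ D.pt w k ≠ D.pt (w * t) k ∧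
    D.pt w (k + 1) ≠ D.pt (w * t) (k - 1) ∧ D.pt w (k + 1) ≠ D.pt (w * t) k ∧
    D.pt (w * t) (k - 1) ≠ D.pt (w * t) k := by
  simp [(mul_t_ne w).symm]

/-- Four vertices are the corners of a square, listed in such a way that the first and the fourth
one are opposite. -/
def IsLabelling (w : F2) (k : ℤ) (p q r s : V) : Prop :=
  ∀ P : V → V → V → V → Prop,
    P (D.pt w k) (D.pt w (k + 1)) (D.pt (w * t) (k - 1)) (D.pt (w * t) k) →
    P (D.pt w (k + 1)) (D.pt w k) (D.pt (w * t) k) (D.pt (w * t) (k - 1)) →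
    P (D.pt (w * t) (k - 1)) (D.pt (w * t) k) (D.pt w k) (D.pt w (k + 1)) →
    P (D.pt (w * t) k) (D.pt (w * t) (k - 1)) (D.pt w (k + 1)) (D.pt w k) →
    P (D.pt w k) (D.pt (w * t) (k - 1)) (D.pt w (k + 1)) (D.pt (w * t) k) →
    P (D.pt w (k + 1)) (D.pt (w * t) k) (D.pt w k) (D.pt (w * t) (k - 1)) →
    P (D.pt (w * t) (k - 1)) (D.pt w k) (D.pt (w * t) k) (D.pt w (k + 1)) →
    P (D.pt (w * t) k) (D.pt w (k + 1)) (D.pt (w * t) (k - 1)) (D.pt w k) → P p q r s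

theorem ncard_pair_le (u v : V) : ({u, v} : Set V).ncard ≤ 2 :=
  (Set.ncard_insert_le u {v}).trans (by simp)

theorem ncard_square (w : F2) (k : ℤ) : (D.square w k).ncard = 4 := by
  obtain ⟨h1, h2, h3, h4, h5, h6⟩ := D.square_corners_ne w k
  rw [square, Set.ncard_insert_of_notMem, Set.ncard_insert_of_notMem, Set.ncard_pair h6] <;>
    simp [*]

theorem ncard_le (D : DiagModel X) {s : Set V} (hs : s ∈ X.cubes) : s.ncard ≤ 2 ∨ ∃ w k, s = D.square w k := by
  obtain ⟨w, k, h | h | h | h | h⟩ := (D.mem_cubes_iff' _).1 hs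
  · exact .inl (by simp [h])
  · exact .inl (h ▸ ncard_pair_le _ _)
  · exact .inl (h ▸ ncard_pair_le _ _)
  · exact .inl (h ▸ ncard_pair_le _ _)
  · exact .inr ⟨w, k, h⟩

theorem pair_notMem (w : F2) (k : ℤ) {u v : V}
    (h : u = D.pt w k ∧ v = D.pt (w * t) k ∨ u = D.pt w (k + 1) ∧ v = D.pt (w * t) (k - 1)) :
    {u, v} ∉ X.cubes := fun hc => by
  have := D.eq_square_of_mem hc (w := w) (k := k) (by
    rcases h with ⟨rfl, rfl⟩ | ⟨rfl, rfl⟩ <;> simp)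
  have h4 := D.ncard_square w k
  rw [← this] at h4
  have := ncard_pair_le u v
  omega

/-- A diagonal of a square is not an edge, so among the orderings of the four corners only the eight
symmetries of the square survive. `IsLabelling` has the form of a recursor: a property of the four
vertices need only be checked on these eight. -/
theorem exists_labelling {p q r s : V} (hc : {p, q, r, s} ∈ X.cubes) (hps : p ≠ s)
    (hqr : q ≠ r) (hpq : X.graph.Adj p q) (hpr : X.graph.Adj p r) (hqs : X.graph.Adj q s)
    (hrs : X.graph.Adj r s) : ∃ w k, D.IsLabelling w k p q r s := by
  have hcard : ({p, q, r, s} : Set V).ncard = 4 := by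
    rw [Set.ncard_insert_of_notMem, Set.ncard_insert_of_notMem, Set.ncard_pair hrs.1] <;>
      simp [hps, hqr, hpq.1, hpr.1, hqs.1]
  obtain ⟨w, k, h⟩ := (D.ncard_le hc).resolve_left (by omega)
  refine ⟨w, k, ?_⟩
  have hp : p ∈ D.square w k := h ▸ by simp
  have hq : q ∈ D.square w k := h ▸ by simp
  have hr : r ∈ D.square w k := h ▸ by simp
  have hs : s ∈ D.square w k := h ▸ by simp
  have hpq0 := hpq.1
  have hpr0 := hpr.1
  have hqs0 := hqs.1
  have hrs0 := hrs.1
  have n1 : ∀ {a b : V}, X.graph.Adj a b → a = D.pt w k → b ≠ D.pt (w * t) k :=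
    fun hab h1 h2 => D.pair_notMem w k (.inl ⟨h1, h2⟩) hab.2
  have n2 : ∀ {a b : V}, X.graph.Adj a b → a = D.pt w (k + 1) → b ≠ D.pt (w * t) (k - 1) :=
    fun hab h1 h2 => D.pair_notMem w k (.inr ⟨h1, h2⟩) hab.2
  intro P h1 h2 h3 h4 h5 h6 h7 h8
  rcases hp with hp | hp | hp | hp <;> rcases hq with hq | hq | hq | hq <;>
    first
    | exact absurd (hp.trans hq.symm) hpq0
    | exact absurd hq (n1 hpq hp)
    | exact absurd hp (n1 hpq.symm hq)
    | exact absurd hq (n2 hpq hp)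
    | exact absurd hp (n2 hpq.symm hq)
    | skip
  all_goals
    rcases hr with hr | hr | hr | hr <;>
    first
    | exact absurd (hp.trans hr.symm) hpr0
    | exact absurd (hq.trans hr.symm) hqr
    | exact absurd hr (n1 hpr hp)
    | exact absurd hp (n1 hpr.symm hr)
    | exact absurd hr (n2 hpr hp)
    | exact absurd hp (n2 hpr.symm hr)
    | skip
  all_goals
    rcases hs with hs | hs | hs | hs <;>
    first
    | exact absurd (hp.trans hs.symm) hps
    | exact absurd (hq.trans hs.symm) hqs0
    | exact absurd (hr.trans hs.symm) hrs0
    | skip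
  all_goals
    subst hp
    subst hq
    subst hr
    subst hs
    assumption

/-! ## Charts -/

theorem cases_of_subset_square {A B C E : V} {u : Set V} (hu : u ⊆ {A, B, C, E})
    (hne : u.Nonempty) (h1 : ¬ (A ∈ u ∧ E ∈ u)) (h2 : ¬ (B ∈ u ∧ C ∈ u)) :
    u = {A} ∨ u = {B} ∨ u = {C} ∨ u = {E} ∨ u = {A, B} ∨ u = {A, C} ∨ u = {B, E} ∨ u = {C, E} := by
  have key : ∀ s : Set V, (∀ v, v = A ∨ v = B ∨ v = C ∨ v = E → (v ∈ u ↔ v ∈ s)) →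
      s ⊆ {A, B, C, E} → u = s :=
    fun s h h' => Set.ext fun v => ⟨fun hv => (h v (hu hv)).1 hv, fun hv => (h v (h' hv)).2 hv⟩
  obtain ⟨v, hv⟩ := hne
  have hv' : v = A ∨ v = B ∨ v = C ∨ v = E := hu hv
  by_cases hA : A ∈ u <;> by_cases hB : B ∈ u <;> by_cases hC : C ∈ u <;> by_cases hE : E ∈ u <;>
  first
    | exact (h1 ⟨hA, hE⟩).elim
    | exact (h2 ⟨hB, hC⟩).elim
    | (exfalso; grind)
    | exact .inl (key _ (by simp only [Set.mem_singleton_iff]; grind) (by simp))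
    | exact .inr (.inl (key _ (by simp only [Set.mem_singleton_iff]; grind) (by simp)))
    | exact .inr (.inr (.inl (key _ (by simp only [Set.mem_singleton_iff]; grind) (by simp))))
    | exact .inr (.inr (.inr (.inl (key _ (by simp only [Set.mem_singleton_iff]; grind) (by simp)))))
    | exact .inr (.inr (.inr (.inr (.inl (key _ (by
        simp only [Set.mem_insert_iff, Set.mem_singleton_iff]; grind) (by simp [Set.subset_def]))))))
    | exact .inr (.inr (.inr (.inr (.inr (.inl (key _ (by
        simp only [Set.mem_insert_iff, Set.mem_singleton_iff]; grind) (by simp [Set.subset_def])))))))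
    | exact .inr (.inr (.inr (.inr (.inr (.inr (.inl (key _ (by
        simp only [Set.mem_insert_iff, Set.mem_singleton_iff]; grind)
        (by simp [Set.subset_def]))))))))
    | exact .inr (.inr (.inr (.inr (.inr (.inr (.inr (key _ (by
        simp only [Set.mem_insert_iff, Set.mem_singleton_iff]; grind)
        (by simp [Set.subset_def]))))))))

/-- The chart of a vertex. -/
def chart0 (v : V) : (Fin 0 → Bool) → V := fun _ => v

/-- The chart of an edge. -/
def chart1 (u v : V) : (Fin 1 → Bool) → V := fun ε => if ε 0 = true then v else u

/-- The chart of a square. -/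
def chart2 (A B C E : V) : (Fin 2 → Bool) → V := fun ε =>
  if ε 0 = true then if ε 1 = true then E else B else if ε 1 = true then C else A

theorem ne_empty (D : DiagModel X) {s : Set V} (hs : s ∈ X.cubes) : s.Nonempty := by
  obtain ⟨w, k, h | h | h | h | h⟩ := (D.mem_cubes_iff' _).1 hs <;> rw [h]
  exacts [Set.singleton_nonempty _, Set.insert_nonempty _ _, Set.insert_nonempty _ _,
    Set.insert_nonempty _ _, Set.insert_nonempty _ _]

theorem isChart0 (D : DiagModel X) (v : V) : X.IsChart (chart0 v) := by
  have hr : Set.range (chart0 v) = {v} := by ext; simp [chart0, eq_comm]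
  refine ⟨fun _ _ _ => Subsingleton.elim _ _, hr ▸ D.singleton_mem v, fun s hs => ?_⟩
  rw [hr] at hs
  constructor
  · intro h
    rw [((D.ne_empty h).subset_singleton_iff).1 hs]
    exact ⟨∅, fun _ => true, by ext x; simpa [chart0, cubeFace] using eq_comm⟩
  · rintro ⟨I, a, rfl⟩
    convert D.singleton_mem v
    ext
    simp [chart0, cubeFace, eq_comm]

theorem range_chart1 (u v : V) : Set.range (chart1 u v) = {u, v} := by
  ext x
  constructor
  · rintro ⟨ε, rfl⟩
    unfold chart1
    split_ifs <;> simp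
  · rintro (rfl | rfl)
    · exact ⟨fun _ => false, by simp [chart1]⟩
    · exact ⟨fun _ => true, by simp [chart1]⟩

theorem image_chart1 (u v : V) (I : Set (Fin 1)) (a : Fin 1 → Bool) (x : V) :
    x ∈ chart1 u v '' cubeFace I a ↔
      ∃ i : Bool, (0 ∈ I → i = a 0) ∧ (if i = true then v else u) = x := by
  constructor
  · rintro ⟨ε, hε, rfl⟩
    exact ⟨ε 0, hε 0, rfl⟩
  · rintro ⟨i, h0, rfl⟩
    refine ⟨fun _ => i, fun j hj => ?_, rfl⟩
    rw [Subsingleton.elim j 0] at hj ⊢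
    exact h0 hj

theorem isChart1 (D : DiagModel X) {u v : V} (h : X.graph.Adj u v) : X.IsChart (chart1 u v) := by
  refine ⟨fun ε ε' hε => ?_, range_chart1 u v ▸ h.2, fun s hs => ?_⟩
  · funext i
    rw [Subsingleton.elim i 0]
    unfold chart1 at hε
    have := h.1
    cases h0 : ε 0 <;> cases h1 : ε' 0 <;> simp_all
  · rw [range_chart1] at hs
    constructor
    · intro hc
      rcases Set.subset_pair_iff_eq.1 hs with rfl | rfl | rfl | rfl
      · exact absurd (D.ne_empty hc) (by simp)
      · exact ⟨Set.univ, fun _ => false, by ext; rw [image_chart1]; simp [eq_comm]⟩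
      · exact ⟨Set.univ, fun _ => true, by ext; rw [image_chart1]; simp [eq_comm]⟩
      · exact ⟨∅, fun _ => true, by ext; rw [image_chart1]; simp [eq_comm]⟩
    · rintro ⟨I, a, rfl⟩
      by_cases h0 : (0 : Fin 1) ∈ I
      · convert D.singleton_mem (if a 0 = true then v else u)
        ext
        rw [image_chart1]
        simp only [h0, true_imp_iff, exists_eq_left, Set.mem_singleton_iff]
        exact eq_comm
      · convert h.2
        ext
        rw [image_chart1]
        simp [h0, eq_comm]

theorem image_chart2 (A B C E : V) (I : Set (Fin 2)) (a : Fin 2 → Bool) (x : V) :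
    x ∈ chart2 A B C E '' cubeFace I a ↔
      ∃ i j : Bool, (0 ∈ I → i = a 0) ∧ (1 ∈ I → j = a 1) ∧
        (if i = true then if j = true then E else B else if j = true then C else A) = x := by
  constructor
  · rintro ⟨ε, hε, rfl⟩
    exact ⟨ε 0, ε 1, hε 0, hε 1, rfl⟩
  · rintro ⟨i, j, h0, h1, rfl⟩
    refine ⟨![i, j], ?_, rfl⟩
    intro k hk
    fin_cases k
    · exact h0 hk
    · exact h1 hk

theorem range_chart2 (A B C E : V) : Set.range (chart2 A B C E) = {A, B, C, E} := by
  rw [← Set.image_univ, show (Set.univ : Set (Fin 2 → Bool)) = cubeFace ∅ fun _ => true by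
    ext; simp [cubeFace]]
  ext x
  rw [image_chart2]
  simp only [Set.mem_empty_iff_false, false_imp_iff, true_and, Bool.exists_bool,
    Set.mem_insert_iff, Set.mem_singleton_iff]
  grind

theorem isChart2 (w : F2) (k : ℤ) : X.IsChart
    (chart2 (D.pt w k) (D.pt w (k + 1)) (D.pt (w * t) (k - 1)) (D.pt (w * t) k)) := by
  obtain ⟨h1, h2, h3, h4, h5, h6⟩ := D.square_corners_ne w k
  have hsq := D.square_mem w k
  have hx := D.edge_x_mem w k
  have hx' := D.edge_x_mem' w k
  have hy := D.edge_y_mem w k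
  have hy' := D.edge_y_mem' w k
  have hm := fun (s : Set V) (hs : s ∈ X.cubes) => D.eq_square_of_mem hs (w := w) (k := k)
  unfold square at hsq hm
  generalize D.pt w k = A at *
  generalize D.pt w (k + 1) = B at *
  generalize D.pt (w * t) (k - 1) = C at *
  generalize D.pt (w * t) k = E at *
  refine ⟨fun ε ε' hε => ?_, range_chart2 A B C E ▸ hsq, fun s hs => ?_⟩
  · unfold chart2 at hε
    have : ε 0 = ε' 0 ∧ ε 1 = ε' 1 := by
      cases e0 : ε 0 <;> cases e1 : ε 1 <;> cases e2 : ε' 0 <;> cases e3 : ε' 1 <;>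
        simp [e0, e1, e2, e3] at hε ⊢ <;> grind
    funext i
    fin_cases i
    exacts [this.1, this.2]
  · rw [range_chart2] at hs
    constructor
    · intro hc
      -- A cube containing a diagonal is the whole square; otherwise only vertices and sides remain.
      by_cases hd : A ∈ s ∧ E ∈ s ∨ B ∈ s ∧ C ∈ s
      · rw [hm _ hc hd, ← range_chart2 A B C E]
        exact ⟨∅, fun _ => true, by rw [← Set.image_univ]; congr; ext; simp [cubeFace]⟩
      · rw [not_or] at hd
        rcases cases_of_subset_square hs (D.ne_empty hc) hd.1 hd.2 with
          rfl | rfl | rfl | rfl | rfl | rfl | rfl | rfl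
        · exact ⟨Set.univ, ![false, false], by ext; rw [image_chart2]; simp [eq_comm]⟩
        · exact ⟨Set.univ, ![true, false], by ext; rw [image_chart2]; simp [eq_comm]⟩
        · exact ⟨Set.univ, ![false, true], by ext; rw [image_chart2]; simp [eq_comm]⟩
        · exact ⟨Set.univ, ![true, true], by ext; rw [image_chart2]; simp [eq_comm]⟩
        · exact ⟨{1}, ![false, false], by ext; rw [image_chart2]; simp [eq_comm]⟩
        · exact ⟨{0}, ![false, false], by ext; rw [image_chart2]; simp [eq_comm]⟩
        · exact ⟨{0}, ![true, true], by ext; rw [image_chart2]; simp [eq_comm]⟩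
        · exact ⟨{1}, ![true, true], by ext; rw [image_chart2]; simp [eq_comm]⟩
    · rintro ⟨I, a, rfl⟩
      have key : ∀ {s s' : Set V}, s ∈ X.cubes → (∀ x, x ∈ s' ↔ x ∈ s) → s' ∈ X.cubes :=
        fun hs h => (Set.ext h) ▸ hs
      by_cases h0 : (0 : Fin 2) ∈ I <;> by_cases h1 : (1 : Fin 2) ∈ I
      · refine key (D.singleton_mem
          (if a 0 = true then if a 1 = true then E else B else if a 1 = true then C else A)) ?_
        intro x
        rw [image_chart2]
        simp only [h0, h1, true_imp_iff, exists_and_left, exists_eq_left, Set.mem_singleton_iff]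
        exact eq_comm
      · cases ha : a 0
        · exact key hy fun x => by rw [image_chart2]; simp [h0, h1, ha, eq_comm]
        · exact key hy' fun x => by rw [image_chart2]; simp [h0, h1, ha, eq_comm]
      · cases ha : a 1
        · exact key hx fun x => by rw [image_chart2]; simp [h0, h1, ha, eq_comm]
        · exact key hx' fun x => by rw [image_chart2]; simp [h0, h1, ha, eq_comm]
      · refine key hsq fun x => ?_
        rw [image_chart2]
        simp only [h0, h1, Bool.exists_bool, Set.mem_insert_iff,
          Set.mem_singleton_iff]
        grind

theorem isCubicalComplex (D : DiagModel X) : X.IsCubicalComplex where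
  singleton_mem := D.singleton_mem
  exists_chart s hs := by
    obtain ⟨w, k, rfl | rfl | rfl | rfl | rfl⟩ := (D.mem_cubes_iff' _).1 hs
    · exact ⟨0, _, D.isChart0 (D.pt w k), by ext; simp [chart0, eq_comm]⟩
    · exact ⟨1, _, D.isChart1 (D.adj_x w k), (range_chart1 _ _).symm⟩
    · exact ⟨1, _, D.isChart1 (D.adj_y w k), (range_chart1 _ _).symm⟩
    · exact ⟨1, _, D.isChart1 (D.adj_c w), (range_chart1 _ _).symm⟩
    · exact ⟨2, _, D.isChart2 w k, (range_chart2 _ _ _ _).symm⟩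
  inter_mem s hs s' hs' hne := by
    have hpair : ∀ u v : V, s = {u, v} → s ∩ s' ∈ X.cubes := by
      rintro u v h
      have h' : s ∩ s' ⊆ {u, v} := h ▸ Set.inter_subset_left
      rcases Set.subset_pair_iff_eq.1 h' with h' | h' | h' | h'
      · exact absurd hne (by simp [h'])
      · exact h' ▸ D.singleton_mem u
      · exact h' ▸ D.singleton_mem v
      · exact h' ▸ h ▸ hs
    obtain ⟨w, k, h | h | h | h | h⟩ := (D.mem_cubes_iff' _).1 hs
    · exact hpair (D.pt w k) (D.pt w k) (by simpa using h)
    · exact hpair _ _ h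
    · exact hpair _ _ h
    · exact hpair _ _ h
    -- If `s'` contains a diagonal of the square `s`, then `s' = s`; otherwise the intersection
    -- contains no diagonal, hence is a vertex or a side.
    · by_cases hd : D.pt w k ∈ s' ∧ D.pt (w * t) k ∈ s' ∨
          D.pt w (k + 1) ∈ s' ∧ D.pt (w * t) (k - 1) ∈ s'
      · rw [D.eq_square_of_mem hs' hd, h, Set.inter_self]
        exact h ▸ hs
      · rw [not_or] at hd
        have h' : s ∩ s' ⊆ D.square w k := h ▸ Set.inter_subset_left
        rcases cases_of_subset_square h' hne (fun hh => hd.1 ⟨hh.1.2, hh.2.2⟩)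
          (fun hh => hd.2 ⟨hh.1.2, hh.2.2⟩) with h' | h' | h' | h' | h' | h' | h' | h' <;> rw [h']
        exacts [D.singleton_mem _, D.singleton_mem _, D.singleton_mem _, D.singleton_mem _,
          D.edge_x_mem _ _, D.edge_y_mem _ _, D.edge_y_mem' _ _, D.edge_x_mem' _ _]

theorem isChart_le_two (D : DiagModel X) {n : ℕ} {φ : (Fin n → Bool) → V} (h : X.IsChart φ) : n ≤ 2 := by
  have h1 : (Set.range φ).ncard = 2 ^ n := by
    rw [← Set.image_univ, Set.ncard_image_of_injective _ h.injective, Set.ncard_univ]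
    simp
  have h2 : (Set.range φ).ncard ≤ 2 ^ 2 := by
    rcases D.ncard_le h.range_mem with h | ⟨w, k, h⟩
    · omega
    · rw [h, ncard_square]; norm_num
  rw [h1] at h2
  exact (Nat.pow_le_pow_iff_right (by norm_num)).1 h2

theorem isFiniteDimensional (D : DiagModel X) : X.IsFiniteDimensional := ⟨2, fun _ _ h => D.isChart_le_two h⟩

end DiagModel

end DiagonalPlanes

end

noncomputable section

namespace DiagonalPlanes

namespace DiagModel

variable {V : Type*} {X : CubeFamily V} (D : DiagModel X)

/-! ## Symmetries -/

/-- Left translation of an identification. -/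
def tr (w : F2) : DiagModel X where
  e := ((Equiv.mulLeft w).prodCongr (Equiv.refl ℤ)).trans D.e
  mem_cubes_iff s := by
    rw [D.mem_cubes_iff s]
    constructor
    · rintro ⟨u, k, h⟩
      exact ⟨w⁻¹ * u, k, by simpa [mul_assoc] using h⟩
    · rintro ⟨u, k, h⟩
      exact ⟨w * u, k, by simpa [mul_assoc] using h⟩

@[simp] theorem tr_pt (w u : F2) (k : ℤ) : (D.tr w).pt u k = D.pt (w * u) k := rfl

/-- The map exchanging the two coordinates in each plane. -/
def swapEquiv : F2 × ℤ ≃ F2 × ℤ where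
  -- In the plane `T`, `(t ^ n, k)` has coordinates `(n + k, n)`, and the exchanged pair `(n, n +
  -- k)` belongs to `(t ^ (n + k), -k)`.
  toFun p := (p.1 * t ^ p.2, -p.2)
  invFun p := (p.1 * t ^ p.2, -p.2)
  left_inv p := by simp
  right_inv p := by simp

theorem swapEquiv_apply (w : F2) (k : ℤ) : swapEquiv (w, k) = (w * t ^ k, -k) := rfl

/-- The identification obtained by exchanging the two coordinates in each plane. -/
def swap : DiagModel X where
  e := swapEquiv.trans D.e
  mem_cubes_iff s := by
    have h1 : ∀ (w : F2) (k : ℤ), w * t * t ^ (k - 1) = w * t ^ k := fun w k => by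
      rw [mul_assoc, ← zpow_one_add, add_sub_cancel]
    have h2 : ∀ (w : F2) (k : ℤ), w * t ^ (k + 1) = w * t ^ k * t := fun w k => by
      rw [mul_assoc, ← zpow_add_one]
    have h3 : ∀ (w : F2) (k : ℤ), w * t * t ^ k = w * t ^ k * t := fun w k => by
      rw [mul_assoc, ← zpow_one_add, add_comm, h2]
    have e1 : ∀ k : ℤ, -(k + 1) = -k - 1 := fun k => by ring
    have e2 : ∀ k : ℤ, -(k - 1) = -k + 1 := fun k => by ring
    rw [D.mem_cubes_iff s]
    simp only [Equiv.trans_apply, swapEquiv_apply, h1, h2, h3, e1, e2, zpow_zero, mul_one, neg_zero]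
    constructor
    · rintro ⟨w, k, h⟩
      have h4 : ∀ {P : F2 → ℤ → Prop}, P w k → P (w * t ^ k * t ^ (-k)) (- -k) := by simp
      rcases h with h | h | h | h | h
      · exact ⟨w * t ^ k, -k, .inl (h4 (P := fun w k => s = {D.e (w, k)}) h)⟩
      · exact ⟨w * t ^ k, -k, .inr (.inr (.inl
          (h4 (P := fun w k => s = {D.e (w, k), D.e (w, k + 1)}) h)))⟩
      · exact ⟨w * t ^ k, -k, .inr (.inl
          (h4 (P := fun w k => s = {D.e (w, k), D.e (w * t, k - 1)}) h))⟩
      · exact ⟨w, 0, .inr (.inr (.inr (.inl h)))⟩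
      · refine ⟨w * t ^ k, -k, .inr (.inr (.inr (.inr (h4 (P := fun w k => s =
          {D.e (w, k), D.e (w * t, k - 1), D.e (w, k + 1), D.e (w * t, k)}) (h.trans ?_)))))⟩
        rw [Set.insert_comm (D.e (w, k + 1))]
    · rintro ⟨w, k, h⟩
      rcases h with h | h | h | h | h
      · exact ⟨w * t ^ k, -k, .inl h⟩
      · exact ⟨w * t ^ k, -k, .inr (.inr (.inl h))⟩
      · exact ⟨w * t ^ k, -k, .inr (.inl h)⟩
      · exact ⟨w, 0, .inr (.inr (.inr (.inl h)))⟩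
      · refine ⟨w * t ^ k, -k, .inr (.inr (.inr (.inr (h.trans ?_))))⟩
        rw [Set.insert_comm (D.e (w * t ^ k * t, -k - 1))]

@[simp] theorem swap_pt (w : F2) (k : ℤ) : D.swap.pt w k = D.pt (w * t ^ k) (-k) := rfl

theorem image_mem_cubes (D' : DiagModel X) {s : Set V} (hs : s ∈ X.cubes) :
    (D.e.symm.trans D'.e) '' s ∈ X.cubes := by
  obtain ⟨w, k, h⟩ := (D.mem_cubes_iff s).1 hs
  refine (D'.mem_cubes_iff _).2 ⟨w, k, ?_⟩
  rcases h with rfl | rfl | rfl | rfl | rfl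
  · exact .inl (by simp)
  · exact .inr (.inl (by simp [Set.image_insert_eq]))
  · exact .inr (.inr (.inl (by simp [Set.image_insert_eq])))
  · exact .inr (.inr (.inr (.inl (by simp [Set.image_insert_eq]))))
  · exact .inr (.inr (.inr (.inr (by simp [Set.image_insert_eq]))))

/-- The isometry of `X` relating two identifications. -/
def isomTo (D' : DiagModel X) : X.isom :=
  ⟨D.e.symm.trans D'.e, fun s => ⟨fun h => by
    have := D'.image_mem_cubes D h
    rw [← Set.image_comp] at this
    convert this
    ext v
    simp, D.image_mem_cubes D'⟩⟩

@[simp] theorem isomTo_pt (D' : DiagModel X) (w : F2) (k : ℤ) :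
    (D.isomTo D').1 (D.pt w k) = D'.pt w k := by
  simp [isomTo, pt]

/-! ## Coordinates -/

open Classical in
/-- The first coordinate of the projection to the plane `T`. -/
def x (v : V) : ℤ := tau (D.e.symm v).1 + if (D.e.symm v).1 ∈ T then (D.e.symm v).2 else 0

/-- The second coordinate of the projection to the plane `T`. -/
def y (v : V) : ℤ := tau (D.e.symm v).1

/-- The projection to the edge joining `1` to `c`. -/
def z (v : V) : ℤ := DiagonalPlanes.z (D.e.symm v).1

@[simp] theorem y_pt (w : F2) (k : ℤ) : D.y (D.pt w k) = tau w := by simp [y, pt]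

@[simp] theorem z_pt (w : F2) (k : ℤ) : D.z (D.pt w k) = DiagonalPlanes.z w := by simp [z, pt]

theorem x_pt_of_mem {w : F2} (h : w ∈ T) (k : ℤ) : D.x (D.pt w k) = tau w + k := by
  simp [x, pt, h]

/-- Every other plane is attached to `T` through one diagonal vertex, so it projects entirely to
that vertex, whatever `k` is. -/
theorem x_pt_of_notMem {w : F2} (h : w ∉ T) (k : ℤ) : D.x (D.pt w k) = tau w := by
  simp [x, pt, h]

@[simp] theorem x_pt_zero (w : F2) : D.x (D.pt w 0) = tau w := by
  simp [x, pt]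

theorem x_pt_add_one_of_notMem {w : F2} (h : w ∉ T) (k : ℤ) :
    D.x (D.pt w (k + 1)) = D.x (D.pt w k) := by
  rw [D.x_pt_of_notMem h, D.x_pt_of_notMem h]

theorem x_pt_add_one_of_mem {w : F2} (h : w ∈ T) (k : ℤ) :
    D.x (D.pt w (k + 1)) = D.x (D.pt w k) + 1 := by
  rw [D.x_pt_of_mem h, D.x_pt_of_mem h, add_assoc]

theorem x_pt_mul_t (w : F2) (k : ℤ) : D.x (D.pt (w * t) (k - 1)) = D.x (D.pt w k) := by
  by_cases h : w ∈ T
  · rw [D.x_pt_of_mem h, D.x_pt_of_mem (mul_t_mem.2 h), tau_mul_t_of_mem h]; ring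
  · rw [D.x_pt_of_notMem h, D.x_pt_of_notMem (mt mul_t_mem.1 h), tau_mul_t_of_notMem h]

theorem x_pt_mul_c (w : F2) : D.x (D.pt (w * c) 0) = D.x (D.pt w 0) := by simp [tau_mul_c]

theorem pt_tr (w u : F2) (k : ℤ) : D.pt u k = (D.tr w).pt (w⁻¹ * u) k := by simp

theorem swap_x (v : V) : D.swap.x v = D.y v := by
  obtain ⟨w, k, rfl⟩ := D.swap.exists_pt v
  by_cases h : w ∈ T
  · rw [x_pt_of_mem _ h, swap_pt, y_pt, tau_mul_zpow_of_mem h]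
  · rw [x_pt_of_notMem _ h, swap_pt, y_pt, tau_mul_zpow_of_notMem h]

/-- Everything beyond the edge from `1` to `c` projects to its attaching point, the origin of `T`.
-/
theorem x_eq_zero_of_z {v : V} (h : D.z v = 1) : D.x v = 0 ∧ D.y v = 0 := by
  obtain ⟨u, k, rfl⟩ := D.exists_pt v
  rw [z_pt] at h
  have h0 : tau u = 0 := by
    by_contra h0
    rw [z_eq_zero_of_tau_ne h0] at h
    exact zero_ne_one h
  have hT : u ∉ T := by
    rintro ⟨n, rfl⟩
    have := z_mul_zpow 1 n
    rw [one_mul, z_one] at this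
    exact zero_ne_one (this.symm.trans h)
  rw [D.x_pt_of_notMem hT, y_pt]
  exact ⟨h0, h0⟩

/-- The same statement seen from the plane `c T` at the other end of the edge. -/
theorem x_tr_eq_zero_of_z {v : V} (h : D.z v = 0) : (D.tr c).x v = 0 ∧ (D.tr c).y v = 0 := by
  obtain ⟨u, k, rfl⟩ := (D.tr c).exists_pt v
  rw [tr_pt, z_pt] at h
  have h0 : tau u = 0 := by
    by_contra h0
    rw [z_c_mul_eq_one_of_tau_ne h0] at h
    exact one_ne_zero h
  have hT : u ∉ T := by
    rintro ⟨n, rfl⟩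
    rw [z_mul_zpow, z_c] at h
    exact one_ne_zero h
  rw [x_pt_of_notMem _ hT, y_pt]
  exact ⟨h0, h0⟩

theorem tr_t_zpow_x (n : ℤ) (v : V) : (D.tr (t ^ n)).x v = D.x v - n := by
  obtain ⟨u, k, rfl⟩ := (D.tr (t ^ n)).exists_pt v
  have hm : t ^ n * u ∈ T ↔ u ∈ T := Subgroup.mul_mem_cancel_left _ (t_zpow_mem n)
  by_cases h : u ∈ T
  · rw [x_pt_of_mem _ h, tr_pt, D.x_pt_of_mem (hm.2 h), tau_zpow_mul]; ring
  · rw [x_pt_of_notMem _ h, tr_pt, D.x_pt_of_notMem (mt hm.1 h), tau_zpow_mul]; ring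

theorem tr_t_zpow_y (n : ℤ) (v : V) : (D.tr (t ^ n)).y v = D.y v - n := by
  obtain ⟨u, k, rfl⟩ := (D.tr (t ^ n)).exists_pt v
  rw [y_pt, tr_pt, y_pt, tau_zpow_mul]
  ring

theorem x_lipschitz_of_adj {u v : V} (h : X.graph.Adj u v) : |D.x u - D.x v| ≤ 1 := by
  have key : ∀ {u v : V}, D.Edge u v → |D.x u - D.x v| ≤ 1 := by
    rintro u v ⟨w, k, rfl, rfl | rfl | ⟨rfl, rfl⟩⟩
    · by_cases h : w ∈ T
      · rw [D.x_pt_add_one_of_mem h]; simp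
      · rw [D.x_pt_add_one_of_notMem h]; simp
    · rw [x_pt_mul_t]; simp
    · rw [x_pt_mul_c]; simp
  rcases D.adj_iff.1 h with h | h
  · exact key h
  · rw [abs_sub_comm]
    exact key h

/-! ## Half-spaces -/

/-- The vertices with positive first coordinate. -/
def HX : Set V := {v | 1 ≤ D.x v}

/-- The vertices separated from `1` by the edge joining `1` to `c`. -/
def HZ : Set V := {v | D.z v = 1}

/-- The edge `e` joins a point of `A` to a point of its complement. -/
def Cross (A : Set V) (e : Sym2 V) : Prop := ∃ u v, e = s(u, v) ∧ u ∈ A ∧ v ∉ A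

theorem cross_iff {A : Set V} {u v : V} : Cross A s(u, v) ↔ ¬ (u ∈ A ↔ v ∈ A) := by
  constructor
  · rintro ⟨u', v', h, hu, hv⟩ h'
    rcases Sym2.eq_iff.1 h with ⟨rfl, rfl⟩ | ⟨rfl, rfl⟩
    · exact hv (h'.1 hu)
    · exact hv (h'.2 hu)
  · intro h
    by_cases hu : u ∈ A
    · exact ⟨u, v, rfl, hu, fun hv => h (by simp [hu, hv])⟩
    · exact ⟨v, u, Sym2.eq_swap, by tauto, hu⟩

/-- If `A` is invariant under `b`-steps, then in each square the two `b`-sides do not cross `A` and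
the two `a`-sides cross it together. Hence crossing is constant on walls. -/
theorem cross_iff_of_wall {A : Set V}
    (hA : ∀ w k, D.pt (w * t) (k - 1) ∈ A ↔ D.pt w k ∈ A) {e f : Sym2 V} (h : f ∈ X.wall e) :
    Cross A e ↔ Cross A f := by
  induction (show Relation.EqvGen X.AreOpposite e f from h) with
  | rel e f ho =>
    obtain ⟨v, w, v', w', rfl, rfl, h1, h2, h3, h4, h5, h6, h7⟩ := ho
    obtain ⟨u, k, hl⟩ := D.exists_labelling h7 h1 h2 h3 h5 h6 h4
    have hA1 := hA u k
    have hA2 := hA u (k + 1)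
    rw [add_sub_cancel_right] at hA2
    rw [cross_iff, cross_iff]
    refine hl (fun p q r s => ¬ (p ∈ A ↔ q ∈ A) ↔ ¬ (r ∈ A ↔ s ∈ A)) ?_ ?_ ?_ ?_ ?_ ?_ ?_ ?_ <;>
      tauto
  | refl _ => rfl
  | symm _ _ hh ih => exact (ih hh).symm
  | trans _ _ _ h1 h2 ih1 ih2 => exact (ih1 h1).trans (ih2 h2)

/-- If the wall of `e` consists of the edges crossing `A`, and if `A` and its complement are
connected, then these are the half-spaces defined by `e`. -/
theorem component_eq {A : Set V} {e : Sym2 V}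
    (hA : ∀ u v, X.graph.Adj u v → s(u, v) ∈ X.wall e → Cross A s(u, v))
    (hA' : ∀ u v, X.graph.Adj u v → Cross A s(u, v) → s(u, v) ∈ X.wall e)
    (hconn : ∀ H : SimpleGraph V, (∀ u v, X.graph.Adj u v → (u ∈ A ↔ v ∈ A) → H.Adj u v) →
      ∃ p q, p ∈ A ∧ q ∉ A ∧ ∀ u, u ∈ A ∧ H.Reachable p u ∨ u ∉ A ∧ H.Reachable q u) (v : V) :
    (v ∈ A → {u | (X.graph.deleteEdges (X.wall e)).Reachable v u} = A) ∧
    (v ∉ A → {u | (X.graph.deleteEdges (X.wall e)).Reachable v u} = Aᶜ) := by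
  obtain ⟨p, q, hp, hq, h⟩ := hconn (X.graph.deleteEdges (X.wall e)) fun u v huv hA0 => by
    rw [SimpleGraph.deleteEdges_adj]
    exact ⟨huv, fun hw => cross_iff.1 (hA u v huv hw) hA0⟩
  have hside : ∀ {u v : V}, (X.graph.deleteEdges (X.wall e)).Reachable u v → (u ∈ A ↔ v ∈ A) := by
    rintro u v ⟨W⟩
    induction W with
    | nil => rfl
    | cons hadj _ ih =>
      rw [SimpleGraph.deleteEdges_adj] at hadj
      refine Iff.trans ?_ ih
      by_contra hc
      exact hadj.2 (hA' _ _ hadj.1 (cross_iff.2 hc))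
  constructor
  · intro hv
    ext u
    refine ⟨fun hu => (hside hu).1 hv, fun hu => ?_⟩
    have h1 := (h u).resolve_right fun hh => hh.1 hu
    have h2 := (h v).resolve_right fun hh => hh.1 hv
    exact h2.2.symm.trans h1.2
  · intro hv
    ext u
    refine ⟨fun hu hu' => hv ((hside hu).2 hu'), fun hu => ?_⟩
    have h1 := (h u).resolve_left fun hh => hu hh.1
    have h2 := (h v).resolve_left fun hh => hv hh.1
    exact h2.2.symm.trans h1.2

theorem reachable_of_steps {H : SimpleGraph V} {f : ℤ → V} {i j : ℤ} (hij : i ≤ j)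
    (h : ∀ l, i ≤ l → l < j → H.Reachable (f l) (f (l + 1))) : H.Reachable (f i) (f j) := by
  induction j, hij using Int.leInduction with
  | base => exact .refl _
  | succ j hij ih =>
    exact (ih fun l h1 h2 => h l h1 (by omega)).trans (h j hij (by omega))

theorem reachable_of_forall_steps {H : SimpleGraph V} {f : ℤ → V}
    (h : ∀ l, H.Reachable (f l) (f (l + 1))) (i j : ℤ) : H.Reachable (f i) (f j) := by
  rcases le_total i j with hij | hij
  · exact reachable_of_steps hij fun l _ _ => h l
  · exact (reachable_of_steps hij fun l _ _ => h l).symm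

/-- `H` contains all edges except those joining `x = 0` to `x = 1`, all of which lie in the plane
`T`. -/
theorem connected_HX (H : SimpleGraph V)
    (hH : ∀ u v, X.graph.Adj u v → (u ∈ D.HX ↔ v ∈ D.HX) → H.Adj u v) (v : V) :
    v ∈ D.HX ∧ H.Reachable (D.pt 1 1) v ∨ v ∉ D.HX ∧ H.Reachable (D.pt 1 0) v := by
  have hx : ∀ w k, w ∉ T → H.Adj (D.pt w k) (D.pt w (k + 1)) := fun w k hw =>
    hH _ _ (D.adj_x w k) (by simp only [HX, Set.mem_ofPred_eq, D.x_pt_add_one_of_notMem hw])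
  have hy : ∀ w k, H.Adj (D.pt w k) (D.pt (w * t) (k - 1)) := fun w k =>
    hH _ _ (D.adj_y w k) (by simp only [HX, Set.mem_ofPred_eq, D.x_pt_mul_t])
  have hc : ∀ w, H.Adj (D.pt w 0) (D.pt (w * c) 0) := fun w =>
    hH _ _ (D.adj_c w) (by simp only [HX, Set.mem_ofPred_eq, D.x_pt_mul_c])
  -- The branch hanging off a diagonal vertex has constant `x`, so it is joined to that vertex
  -- within `H`.
  have fiber : ∀ w, H.Reachable (D.pt w 0) (D.pt (t ^ tau w) 0) := by
    intro w
    have := eq_of_invariant (f := fun w => H.Reachable (D.pt w 0) (D.pt (t ^ tau w) 0))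
      (fun w => ?_) (fun w => ?_) w
    · rw [this, tau_one, zpow_zero]
    · by_cases hw : w ∈ T
      · rw [← eq_zpow_tau hw, ← eq_zpow_tau (mul_t_mem.2 hw)]
        exact propext ⟨fun _ => .refl _, fun _ => .refl _⟩
      · rw [tau_mul_t_of_notMem hw]
        have h1 : H.Reachable (D.pt w 0) (D.pt (w * t) 0) := by
          have := hy w 1
          rw [sub_self] at this
          exact (hx w 0 hw).reachable.trans this.reachable
        exact propext ⟨h1.trans, h1.symm.trans⟩
    · rw [tau_mul_c]
      exact propext ⟨(hc w).reachable.trans, (hc w).symm.reachable.trans⟩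
  -- `(t ^ j, i - j)` is the vertex `(i, j)`. It is reached along the row of `1`, away from the
  -- wall, and then along a column.
  have plane : ∀ i j : ℤ, 1 ≤ i ∧ H.Reachable (D.pt 1 1) (D.pt (t ^ j) (i - j)) ∨
      ¬ 1 ≤ i ∧ H.Reachable (D.pt 1 0) (D.pt (t ^ j) (i - j)) := by
    intro i j
    have h1 : H.Reachable (D.pt 1 i) (D.pt (t ^ j) (i - j)) := by
      have := reachable_of_forall_steps (H := H) (f := fun j => D.pt (t ^ j) (i - j)) (fun l => by
        have := hy (t ^ l) (i - l)
        rw [← zpow_add_one, sub_sub] at this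
        exact this.reachable) 0 j
      simpa using this
    have h2 : ∀ l : ℤ, l ≠ 0 → H.Adj (D.pt 1 l) (D.pt 1 (l + 1)) := fun l hl =>
      hH _ _ (D.adj_x 1 l) (by
        simp only [HX, Set.mem_ofPred_eq, D.x_pt_of_mem (one_mem T), tau_one]
        omega)
    by_cases hi : 1 ≤ i
    · exact .inl ⟨hi, (reachable_of_steps (f := D.pt 1) hi fun l hl _ =>
        (h2 l (by omega)).reachable).trans h1⟩
    · exact .inr ⟨hi, (reachable_of_steps (f := D.pt 1) (j := 0) (by omega) fun l _ hl =>
        (h2 l (by omega)).reachable).symm.trans h1⟩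
  obtain ⟨w, k, rfl⟩ := D.exists_pt v
  by_cases hw : w ∈ T
  · have := plane (tau w + k) (tau w)
    rw [← eq_zpow_tau hw, add_sub_cancel_left] at this
    simpa only [HX, Set.mem_ofPred_eq, D.x_pt_of_mem hw] using this
  · have h0 : H.Reachable (D.pt (t ^ tau w) 0) (D.pt w k) := (fiber w).symm.trans
      (reachable_of_forall_steps (f := D.pt w) (fun l => (hx w l hw).reachable) 0 k)
    have := plane (tau w) (tau w)
    rw [sub_self] at this
    simp only [HX, Set.mem_ofPred_eq, D.x_pt_of_notMem hw]
    exact this.imp (fun h => ⟨h.1, h.2.trans h0⟩) fun h => ⟨h.1, h.2.trans h0⟩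

theorem connected_HZ (H : SimpleGraph V)
    (hH : ∀ u v, X.graph.Adj u v → (u ∈ D.HZ ↔ v ∈ D.HZ) → H.Adj u v) (v : V) :
    v ∈ D.HZ ∧ H.Reachable (D.pt c 0) v ∨ v ∉ D.HZ ∧ H.Reachable (D.pt 1 0) v := by
  have hx : ∀ w k, H.Adj (D.pt w k) (D.pt w (k + 1)) := fun w k =>
    hH _ _ (D.adj_x w k) (by simp [HZ])
  have hy : ∀ w k, H.Adj (D.pt w k) (D.pt (w * t) (k - 1)) := fun w k =>
    hH _ _ (D.adj_y w k) (by simp [HZ, z_mul_t])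
  have hc : ∀ w, w ≠ 1 → H.Adj (D.pt w 0) (D.pt (w * c) 0) := fun w hw =>
    hH _ _ (D.adj_c w) (by simp [HZ, z_mul_c hw])
  have fiber : ∀ w, H.Reachable (D.pt (if DiagonalPlanes.z w = 1 then c else 1) 0) (D.pt w 0) := by
    intro w
    have := eq_of_invariant (f := fun w =>
      H.Reachable (D.pt (if DiagonalPlanes.z w = 1 then c else 1) 0) (D.pt w 0))
      (fun w => ?_) (fun w => ?_) w
    · rw [this, z_one]
      simp
    · rw [z_mul_t]
      have h1 : H.Reachable (D.pt w 0) (D.pt (w * t) 0) := by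
        have := hy w 1
        rw [sub_self] at this
        exact (hx w 0).reachable.trans this.reachable
      exact propext ⟨fun h => h.trans h1.symm, fun h => h.trans h1⟩
    · by_cases hw : w = 1
      · simp [hw, z_one, z_c]
      · rw [z_mul_c hw]
        exact propext ⟨fun h => h.trans (hc w hw).symm.reachable,
          fun h => h.trans (hc w hw).reachable⟩
  obtain ⟨w, k, rfl⟩ := D.exists_pt v
  have h0 := (fiber w).trans
    (reachable_of_forall_steps (f := D.pt w) (fun l => (hx w l).reachable) 0 k)
  simp only [HZ, Set.mem_ofPred_eq, z_pt]
  by_cases h : DiagonalPlanes.z w = 1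
  · rw [if_pos h] at h0
    exact .inl ⟨h, h0⟩
  · rw [if_neg h] at h0
    exact .inr ⟨h, h0⟩

theorem connected (D : DiagModel X) : X.graph.Connected := by
  have : Nonempty V := ⟨D.pt 1 0⟩
  rw [SimpleGraph.connected_iff]
  refine ⟨?_, this⟩
  have key : ∀ v, X.graph.Reachable (D.pt 1 0) v := fun v => by
    rcases D.connected_HX X.graph (fun _ _ h _ => h) v with h | h
    · exact (D.adj_x 1 0).reachable.trans h.2
    · exact h.2
  exact fun u v => (key u).symm.trans (key v)

/-- This is the edge from `(0, n)` to `(1, n)`; consecutive ones are opposite sides of a square. -/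
theorem edge_mem_wall_x (n : ℤ) : s(D.pt (t ^ n) (-n), D.pt (t ^ n) (-n + 1)) ∈
    X.wall s(D.pt 1 0, D.pt 1 1) := by
  have key : ∀ n : ℤ, X.AreOpposite s(D.pt (t ^ n) (-n), D.pt (t ^ n) (-n + 1))
      s(D.pt (t ^ (n + 1)) (-(n + 1)), D.pt (t ^ (n + 1)) (-(n + 1) + 1)) := by
    intro n
    have e1 : -(n + 1) + 1 = -n := by ring
    have e2 : -(n + 1) = -n - 1 := by ring
    rw [e1, e2, zpow_add_one]
    obtain ⟨h1, h2, h3, h4, h5, h6⟩ := D.square_corners_ne (t ^ n) (-n)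
    refine ⟨_, _, _, _, rfl, rfl, h3, h4, D.adj_x _ _, ?_, D.adj_y _ _, ?_, D.square_mem _ _⟩
    · simpa using D.adj_x (t ^ n * t) (-n - 1)
    · simpa using D.adj_y (t ^ n) (-n + 1)
  change Relation.EqvGen _ _ _
  induction n using Int.induction_on with
  | zero => simpa using Relation.EqvGen.refl _
  | succ n ih => exact .trans _ _ _ ih (.rel _ _ (key n))
  | pred n ih =>
    have := key (-(n : ℤ) - 1)
    rw [sub_add_cancel] at this
    exact .trans _ _ _ ih (.symm _ _ (.rel _ _ this))

theorem component_HX (v : V) :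
    (v ∈ D.HX → {u | (X.graph.deleteEdges (X.wall s(D.pt 1 0, D.pt 1 1))).Reachable v u} = D.HX) ∧
    (v ∉ D.HX →
      {u | (X.graph.deleteEdges (X.wall s(D.pt 1 0, D.pt 1 1))).Reachable v u} = D.HXᶜ) := by
  refine component_eq (fun u v _ h => ?_) (fun u v h hc => ?_)
    (fun H hH => ⟨D.pt 1 1, D.pt 1 0, ?_, ?_, D.connected_HX H hH⟩) v
  · refine (D.cross_iff_of_wall (fun w k => ?_) h).1 (cross_iff.2 ?_)
    · simp only [HX, Set.mem_ofPred_eq, x_pt_mul_t]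
    · simp [HX, x_pt_of_mem _ (one_mem T), tau_one]
  · have key : ∀ {u v : V}, D.Edge u v → Cross D.HX s(u, v) →
        s(u, v) ∈ X.wall s(D.pt 1 0, D.pt 1 1) := by
      rintro u v ⟨w, k, rfl, rfl | rfl | ⟨rfl, rfl⟩⟩ hc <;> rw [cross_iff] at hc
      · by_cases hw : w ∈ T
        · simp only [HX, Set.mem_ofPred_eq, x_pt_of_mem _ hw] at hc
          have := D.edge_mem_wall_x (tau w)
          rw [← eq_zpow_tau hw] at this
          have e : k = - tau w := by omega
          rwa [e]
        · simp only [HX, Set.mem_ofPred_eq, D.x_pt_add_one_of_notMem hw] at hc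
          exact absurd trivial hc
      · simp only [HX, Set.mem_ofPred_eq, D.x_pt_mul_t] at hc
        exact absurd trivial hc
      · simp only [HX, Set.mem_ofPred_eq, D.x_pt_mul_c] at hc
        exact absurd trivial hc
    rcases D.adj_iff.1 h with h | h
    · exact key h hc
    · rw [Sym2.eq_swap (a := u)] at hc ⊢
      exact key h hc
  · simp [HX, x_pt_of_mem _ (one_mem T), tau_one]
  · simp [HX, x_pt_of_mem _ (one_mem T), tau_one]

theorem component_HZ (v : V) :
    (v ∈ D.HZ → {u | (X.graph.deleteEdges (X.wall s(D.pt 1 0, D.pt c 0))).Reachable v u} = D.HZ) ∧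
    (v ∉ D.HZ →
      {u | (X.graph.deleteEdges (X.wall s(D.pt 1 0, D.pt c 0))).Reachable v u} = D.HZᶜ) := by
  refine component_eq (fun u v _ h => ?_) (fun u v h hc => ?_)
    (fun H hH => ⟨D.pt c 0, D.pt 1 0, ?_, ?_, D.connected_HZ H hH⟩) v
  · refine (D.cross_iff_of_wall (fun w k => ?_) h).1 (cross_iff.2 ?_)
    · simp [HZ, z_mul_t]
    · simp [HZ, z_one, z_c]
  · have key : ∀ {u v : V}, D.Edge u v → Cross D.HZ s(u, v) →
        s(u, v) ∈ X.wall s(D.pt 1 0, D.pt c 0) := by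
      rintro u v ⟨w, k, rfl, rfl | rfl | ⟨rfl, rfl⟩⟩ hc <;> rw [cross_iff] at hc
      · simp [HZ] at hc
      · simp [HZ, z_mul_t] at hc
      · by_cases hw : w = 1
        · rw [hw, one_mul]
          exact Relation.EqvGen.refl _
        · simp [HZ, z_mul_c hw] at hc
    rcases D.adj_iff.1 h with h | h
    · exact key h hc
    · rw [Sym2.eq_swap (a := u)] at hc ⊢
      exact key h hc
  · simp [HZ, z_c]
  · simp [HZ, z_one]

theorem isHalfSpace_HX : X.IsHalfSpace D.HX :=
  ⟨s(D.pt 1 0, D.pt 1 1), D.adj_x 1 0, D.pt 1 1, ((D.component_HX _).1 (by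
    simp [HX, x_pt_of_mem _ (one_mem T), tau_one])).symm⟩

theorem isHalfSpace_HX_compl : X.IsHalfSpace D.HXᶜ :=
  ⟨s(D.pt 1 0, D.pt 1 1), D.adj_x 1 0, D.pt 1 0, ((D.component_HX _).2 (by
    simp [HX, tau_one])).symm⟩

theorem isHalfSpace_HZ : X.IsHalfSpace D.HZ :=
  ⟨s(D.pt 1 0, D.pt c 0), by simpa using D.adj_c 1, D.pt c 0, ((D.component_HZ _).1 (by
    simp [HZ, z_c])).symm⟩

theorem wall_eq_of_mem {e f : Sym2 V} (h : f ∈ X.wall e) : X.wall f = X.wall e := by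
  ext g
  exact ⟨fun hg => .trans _ _ _ h hg, fun hg => .trans _ _ _ (.symm _ _ h) hg⟩

/-- The half-spaces of `X`. -/
theorem halfSpace_cases {h : Set V} (hh : X.IsHalfSpace h) : ∃ D' : DiagModel X,
    (∃ w, D' = D.tr w ∨ D' = D.swap.tr w) ∧
    (h = D'.HX ∨ h = D'.HXᶜ ∨ h = D'.HZ ∨ h = D'.HZᶜ) := by
  obtain ⟨e, he, v, rfl⟩ := hh
  -- Slide an `a`-edge along its wall until it starts at the diagonal vertex `w * t ^ k` of the same
  -- column. Translation then makes it the base edge.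
  have hxe : ∀ (E : DiagModel X) (w : F2) (k : ℤ),
      X.wall s(E.pt w k, E.pt w (k + 1)) =
        X.wall s((E.tr (w * t ^ k)).pt 1 0, (E.tr (w * t ^ k)).pt 1 1) := fun E w k =>
    wall_eq_of_mem (by simpa using (E.tr (w * t ^ k)).edge_mem_wall_x (-k))
  have key : ∀ {u v' : V}, D.Edge u v' → ∃ D' : DiagModel X,
      (∃ w, D' = D.tr w ∨ D' = D.swap.tr w) ∧
      (X.wall s(u, v') = X.wall s(D'.pt 1 0, D'.pt 1 1) ∨
        X.wall s(u, v') = X.wall s(D'.pt 1 0, D'.pt c 0)) := by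
    rintro u v' ⟨w, k, rfl, rfl | rfl | ⟨rfl, rfl⟩⟩
    · exact ⟨_, ⟨w * t ^ k, .inl rfl⟩, .inl (hxe D w k)⟩
    -- A `b`-edge is an `a`-edge for the swapped identification.
    · refine ⟨_, ⟨w * t ^ k * t ^ (-k), .inr rfl⟩, .inl ?_⟩
      rw [← hxe D.swap (w * t ^ k) (-k)]
      simp [mul_assoc, ← zpow_add]
      grind
    · exact ⟨_, ⟨w, .inl rfl⟩, .inr (by simp)⟩
  have key' : ∃ D' : DiagModel X, (∃ w, D' = D.tr w ∨ D' = D.swap.tr w) ∧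
      (X.wall e = X.wall s(D'.pt 1 0, D'.pt 1 1) ∨
        X.wall e = X.wall s(D'.pt 1 0, D'.pt c 0)) := by
    induction e with
    | h u v' =>
      rcases D.adj_iff.1 he with he | he
      · exact key he
      · rw [Sym2.eq_swap]
        exact key he
  obtain ⟨D', hD', h | h⟩ := key'
  · refine ⟨D', hD', ?_⟩
    rw [h]
    by_cases hv : v ∈ D'.HX
    · exact .inl ((D'.component_HX v).1 hv)
    · exact .inr (.inl ((D'.component_HX v).2 hv))
  · refine ⟨D', hD', ?_⟩
    rw [h]
    by_cases hv : v ∈ D'.HZ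
    · exact .inr (.inr (.inl ((D'.component_HZ v).1 hv)))
    · exact .inr (.inr (.inr ((D'.component_HZ v).2 hv)))

end DiagModel

end DiagonalPlanes

end

noncomputable section

namespace DiagonalPlanes

namespace DiagModel

variable {V : Type*} {X : CubeFamily V} (D : DiagModel X)

/-! ## Essentiality -/

theorem x_sub_le_dist (u v : V) : |D.x u - D.x v| ≤ X.graph.dist u v := by
  obtain ⟨W, hW⟩ := D.connected.exists_walk_length_eq_dist u v
  rw [← hW]
  clear hW
  induction W with
  | nil => simp
  | @cons a b _ h W ih =>
    refine (abs_sub_le _ (D.x b) _).trans ?_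
    rw [SimpleGraph.Walk.length_cons, Nat.cast_add, Nat.cast_one, add_comm]
    exact add_le_add ih (D.x_lipschitz_of_adj h)

/-- Left translations move `(u, k)` to `(s, k)` for any `s` but keep `k`, which is why the
hypothesis asks for every `k`. The coordinate `x` is 1-Lipschitz, so it bounds the depth in `h` from
below. -/
theorem not_isShallow (D' : DiagModel X) {h : X.HalfSpace}
    (H : ∀ R : ℕ, ∃ s : F2, ∀ k, D.pt s k ∈ h.1 ∧ ∀ v ∈ h.1ᶜ, (R : ℤ) < |D'.x (D.pt s k) - D'.x v|) :
    ¬ X.IsShallow h := by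
  rintro ⟨v, R, hR⟩
  obtain ⟨u, k, rfl⟩ := D.exists_pt v
  obtain ⟨s, hs⟩ := H R
  have h1 : (D.isomTo (D.tr (s * u⁻¹))).1 (D.pt u k) = D.pt s k := by simp
  obtain ⟨y, hy, hd⟩ := hR (D.isomTo (D.tr (s * u⁻¹))) (by rw [h1]; exact (hs k).1)
  rw [h1] at hd
  have h2 := D'.x_sub_le_dist (D.pt s k) y
  have h3 := (hs k).2 y hy
  omega

theorem isEssential (D : DiagModel X) : X.IsEssential := by
  rintro ⟨h, hh⟩
  obtain ⟨D', -, rfl | rfl | rfl | rfl⟩ := D.halfSpace_cases hh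
  -- The plane of `t ^ (R + 1) * c` hangs off the diagonal vertex `(R + 1, R + 1)`, so it lies
  -- entirely at depth greater than `R`.
  · refine D'.not_isShallow D' fun R => ⟨t ^ (R + 1 : ℤ) * c, fun k => ?_⟩
    have hx : D'.x (D'.pt (t ^ (R + 1 : ℤ) * c) k) = R + 1 := by
      rw [D'.x_pt_of_notMem (mul_c_notMem (t_zpow_mem _)), tau_mul_c, tau_zpow]
    simp only [HX, hx, Set.mem_ofPred_eq, Set.mem_compl_iff]
    exact ⟨by omega, fun v hv => by rw [lt_abs]; omega⟩
  · refine D'.not_isShallow D' fun R => ⟨t ^ (-R : ℤ) * c, fun k => ?_⟩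
    have hx : D'.x (D'.pt (t ^ (-R : ℤ) * c) k) = -R := by
      rw [D'.x_pt_of_notMem (mul_c_notMem (t_zpow_mem _)), tau_mul_c, tau_zpow]
    simp only [HX, hx, Set.mem_ofPred_eq, Set.mem_compl_iff, not_not]
    exact ⟨by omega, fun v hv => by rw [lt_abs]; omega⟩
  -- Depth beyond the `c`-edge is measured in the plane `c T`, to whose origin the complement
  -- projects.
  · refine D'.not_isShallow (D'.tr c) fun R => ⟨c * (t ^ (R + 1 : ℤ) * c), fun k => ⟨?_, ?_⟩⟩
    · change D'.z _ = 1
      rw [z_pt, ← mul_assoc, z_mul_c, z_mul_zpow, z_c]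
      intro h
      rw [mul_eq_one_iff_eq_inv] at h
      exact c_notMem (h ▸ inv_mem (t_zpow_mem _))
    · intro v hv
      have hv0 : D'.z v = 0 := (z_eq_zero_or_one _).resolve_right hv
      rw [← D'.tr_pt, x_pt_of_notMem _ (mul_c_notMem (t_zpow_mem _)), tau_mul_c, tau_zpow,
        (D'.x_tr_eq_zero_of_z hv0).1, lt_abs]
      omega
  · refine D'.not_isShallow D' fun R => ⟨t ^ (R + 1 : ℤ) * c, fun k => ⟨?_, ?_⟩⟩
    · change ¬ D'.z _ = 1
      rw [z_pt, z_eq_zero_of_tau_ne]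
      · exact zero_ne_one
      · rw [tau_mul_c, tau_zpow]
        omega
    · intro v hv
      rw [compl_compl] at hv
      rw [x_pt_of_notMem _ (mul_c_notMem (t_zpow_mem _)), tau_mul_c, tau_zpow,
        (D'.x_eq_zero_of_z hv).1, lt_abs]
      omega

/-! ## Corners of the plane `T` -/

theorem isHalfSpace_x {σ : ℤ} (hσ : σ = 1 ∨ σ = -1) (N : ℤ) :
    X.IsHalfSpace {v | N ≤ σ * D.x v} := by
  rcases hσ with rfl | rfl
  · convert (D.tr (t ^ (N - 1))).isHalfSpace_HX using 1
    ext v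
    simp only [HX, Set.mem_ofPred_eq, tr_t_zpow_x]
    omega
  · convert (D.tr (t ^ (-N))).isHalfSpace_HX_compl using 1
    ext v
    simp only [HX, Set.mem_ofPred_eq, tr_t_zpow_x, Set.mem_compl_iff]
    omega

theorem isHalfSpace_y {σ : ℤ} (hσ : σ = 1 ∨ σ = -1) (N : ℤ) :
    X.IsHalfSpace {v | N ≤ σ * D.y v} := by
  simpa only [swap_x] using D.swap.isHalfSpace_x hσ N

/-- Increasing `N` by one loses the vertex `(σ * N, 0)`, which makes an inclusion strict. -/
theorem x_ssubset {σ : ℤ} (hσ : σ = 1 ∨ σ = -1) {N : ℤ} {h : Set V}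
    (hN : {v | N ≤ σ * D.x v} ⊆ h) : {v | N + 1 ≤ σ * D.x v} ⊂ h := by
  refine (Set.ssubset_iff_of_subset (fun v hv => hN ?_)).2 ⟨D.pt 1 (σ * N), hN ?_, ?_⟩
  · simp only [Set.mem_ofPred_eq] at hv ⊢
    omega
  all_goals
    simp only [Set.mem_ofPred_eq, x_pt_of_mem _ (one_mem T), tau_one]
    rcases hσ with rfl | rfl <;> omega

theorem y_ssubset {σ : ℤ} (hσ : σ = 1 ∨ σ = -1) {N : ℤ} {h : Set V}
    (hN : {v | N ≤ σ * D.y v} ⊆ h) : {v | N + 1 ≤ σ * D.y v} ⊂ h := by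
  simpa only [swap_x] using D.swap.x_ssubset hσ (h := h) (by simpa only [swap_x] using hN)

/-- For a half-space `h`, a neighbourhood of infinity in one of the two coordinates is contained
in `h`. -/
def CornerMem (σ σ' : ℤ) (h : Set V) : Prop :=
  ∃ N : ℤ, {v | N ≤ σ * D.x v} ⊂ h ∨ {v | N ≤ σ' * D.y v} ⊂ h

/-- For `HX` with `w ∈ T` the half-space is itself a condition on `x`. Otherwise its wall lies over
the single diagonal vertex at `tau w`, and all vertices with `x ≠ tau w` are on one side. -/
theorem exists_x_subset {σ : ℤ} (hσ : σ = 1 ∨ σ = -1) {h : Set V} {w : F2}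
    (hh : h = (D.tr w).HX ∨ h = (D.tr w).HZ) :
    ∃ N : ℤ, {v | N ≤ σ * D.x v} ⊂ h ∨ {v | N ≤ σ * D.x v} ⊂ hᶜ := by
  have const : (∀ v v', D.x v ≠ tau w → D.x v' ≠ tau w → v ∈ h → v' ∈ h) →
      ∃ N : ℤ, {v | N ≤ σ * D.x v} ⊂ h ∨ {v | N ≤ σ * D.x v} ⊂ hᶜ := by
    intro H
    have hne : ∀ v, v ∈ {v | |tau w| + 1 ≤ σ * D.x v} → D.x v ≠ tau w := by
      intro v hv he
      rw [Set.mem_ofPred_eq, he] at hv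
      have h1 := le_abs_self (tau w)
      have h2 := neg_le_abs (tau w)
      rcases hσ with rfl | rfl <;> omega
    refine ⟨|tau w| + 1 + 1, ?_⟩
    by_cases h0 : ∃ v ∈ {v | |tau w| + 1 ≤ σ * D.x v}, v ∈ h
    · obtain ⟨v, hv, hvh⟩ := h0
      exact .inl (D.x_ssubset hσ fun v' hv' => H v v' (hne v hv) (hne v' hv') hvh)
    · push Not at h0
      exact .inr (D.x_ssubset hσ h0)
  -- The second alternative is a vertex of `T` in the row `y = tau w`, off the diagonal.
  have proj : ∀ v, D.x v ≠ tau w → ∃ u k, v = D.pt u k ∧ (tau u ≠ tau w ∨ u = t ^ tau w) := by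
    intro v hv
    obtain ⟨u, k, rfl⟩ := D.exists_pt v
    refine ⟨u, k, rfl, ?_⟩
    by_cases hu : u ∈ T
    · by_cases h0 : tau u = tau w
      · exact .inr (by rw [← h0]; exact eq_zpow_tau hu)
      · exact .inl h0
    · rw [D.x_pt_of_notMem hu] at hv
      exact .inl hv
  rcases hh with rfl | rfl
  · by_cases hw : w ∈ T
    · rw [eq_zpow_tau hw]
      rcases hσ with rfl | rfl
      · refine ⟨tau w + 1 + 1, .inl (D.x_ssubset (.inl rfl) fun v hv => ?_)⟩
        simp only [HX, Set.mem_ofPred_eq, tr_t_zpow_x] at hv ⊢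
        omega
      · refine ⟨-tau w + 1, .inr (D.x_ssubset (.inr rfl) fun v hv => ?_)⟩
        simp only [HX, Set.mem_ofPred_eq, tr_t_zpow_x, Set.mem_compl_iff] at hv ⊢
        omega
    · refine const ?_
      have hc : ∀ v, D.x v ≠ tau w → (D.tr w).x v = tau (w⁻¹ * t ^ tau w) := by
        intro v hv
        obtain ⟨u, k, rfl, hu⟩ := proj v hv
        have hn : w⁻¹ * u ∉ T := by
          intro h0
          rcases hu with hu | rfl
          · exact hu (tau_eq_of_inv_mul_mem hw h0)
          · rw [mul_zpow_mem] at h0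
            exact hw (inv_mem_iff.1 h0)
        rw [D.pt_tr w, x_pt_of_notMem _ hn]
        rcases hu with hu | hu
        · exact tau_inv_mul_eq_of_tau_ne hw hu
        · rw [← hu]
      intro v v' hv hv' hvh
      rw [HX, Set.mem_ofPred_eq, hc v hv] at hvh
      rwa [HX, Set.mem_ofPred_eq, hc v' hv']
  · refine const ?_
    have hc : ∀ v, D.x v ≠ tau w → (D.tr w).z v = DiagonalPlanes.z (w⁻¹ * t ^ tau w) := by
      intro v hv
      obtain ⟨u, k, rfl, hu⟩ := proj v hv
      rw [D.pt_tr w, z_pt]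
      rcases hu with hu | hu
      · exact z_inv_mul_eq_of_tau_ne hu
      · rw [← hu]
    intro v v' hv hv' hvh
    rw [HZ, Set.mem_ofPred_eq, hc v hv] at hvh
    rwa [HZ, Set.mem_ofPred_eq, hc v' hv']

theorem cornerMem_or {σ σ' : ℤ} (hσ : σ = 1 ∨ σ = -1) (hσ' : σ' = 1 ∨ σ' = -1) {h : Set V}
    (hh : X.IsHalfSpace h) : D.CornerMem σ σ' h ∨ D.CornerMem σ σ' hᶜ := by
  have key : ∀ {w : F2} {h : Set V}, (h = (D.tr w).HX ∨ h = (D.tr w).HZ) ∨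
      (h = (D.swap.tr w).HX ∨ h = (D.swap.tr w).HZ) →
      D.CornerMem σ σ' h ∨ D.CornerMem σ σ' hᶜ := by
    rintro w h (h1 | h1)
    · obtain ⟨N, hN | hN⟩ := D.exists_x_subset hσ h1
      exacts [.inl ⟨N, .inl hN⟩, .inr ⟨N, .inl hN⟩]
    · obtain ⟨N, hN⟩ := D.swap.exists_x_subset hσ' h1
      simp only [swap_x] at hN
      rcases hN with hN | hN
      exacts [.inl ⟨N, .inr hN⟩, .inr ⟨N, .inr hN⟩]
  have key' : ∀ {w : F2} {h : Set V}, (hᶜ = (D.tr w).HX ∨ hᶜ = (D.tr w).HZ) ∨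
      (hᶜ = (D.swap.tr w).HX ∨ hᶜ = (D.swap.tr w).HZ) →
      D.CornerMem σ σ' h ∨ D.CornerMem σ σ' hᶜ := by
    intro w h hh
    have := key hh
    rw [compl_compl] at this
    exact this.symm
  obtain ⟨D', ⟨w, rfl | rfl⟩, h1 | h1 | h1 | h1⟩ := D.halfSpace_cases hh
  · exact key (.inl (.inl h1))
  · exact key' (.inl (.inl (by rw [h1, compl_compl])))
  · exact key (.inl (.inr h1))
  · exact key' (.inl (.inr (by rw [h1, compl_compl])))
  · exact key (.inr (.inl h1))
  · exact key' (.inr (.inl (by rw [h1, compl_compl])))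
  · exact key (.inr (.inr h1))
  · exact key' (.inr (.inr (by rw [h1, compl_compl])))

open Classical in
/-- The corner of the plane `T` where the coordinates tend to `σ * ∞` and `σ' * ∞`. -/
def corner (σ σ' : ℤ) : X.HalfSpace → Bool := fun h => decide (D.CornerMem σ σ' h.1)

theorem corner_eq_true {σ σ' : ℤ} {h : X.HalfSpace} :
    D.corner σ σ' h = true ↔ D.CornerMem σ σ' h.1 := by
  simp [corner]

/-- These are the vertices `(σ * n, σ' * n)` of the plane `T`, which therefore converge to the
corner by `cornerMem_or`. -/
theorem pt_mem_of_cornerMem {σ σ' : ℤ} (hσ : σ = 1 ∨ σ = -1) (hσ' : σ' = 1 ∨ σ' = -1)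
    {h : Set V} (hh : D.CornerMem σ σ' h) :
    ∀ᶠ n : ℕ in Filter.atTop, D.pt (t ^ (σ' * n)) (σ * n - σ' * n) ∈ h := by
  obtain ⟨N, hN⟩ := hh
  filter_upwards [Filter.eventually_ge_atTop N.toNat] with n hn
  rcases hN with hN | hN
  · refine hN.subset ?_
    rw [Set.mem_ofPred_eq, x_pt_of_mem _ (t_zpow_mem _), tau_zpow]
    rcases hσ with rfl | rfl <;> omega
  · refine hN.subset ?_
    rw [Set.mem_ofPred_eq, y_pt, tau_zpow]
    rcases hσ' with rfl | rfl <;> omega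

theorem corner_mem_nonterminatingPoints {σ σ' : ℤ} (hσ : σ = 1 ∨ σ = -1)
    (hσ' : σ' = 1 ∨ σ' = -1) : D.corner σ σ' ∈ X.nonterminatingPoints := by
  refine ⟨⟨?_, ?_⟩, ?_⟩
  · refine mem_closure_of_tendsto (b := Filter.atTop)
      (f := fun n : ℕ => X.vertexPoint (D.pt (t ^ (σ' * n)) (σ * n - σ' * n))) ?_
      (Filter.Eventually.of_forall fun n => Set.mem_range_self _)
    rw [tendsto_pi_nhds]
    intro h
    refine tendsto_const_nhds.congr' ?_
    by_cases hc : D.CornerMem σ σ' h.1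
    · filter_upwards [D.pt_mem_of_cornerMem hσ hσ' hc] with n hn
      simp [corner, CubeFamily.vertexPoint, hc, hn]
    · filter_upwards [D.pt_mem_of_cornerMem hσ hσ' ((D.cornerMem_or hσ hσ' h.2).resolve_left hc)]
        with n hn
      have hn' : D.pt (t ^ (σ' * n)) (σ * n - σ' * n) ∉ h.1 := hn
      simp [corner, CubeFamily.vertexPoint, hc, hn']
  · rintro ⟨v, hv⟩
    -- The corner belongs to every half-space `N ≤ σ * x`, and no vertex does.
    have h1 : D.corner σ σ' ⟨_, D.isHalfSpace_x hσ (σ * D.x v + 1)⟩ = true :=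
      D.corner_eq_true.2 ⟨_, .inl (D.x_ssubset hσ subset_rfl)⟩
    rw [← hv] at h1
    simp [CubeFamily.vertexPoint] at h1
  · intro h hh
    -- Since `CornerMem` requires a strict inclusion, its witness is already the smaller half-space.
    obtain ⟨N, hN | hN⟩ := D.corner_eq_true.1 hh
    · exact ⟨⟨_, D.isHalfSpace_x hσ N⟩,
        D.corner_eq_true.2 ⟨_, .inl (D.x_ssubset hσ subset_rfl)⟩, hN⟩
    · exact ⟨⟨_, D.isHalfSpace_y hσ' N⟩,
        D.corner_eq_true.2 ⟨_, .inr (D.y_ssubset hσ' subset_rfl)⟩, hN⟩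

/-! ## The quadrant avoiding the diagonal -/

/-- The half-space where the first coordinate is positive. -/
def posX : X.HalfSpace := ⟨_, D.isHalfSpace_x (.inl rfl) 1⟩

/-- The half-space where the second coordinate is negative. -/
def negY : X.HalfSpace := ⟨_, D.isHalfSpace_y (.inr rfl) 1⟩

/-- Translations and the swap preserve the set of diagonal vertices, so an explicit one in each of
the four model half-spaces suffices. -/
theorem exists_diagonal_mem {h : Set V} (hh : X.IsHalfSpace h) : ∃ u, D.pt u 0 ∈ h := by
  obtain ⟨D', hD', hd⟩ := D.halfSpace_cases hh
  have : ∀ u, ∃ u', D'.pt u 0 = D.pt u' 0 := by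
    obtain ⟨w, rfl | rfl⟩ := hD'
    · exact fun u => ⟨w * u, rfl⟩
    · exact fun u => ⟨w * u, by simp⟩
  have key : ∀ u, D'.pt u 0 ∈ h → ∃ u, D.pt u 0 ∈ h := fun u hu => by
    obtain ⟨u', h'⟩ := this u
    exact ⟨u', h' ▸ hu⟩
  rcases hd with rfl | rfl | rfl | rfl
  · exact key t (by simpa [HX] using (tau_zpow 1).ge)
  · exact key 1 (by simp [HX, tau_one])
  · exact key c (by simp [HZ, z_c])
  · exact key 1 (by simp [HZ, z_one])

/-- The key obstruction: diagonal vertices satisfy `x = y`, and the quadrant requires `x > 0 > y`.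
-/
theorem not_subset_quadrant {h : Set V} (hh : X.IsHalfSpace h) :
    ¬ h ⊆ D.posX.1 ∩ D.negY.1 := by
  intro hs
  obtain ⟨u, hu⟩ := D.exists_diagonal_mem hh
  obtain ⟨h1, h2⟩ := hs hu
  simp only [posX, negY, Set.mem_ofPred_eq, x_pt_zero, y_pt] at h1 h2
  omega

theorem isOpen_quadrant :
    IsOpen {ξ : X.HalfSpace → Bool | ξ D.posX = true ∧ ξ D.negY = true} := by
  have key : ∀ k : X.HalfSpace, IsOpen {ξ : X.HalfSpace → Bool | ξ k = true} := fun k =>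
    (isOpen_discrete ({true} : Set Bool)).preimage (continuous_apply (A := fun _ => Bool) k)
  exact (key _).inter (key _)

theorem corner_mem_quadrant : D.corner 1 (-1) D.posX = true ∧ D.corner 1 (-1) D.negY = true :=
  ⟨D.corner_eq_true.2 ⟨_, .inl (D.x_ssubset (.inl rfl) subset_rfl)⟩,
    D.corner_eq_true.2 ⟨_, .inr (D.y_ssubset (.inr rfl) subset_rfl)⟩⟩

/-- Although `posX` and `negY` are transverse, `HZ` projects to the origin of `T`, so it is disjoint
from both and links them. -/
theorem sameFactor : X.SameFactor D.posX D.negY := by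
  refine .trans _ ⟨_, D.isHalfSpace_HZ⟩ _ (.rel _ _ ?_) (.rel _ _ ?_)
  · rintro ⟨⟨v, h1, h2⟩, -⟩
    have := (D.x_eq_zero_of_z h2).1
    simp only [posX, Set.mem_ofPred_eq] at h1
    omega
  · rintro ⟨⟨v, h1, h2⟩, -⟩
    have := (D.x_eq_zero_of_z h1).2
    simp only [negY, Set.mem_ofPred_eq] at h2
    omega

/-- A regular point containing both `posX` and `negY` would contain a half-space inside their
intersection. -/
theorem corner_notMem_regularBoundary : D.corner 1 (-1) ∉ X.regularBoundary := by
  intro h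
  obtain ⟨ξ, ⟨h1, h2⟩, hξ⟩ := mem_closure_iff.1 h _ D.isOpen_quadrant D.corner_mem_quadrant
  obtain ⟨k, -, -, hk, -⟩ := hξ.2.2 D.posX D.negY D.sameFactor h1 h2
  exact D.not_subset_quadrant k.2 hk

theorem regularBoundary_ne (D : DiagModel X) :
    X.regularBoundary ≠ X.nonterminatingBoundary := fun h =>
  D.corner_notMem_regularBoundary
    (h ▸ subset_closure (D.corner_mem_nonterminatingPoints (.inl rfl) (.inr rfl)))

/-! ### Failure of minimality -/

theorem HZ_subset_of_cornerMem {h : Set V} (hh : D.CornerMem 1 1 h) :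
    ∃ N : ℤ, ∀ M ≥ N, (D.tr (t ^ M)).HZ ⊆ h := by
  obtain ⟨N, hN⟩ := hh
  refine ⟨N, fun M hM v hv => ?_⟩
  -- The set behind the `c`-edge at `t ^ M` projects to `(M, M)`, so it satisfies both `N ≤ x` and
  -- `N ≤ y`.
  have h1 := (D.tr (t ^ M)).x_eq_zero_of_z hv
  rw [tr_t_zpow_x, tr_t_zpow_y] at h1
  rcases hN with hN | hN <;>
  · refine hN.subset ?_
    rw [Set.mem_ofPred_eq]
    omega

theorem not_isMinimalOn (D : DiagModel X) : ¬ X.IsMinimalOn X.nonterminatingBoundary := by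
  intro h
  have := h _ (subset_closure (D.corner_mem_nonterminatingPoints (.inl rfl) (.inl rfl)))
    (subset_closure (D.corner_mem_nonterminatingPoints (.inl rfl) (.inr rfl)))
  obtain ⟨_, ⟨h1, h2⟩, ⟨g, rfl⟩⟩ := mem_closure_iff.1 this _ D.isOpen_quadrant D.corner_mem_quadrant
  -- The translate by `g` of the corner `(+∞, +∞)` lies in the open quadrant, so `g` maps the
  -- half-space behind a far diagonal vertex into the quadrant.
  obtain ⟨N, hN⟩ := D.HZ_subset_of_cornerMem (D.corner_eq_true.1 h1)
  obtain ⟨N', hN'⟩ := D.HZ_subset_of_cornerMem (D.corner_eq_true.1 h2)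
  refine D.not_subset_quadrant ((D.tr (t ^ max N N')).isHalfSpace_HZ.isom g) ?_
  rintro _ ⟨v, hv, rfl⟩
  have key : ∀ {k : X.HalfSpace}, v ∈ (g⁻¹ • k).1 → g.1 v ∈ k.1 := by
    rintro k ⟨u, hu, rfl⟩
    convert hu
    exact g.1.apply_symm_apply u
  exact ⟨key (hN _ (le_max_left _ _) hv), key (hN' _ (le_max_right _ _) hv)⟩

end DiagModel

end DiagonalPlanes

end

noncomputable section

namespace DiagonalPlanes

/-! # A criterion for the CAT(0) property -/

section Metric

variable {M : Type*} [PseudoEMetricSpace M]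

/-- The distance, as a real number. -/
def rd (p q : M) : ℝ := (edist p q).toReal

theorem rd_comm (p q : M) : rd p q = rd q p := by rw [rd, edist_comm, rd]

theorem rd_nonneg (p q : M) : 0 ≤ rd p q := ENNReal.toReal_nonneg

@[simp] theorem rd_self (p : M) : rd p p = 0 := by simp [rd]

theorem rd_triangle (hfin : ∀ p q : M, edist p q ≠ ⊤) (p q r : M) : rd p r ≤ rd p q + rd q r := by
  rw [rd, rd, rd, ← ENNReal.toReal_add (hfin _ _) (hfin _ _)]
  exact ENNReal.toReal_mono (ENNReal.add_ne_top.2 ⟨hfin _ _, hfin _ _⟩) (edist_triangle p q r)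

theorem sq_sub_le_rd_sq (hfin : ∀ p q : M, edist p q ≠ ⊤) (p q r : M) :
    (rd p q - rd p r) ^ 2 ≤ rd q r ^ 2 := by
  have h1 := rd_triangle hfin p q r
  have h2 := rd_triangle hfin p r q
  rw [rd_comm r q] at h2
  exact sq_le_sq' (by linarith) (by linarith)

/-- The point `m` divides a geodesic from `x` to `y` in the ratio `s : 1 - s`, and satisfies the
comparison inequality for all points. -/
def IsDivision (x y : M) (s : ℝ) (m : M) : Prop :=
  ∀ p, rd p m ^ 2 ≤ (1 - s) * rd p x ^ 2 + s * rd p y ^ 2 - s * (1 - s) * rd x y ^ 2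

/-- There is a geodesic from `x` to `y` satisfying the comparison inequality for all points. -/
def Good (x y : M) : Prop := ∀ s ∈ Set.Icc (0 : ℝ) 1, ∃ m, IsDivision x y s m

theorem IsDivision.symm {x y m : M} {s : ℝ} (h : IsDivision x y s m) :
    IsDivision y x (1 - s) m := fun p => by
  have := h p
  rw [rd_comm y x]
  linarith

theorem Good.symm {x y : M} (h : Good x y) : Good y x := fun s hs => by
  obtain ⟨m, hm⟩ := h (1 - s) ⟨by linarith [hs.2], by linarith [hs.1]⟩
  exact ⟨m, by simpa using hm.symm⟩

/-- If every point has a gate in `A`, then the comparison inequality for points of `A` implies the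
inequality for all points. -/
theorem good_of_gate (hfin : ∀ p q : M, edist p q ≠ ⊤) {A : Set M}
    (gate : ∀ p, ∃ ρ ∈ A, ∀ q ∈ A, rd p q = rd p ρ + rd ρ q) {x y : M} (hx : x ∈ A) (hy : y ∈ A)
    (H : ∀ s ∈ Set.Icc (0 : ℝ) 1, ∃ m ∈ A, ∀ p ∈ A,
      rd p m ^ 2 ≤ (1 - s) * rd p x ^ 2 + s * rd p y ^ 2 - s * (1 - s) * rd x y ^ 2) :
    Good x y := by
  rintro s ⟨hs0, hs1⟩
  obtain ⟨m, hmA, hm⟩ := H s ⟨hs0, hs1⟩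
  refine ⟨m, fun p => ?_⟩
  obtain ⟨ρ, hρ, h⟩ := gate p
  rw [h m hmA, h x hx, h y hy]
  have h1 := hm ρ hρ
  have h2 := sq_sub_le_rd_sq hfin ρ x y
  have he := rd_nonneg p ρ
  have hu := rd_nonneg ρ x
  have hv := rd_nonneg ρ y
  have h0 : 0 ≤ s * (1 - s) := mul_nonneg hs0 (by linarith)
  -- Comparing squares, this follows from `(rd ρ x - rd ρ y) ^ 2 ≤ rd x y ^ 2`. It controls the
  -- cross term that appears when `rd p ρ` is added to all three distances.
  have h3 : rd ρ m ≤ (1 - s) * rd ρ x + s * rd ρ y := by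
    refine (pow_le_pow_iff_left₀ (rd_nonneg _ _)
      (add_nonneg (mul_nonneg (by linarith) hu) (mul_nonneg hs0 hv)) two_ne_zero).1 ?_
    nlinarith
  nlinarith [mul_le_mul_of_nonneg_left h3 he]

/-- The division point lies on the piece from `x` to `o`, at parameter `s * rd x y / rd x o`. Since
`o` separates `p` from `x` or from `y`, one distance is computed exactly and the triangle inequality
bounds the other from below. -/
theorem exists_division_of_concat (hfin : ∀ p q : M, edist p q ≠ ⊤) {x o y : M} (h1 : Good x o)
    (hd : rd x y = rd x o + rd o y)
    (hcut : ∀ p, rd p x = rd p o + rd o x ∨ rd p y = rd p o + rd o y) {s : ℝ} (hs0 : 0 ≤ s)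
    (hs : s * rd x y ≤ rd x o) : ∃ m, IsDivision x y s m := by
  have hu := rd_nonneg x o
  have hv := rd_nonneg o y
  rcases (rd_nonneg x y).eq_or_lt with hD | hD
  · have hu0 : rd x o = 0 := by linarith
    have hv0 : rd o y = 0 := by linarith
    obtain ⟨m, hm⟩ := h1 0 ⟨le_rfl, zero_le_one⟩
    refine ⟨m, fun p => (hm p).trans ?_⟩
    have : rd p x = rd p y := by
      have h1 := sq_sub_le_rd_sq hfin p x y
      rw [← hD] at h1
      nlinarith
    rw [← hD, this]
    linarith
  -- Here `l = s / rd x o`; when `x` and `o` are at distance zero, `s = 0` and `l = 0` will do.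
  · obtain ⟨l, hl0, hl1, hl⟩ : ∃ l : ℝ, 0 ≤ l ∧ l * rd x y ≤ 1 ∧ l * rd x o = s := by
      rcases hu.eq_or_lt with hu0 | hu0
      · refine ⟨0, le_rfl, by simp, ?_⟩
        rw [← hu0] at hs
        rw [zero_mul]
        exact le_antisymm hs0 (nonpos_of_mul_nonpos_left hs hD)
      · refine ⟨s / rd x o, div_nonneg hs0 hu, ?_, div_mul_cancel₀ _ hu0.ne'⟩
        rw [div_mul_eq_mul_div, div_le_one hu0]
        exact hs
    obtain ⟨m, hm⟩ := h1 (l * rd x y) ⟨mul_nonneg hl0 hD.le, hl1⟩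
    refine ⟨m, fun p => (hm p).trans ?_⟩
    have ha := sq_sub_le_rd_sq hfin o p x
    have hb := sq_sub_le_rd_sq hfin o p y
    have hxy := hcut p
    rw [rd_comm o x] at ha hxy
    rw [rd_comm o p] at ha hb
    rw [hd] at hl1 ⊢
    rw [← hl]
    generalize rd x o = u at *
    generalize rd o y = v at *
    generalize rd p o = w at *
    rcases hxy with h | h
    · rw [h]
      have h0 : 0 ≤ l * u * (rd p y ^ 2 - (w - v) ^ 2) :=
        mul_nonneg (mul_nonneg hl0 hu) (by linarith [hb])
      nlinarith
    · rw [h]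
      have h0 : 0 ≤ l * v * (rd p x ^ 2 - (w - u) ^ 2) :=
        mul_nonneg (mul_nonneg hl0 hv) (by linarith [ha])
      nlinarith

/-- Concatenation of geodesics at a cut point. -/
theorem Good.concat (hfin : ∀ p q : M, edist p q ≠ ⊤) {x o y : M} (h1 : Good x o)
    (h2 : Good o y) (hd : rd x y = rd x o + rd o y)
    (hcut : ∀ p, rd p x = rd p o + rd o x ∨ rd p y = rd p o + rd o y) : Good x y := by
  rintro s ⟨hs0, hs1⟩
  rcases le_total (s * rd x y) (rd x o) with hs | hs
  · exact exists_division_of_concat hfin h1 hd hcut hs0 hs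
  · obtain ⟨m, hm⟩ := exists_division_of_concat hfin (x := y) (y := x) (s := 1 - s) h2.symm
      (by rw [rd_comm y x, rd_comm y o, rd_comm o x, hd, add_comm]) (fun p => (hcut p).symm)
      (by linarith) (by rw [rd_comm y x, rd_comm y o]; nlinarith)
    exact ⟨m, by simpa using hm.symm⟩

/-- The comparison inequality for the division points forces them to form a geodesic, and forces
every geodesic with the same ends to pass through them. -/
theorem isCAT0_of_good (hfin : ∀ p q : M, edist p q ≠ ⊤)
    (hsep : ∀ p q : M, edist p q = 0 → p = q) (hgood : ∀ x y : M, Good x y) : IsCAT0 M := by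
  have hsep' : ∀ {p q : M}, rd p q = 0 → p = q := fun {p q} h =>
    hsep p q (((ENNReal.toReal_eq_zero_iff _).1 h).resolve_right (hfin _ _))
  have hed : ∀ p q : M, edist p q = ENNReal.ofReal (rd p q) := fun p q =>
    (ENNReal.ofReal_toReal (hfin _ _)).symm
  refine ⟨hfin, hsep, fun x y => ?_, fun γ L hγ p r hr => ?_⟩
  · rcases (rd_nonneg x y).eq_or_lt with h0 | h0
    · refine ⟨fun _ => x, 0, ⟨le_rfl, fun r hr r' hr' => ?_⟩, rfl, hsep' h0.symm⟩
      have e1 : r = 0 := le_antisymm hr.2 hr.1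
      have e2 : r' = 0 := le_antisymm hr'.2 hr'.1
      simp [e1, e2]
    · have : Nonempty M := ⟨x⟩
      choose! m hm using hgood x y
      -- Apply the inequality for `m s` at `x` and `y`, then the one for `m s'` at `m s`; the
      -- coefficients combine to `(s - s') ^ 2`.
      have hup : ∀ s ∈ Set.Icc (0 : ℝ) 1, ∀ s' ∈ Set.Icc (0 : ℝ) 1,
          rd (m s) (m s') ≤ |s - s'| * rd x y := by
        intro s hs s' hs'
        have h1 := hm s hs x
        have h2 := hm s hs y
        have h3 := hm s' hs' (m s)
        rw [rd_self, rd_comm x (m s)] at h1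
        rw [rd_self, rd_comm y (m s), rd_comm y x] at h2
        refine (pow_le_pow_iff_left₀ (rd_nonneg _ _) (mul_nonneg (abs_nonneg _) h0.le)
          two_ne_zero).1 ?_
        rw [mul_pow, sq_abs]
        have e1 := mul_le_mul_of_nonneg_left h1 (sub_nonneg.2 hs'.2)
        have e2 := mul_le_mul_of_nonneg_left h2 hs'.1
        nlinarith
      have hm0 : m 0 = x := by
        have := hm 0 ⟨le_rfl, zero_le_one⟩ x
        rw [rd_self] at this
        exact (hsep' (pow_eq_zero_iff two_ne_zero |>.1 (le_antisymm (by linarith)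
          (sq_nonneg _)))).symm
      have hm1 : m 1 = y := by
        have := hm 1 ⟨zero_le_one, le_rfl⟩ y
        rw [rd_self] at this
        exact (hsep' (pow_eq_zero_iff two_ne_zero |>.1 (le_antisymm (by linarith)
          (sq_nonneg _)))).symm
      -- The upper bounds for the three consecutive pieces add up to `rd x y`, so none is strict.
      have heq : ∀ s ∈ Set.Icc (0 : ℝ) 1, ∀ s' ∈ Set.Icc (0 : ℝ) 1, s ≤ s' →
          rd (m s) (m s') = (s' - s) * rd x y := by
        intro s hs s' hs' hss
        refine le_antisymm ?_ ?_
        · have := hup s hs s' hs'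
          rwa [abs_sub_comm, abs_of_nonneg (sub_nonneg.2 hss)] at this
        · have h1 := hup 0 ⟨le_rfl, zero_le_one⟩ s hs
          have h2 := hup s' hs' 1 ⟨zero_le_one, le_rfl⟩
          rw [zero_sub, abs_neg, abs_of_nonneg hs.1, hm0] at h1
          rw [abs_sub_comm, abs_of_nonneg (sub_nonneg.2 hs'.2), hm1] at h2
          have h3 := rd_triangle hfin x (m s) y
          have h4 := rd_triangle hfin (m s) (m s') y
          linarith
      have hmem : ∀ r ∈ Set.Icc (0 : ℝ) (rd x y), r / rd x y ∈ Set.Icc (0 : ℝ) 1 := fun r hr =>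
        ⟨div_nonneg hr.1 h0.le, (div_le_one h0).2 hr.2⟩
      refine ⟨fun r => m (r / rd x y), rd x y, ⟨h0.le, fun r hr r' hr' => ?_⟩, ?_, ?_⟩
      · rw [hed]
        congr 1
        rcases le_total r r' with h | h
        · rw [heq _ (hmem r hr) _ (hmem r' hr') (div_le_div_of_nonneg_right h h0.le), abs_sub_comm,
            abs_of_nonneg (sub_nonneg.2 h), ← sub_div, div_mul_cancel₀ _ h0.ne']
        · rw [rd_comm, heq _ (hmem r' hr') _ (hmem r hr) (div_le_div_of_nonneg_right h h0.le),
            abs_of_nonneg (sub_nonneg.2 h), ← sub_div, div_mul_cancel₀ _ h0.ne']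
      · simp only [zero_div, hm0]
      · simp only [div_self h0.ne', hm1]
  · obtain ⟨hL, hγ⟩ := hγ
    have hrd : ∀ r ∈ Set.Icc 0 L, ∀ r' ∈ Set.Icc 0 L, rd (γ r) (γ r') = |r - r'| := by
      intro r hr r' hr'
      rw [rd, hγ r hr r' hr', ENNReal.toReal_ofReal (abs_nonneg _)]
    have m0 : (0 : ℝ) ∈ Set.Icc 0 L := ⟨le_rfl, hL⟩
    have mL : L ∈ Set.Icc 0 L := ⟨hL, le_rfl⟩
    change L * rd p (γ r) ^ 2 ≤ (L - r) * rd p (γ 0) ^ 2 + r * rd p (γ L) ^ 2 - r * (L - r) * L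
    rcases hL.eq_or_lt with h0 | h0
    · have : r = 0 := le_antisymm (h0 ▸ hr.2) hr.1
      simp [← h0, this]
    · obtain ⟨m, hm⟩ := hgood (γ 0) (γ L) (r / L) ⟨div_nonneg hr.1 hL, (div_le_one h0).2 hr.2⟩
      have key : ∀ p, L * rd p m ^ 2 ≤
          (L - r) * rd p (γ 0) ^ 2 + r * rd p (γ L) ^ 2 - r * (L - r) * L := by
        intro p
        have := mul_le_mul_of_nonneg_left (hm p) hL
        rw [hrd 0 m0 L mL, zero_sub, abs_neg, abs_of_pos h0] at this
        refine this.trans (le_of_eq ?_)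
        field_simp
      -- At `p = γ r` the right-hand side of the comparison inequality vanishes.
      have hmr : γ r = m := by
        have := key (γ r)
        rw [hrd r hr 0 m0, hrd r hr L mL, sq_abs, sq_abs] at this
        refine hsep' (pow_eq_zero_iff two_ne_zero |>.1 (le_antisymm ?_ (sq_nonneg _)))
        refine nonpos_of_mul_nonpos_right (a := L) ?_ h0
        nlinarith
      rw [hmr]
      exact key p

end Metric

end DiagonalPlanes

end

noncomputable section

namespace DiagonalPlanes

/-! # The geometric realization -/

variable {V : Type*} {X : CubeFamily V}

open Classical in
/-- The vertex `u`, as a point of the realization. -/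
def ind (u v : V) : ℝ := if u = v then 1 else 0

theorem cubePoint_zero (φ : (Fin 0 → Bool) → V) (x : EuclideanSpace ℝ (Fin 0)) (v : V) :
    CubeFamily.cubePoint φ x v = ind (φ ![]) v := by
  have h : ∀ d, φ d = φ ![] := fun d => congrArg φ (Subsingleton.elim _ _)
  unfold CubeFamily.cubePoint
  rw [Fintype.sum_unique, Finset.univ_eq_empty, Finset.prod_empty, h, ind]

theorem cubePoint_one (φ : (Fin 1 → Bool) → V) (x : EuclideanSpace ℝ (Fin 1)) (v : V) :
    CubeFamily.cubePoint φ x v = (1 - x 0) * ind (φ ![false]) v + x 0 * ind (φ ![true]) v := by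
  unfold CubeFamily.cubePoint
  have : (Finset.univ : Finset (Fin 1 → Bool)) = {![false], ![true]} := by decide
  rw [this, Finset.sum_insert (by decide), Finset.sum_singleton]
  simp [ind]

theorem cubePoint_two (φ : (Fin 2 → Bool) → V) (x : EuclideanSpace ℝ (Fin 2)) (v : V) :
    CubeFamily.cubePoint φ x v =
      (1 - x 0) * (1 - x 1) * ind (φ ![false, false]) v + x 0 * (1 - x 1) * ind (φ ![true, false]) v +
      (1 - x 0) * x 1 * ind (φ ![false, true]) v + x 0 * x 1 * ind (φ ![true, true]) v := by
  unfold CubeFamily.cubePoint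
  have : (Finset.univ : Finset (Fin 2 → Bool)) =
      {![false, false], ![true, false], ![false, true], ![true, true]} := by decide
  rw [this, Finset.sum_insert (by decide), Finset.sum_insert (by decide),
    Finset.sum_insert (by decide), Finset.sum_singleton]
  simp [ind, add_assoc]

/-- The linear extension of a function on the vertices. -/
def ev (f : V → ℝ) (p : V → ℝ) : ℝ := ∑ᶠ v, p v * f v

theorem ev_finsupp (f : V → ℝ) (F : V →₀ ℝ) : ev f F = F.sum fun v a => a * f v := by
  rw [ev, Finsupp.sum]
  refine finsum_eq_sum_of_support_subset _ fun v hv => ?_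
  rw [Finset.mem_coe, Finsupp.mem_support_iff]
  exact fun h => hv (by simp [h])

theorem ev_two (f : V → ℝ) (a b : ℝ) (A B : V) :
    ev f (fun v => a * ind A v + b * ind B v) = a * f A + b * f B := by
  classical
  have : (fun v => a * ind A v + b * ind B v) = ⇑(Finsupp.single A a + Finsupp.single B b) := by
    ext v
    simp [ind, Finsupp.single_apply]
  rw [this, ev_finsupp, Finsupp.sum_add_index' (by simp) (by intros; ring)]
  simp

theorem ev_four (f : V → ℝ) (a b a' b' : ℝ) (A B A' B' : V) :
    ev f (fun v => a * ind A v + b * ind B v + a' * ind A' v + b' * ind B' v) =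
      a * f A + b * f B + a' * f A' + b' * f B' := by
  classical
  have : (fun v => a * ind A v + b * ind B v + a' * ind A' v + b' * ind B' v) =
      ⇑(Finsupp.single A a + Finsupp.single B b + Finsupp.single A' a' + Finsupp.single B' b') := by
    ext v
    simp [ind, Finsupp.single_apply]
  rw [this, ev_finsupp, Finsupp.sum_add_index' (by simp) (by intros; ring),
    Finsupp.sum_add_index' (by simp) (by intros; ring),
    Finsupp.sum_add_index' (by simp) (by intros; ring)]
  simp

theorem ev_smul (f : V → ℝ) (g : X.isom) (p : X.Realization) :
    ev f (g • p).1 = ev (fun v => f (g.1 v)) p.1 := by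
  change ∑ᶠ v, p.1 (g.1⁻¹ v) * f v = ∑ᶠ v, p.1 v * f (g.1 v)
  rw [← finsum_comp_equiv g.1]
  refine finsum_congr fun v => ?_
  rw [show g.1⁻¹ (g.1 v) = v from g.1.symm_apply_apply v]

namespace DiagModel

variable (D : DiagModel X)

theorem ext_e {D D' : DiagModel X} (h : D.e = D'.e) : D = D' := by
  cases D
  cases D'
  cases h
  rfl

@[simp] theorem tr_one : D.tr 1 = D := ext_e (Equiv.ext fun p => by simp [tr])

@[simp] theorem tr_tr (w u : F2) : (D.tr w).tr u = D.tr (w * u) :=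
  ext_e (Equiv.ext fun ⟨p, k⟩ => by simp [tr, mul_assoc])

/-- The point of a square with local coordinates `s` and `r`. -/
def sqFun (w : F2) (k : ℤ) (s r : ℝ) : V → ℝ := fun v =>
  (1 - s) * (1 - r) * ind (D.pt w k) v + s * (1 - r) * ind (D.pt w (k + 1)) v +
    (1 - s) * r * ind (D.pt (w * t) (k - 1)) v + s * r * ind (D.pt (w * t) k) v

/-- The point with coordinate `s` of the edge from `w` to `w * c`. -/
def cFun (w : F2) (s : ℝ) : V → ℝ := fun v =>
  (1 - s) * ind (D.pt w 0) v + s * ind (D.pt (w * c) 0) v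

theorem tr_sqFun (w u : F2) (k : ℤ) (s r : ℝ) : (D.tr w).sqFun u k s r = D.sqFun (w * u) k s r := by
  ext v
  simp only [sqFun, tr_pt, ← mul_assoc w]

theorem tr_cFun (w u : F2) (s : ℝ) : (D.tr w).cFun u s = D.cFun (w * u) s := by
  ext v
  simp only [cFun, tr_pt, ← mul_assoc w]

theorem ev_sqFun (f : V → ℝ) (w : F2) (k : ℤ) (s r : ℝ) : ev f (D.sqFun w k s r) =
    (1 - s) * (1 - r) * f (D.pt w k) + s * (1 - r) * f (D.pt w (k + 1)) +
    (1 - s) * r * f (D.pt (w * t) (k - 1)) + s * r * f (D.pt (w * t) k) :=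
  ev_four f _ _ _ _ _ _ _ _

theorem ev_cFun (f : V → ℝ) (w : F2) (s : ℝ) :
    ev f (D.cFun w s) = (1 - s) * f (D.pt w 0) + s * f (D.pt (w * c) 0) :=
  ev_two f _ _ _ _

theorem sqFun_one_left (w : F2) (k : ℤ) (r : ℝ) : D.sqFun w k 1 r = D.sqFun w (k + 1) 0 r := by
  ext v
  simp [sqFun]

theorem sqFun_one_right (w : F2) (k : ℤ) (s : ℝ) :
    D.sqFun w k s 1 = D.sqFun (w * t) (k - 1) s 0 := by
  ext v
  simp [sqFun]

theorem cubePoint_chart2 (w : F2) (k : ℤ) (s r : ℝ) :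
    CubeFamily.cubePoint (chart2 (D.pt w k) (D.pt w (k + 1)) (D.pt (w * t) (k - 1))
      (D.pt (w * t) k)) !₂[s, r] = D.sqFun w k s r := by
  ext v
  rw [cubePoint_two]
  simp [chart2, sqFun]

theorem cubePoint_chart1 (w : F2) (s : ℝ) :
    CubeFamily.cubePoint (chart1 (D.pt w 0) (D.pt (w * c) 0)) (WithLp.toLp 2 ![s]) = D.cFun w s := by
  ext v
  rw [cubePoint_one]
  simp [chart1, cFun]

/-! ## Steps -/

theorem edist_two (x y : EuclideanSpace ℝ (Fin 2)) :
    edist x y = edist (⟨x 0, x 1⟩ : ℂ) ⟨y 0, y 1⟩ := by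
  rw [edist_dist, edist_dist, EuclideanSpace.dist_eq, Complex.dist_eq_re_im, Fin.sum_univ_two,
    Real.dist_eq, Real.dist_eq, sq_abs, sq_abs]

theorem edist_one (x y : EuclideanSpace ℝ (Fin 1)) : edist x y = edist (x 0) (y 0) := by
  rw [edist_dist, edist_dist, EuclideanSpace.dist_eq, Fin.sum_univ_one, Real.sqrt_sq dist_nonneg]

theorem edist_complex {s r s' r' a b a' b' : ℝ}
    (h : (s - s') ^ 2 + (r - r') ^ 2 = (a - a') ^ 2 + (b - b') ^ 2) :
    edist (⟨s, r⟩ : ℂ) ⟨s', r'⟩ = edist (⟨a, b⟩ : ℂ) ⟨a', b'⟩ := by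
  rw [edist_dist, edist_dist, Complex.dist_eq_re_im, Complex.dist_eq_re_im]
  simp only [h]

theorem edist_complex_real {s r s' r' a a' : ℝ}
    (h : (s - s') ^ 2 + (r - r') ^ 2 = (a - a') ^ 2) :
    edist (⟨s, r⟩ : ℂ) ⟨s', r'⟩ = edist a a' := by
  rw [edist_dist, edist_dist, Complex.dist_eq_re_im, Real.dist_eq]
  simp only [h, Real.sqrt_sq_eq_abs]

theorem mem_Icc_symm {s : ℝ} (h : s ∈ Set.Icc (0 : ℝ) 1) : 1 - s ∈ Set.Icc (0 : ℝ) 1 :=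
  ⟨by linarith [h.2], by linarith [h.1]⟩

/-- The points with coordinates `x` and `y` of the cube with chart `φ` lie in a square, or in an
edge joining two planes. -/
theorem chart_cases {n : ℕ} {φ : (Fin n → Bool) → V} (hφ : X.IsChart φ)
    {x y : EuclideanSpace ℝ (Fin n)} (hx : ∀ i, x i ∈ Set.Icc (0 : ℝ) 1)
    (hy : ∀ i, y i ∈ Set.Icc (0 : ℝ) 1) :
    (∃ w k s r s' r', s ∈ Set.Icc (0 : ℝ) 1 ∧ r ∈ Set.Icc (0 : ℝ) 1 ∧ s' ∈ Set.Icc (0 : ℝ) 1 ∧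
      r' ∈ Set.Icc (0 : ℝ) 1 ∧ CubeFamily.cubePoint φ x = D.sqFun w k s r ∧
      CubeFamily.cubePoint φ y = D.sqFun w k s' r' ∧ edist x y = edist (⟨s, r⟩ : ℂ) ⟨s', r'⟩) ∨
    ∃ w s s', s ∈ Set.Icc (0 : ℝ) 1 ∧ s' ∈ Set.Icc (0 : ℝ) 1 ∧
      CubeFamily.cubePoint φ x = D.cFun w s ∧ CubeFamily.cubePoint φ y = D.cFun w s' ∧
      edist x y = edist s s' := by
  have i0 : (0 : ℝ) ∈ Set.Icc (0 : ℝ) 1 := ⟨le_rfl, zero_le_one⟩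
  have hn := D.isChart_le_two hφ
  have hface : ∀ (I : Set (Fin n)) (a : Fin n → Bool), φ '' cubeFace I a ∈ X.cubes :=
    fun I a => (hφ.mem_cubes_iff _ (Set.image_subset_range _ _)).2 ⟨I, a, rfl⟩
  -- Vertices and edges of planes are treated as faces of a square; only `c`-edges stay apart. The
  -- coordinate `1 - x 0` occurs when the chart reverses the orientation of the edge.
  obtain rfl | rfl | rfl : n = 0 ∨ n = 1 ∨ n = 2 := by omega
  · obtain ⟨w, k, hv⟩ := D.exists_pt (φ ![])
    refine .inl ⟨w, k, 0, 0, 0, 0, i0, i0, i0, i0, ?_, ?_, ?_⟩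
    · ext v
      simp [cubePoint_zero, sqFun, hv]
    · ext v
      simp [cubePoint_zero, sqFun, hv]
    · rw [Subsingleton.elim x y, edist_self, edist_self]
  · have hadj : X.graph.Adj (φ ![false]) (φ ![true]) := by
      refine ⟨fun h => ?_, ?_⟩
      · have := congrFun (hφ.injective h) 0
        simp at this
      · convert hface ∅ fun _ => true
        ext v
        have : ∀ ε : Fin 1 → Bool, ε = ![ε 0] := fun ε => by
          ext i; simp [Subsingleton.elim i 0]
        simp only [Set.mem_insert_iff, Set.mem_singleton_iff, Set.mem_image, cubeFace]
        constructor
        · rintro (rfl | rfl)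
          exacts [⟨_, by simp, rfl⟩, ⟨_, by simp, rfl⟩]
        · rintro ⟨ε, -, rfl⟩
          rw [this ε]
          cases ε 0 <;> simp
    have hx0 := hx 0
    have hy0 := hy 0
    have hx1 := mem_Icc_symm hx0
    have hy1 := mem_Icc_symm hy0
    rcases D.adj_iff.1 hadj with ⟨w, k, h1, h2 | h2 | ⟨rfl, h2⟩⟩ | ⟨w, k, h1, h2 | h2 | ⟨rfl, h2⟩⟩
    · refine .inl ⟨w, k, x 0, 0, y 0, 0, hx0, i0, hy0, i0, ?_, ?_, ?_⟩
      · ext v; simp [cubePoint_one, sqFun, h1, h2]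
      · ext v; simp [cubePoint_one, sqFun, h1, h2]
      · rw [edist_one]
        exact (edist_complex_real (by ring)).symm
    · refine .inl ⟨w, k, 0, x 0, 0, y 0, i0, hx0, i0, hy0, ?_, ?_, ?_⟩
      · ext v; simp [cubePoint_one, sqFun, h1, h2]
      · ext v; simp [cubePoint_one, sqFun, h1, h2]
      · rw [edist_one]
        exact (edist_complex_real (by ring)).symm
    · refine .inr ⟨w, x 0, y 0, hx0, hy0, ?_, ?_, edist_one x y⟩
      · ext v; simp [cubePoint_one, cFun, h1, h2]
      · ext v; simp [cubePoint_one, cFun, h1, h2]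
    · refine .inl ⟨w, k, 1 - x 0, 0, 1 - y 0, 0, hx1, i0, hy1, i0, ?_, ?_, ?_⟩
      · ext v; simp [cubePoint_one, sqFun, h1, h2]; ring
      · ext v; simp [cubePoint_one, sqFun, h1, h2]; ring
      · rw [edist_one]
        exact (edist_complex_real (by ring)).symm
    · refine .inl ⟨w, k, 0, 1 - x 0, 0, 1 - y 0, i0, hx1, i0, hy1, ?_, ?_, ?_⟩
      · ext v; simp [cubePoint_one, sqFun, h1, h2]; ring
      · ext v; simp [cubePoint_one, sqFun, h1, h2]; ring
      · rw [edist_one]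
        exact (edist_complex_real (by ring)).symm
    · refine .inr ⟨w, 1 - x 0, 1 - y 0, hx1, hy1, ?_, ?_, ?_⟩
      · ext v; simp [cubePoint_one, cFun, h1, h2]; ring
      · ext v; simp [cubePoint_one, cFun, h1, h2]; ring
      · rw [edist_one, edist_dist, edist_dist, Real.dist_eq, Real.dist_eq, abs_sub_comm]
        congr 2
        ring
  · have hε : ∀ ε : Fin 2 → Bool, ε = ![ε 0, ε 1] := fun ε => by
      ext i; fin_cases i <;> rfl
    have himg : ∀ (I : Set (Fin 2)) (a : Fin 2 → Bool) (v : V), v ∈ φ '' cubeFace I a ↔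
        ∃ i j : Bool, (0 ∈ I → i = a 0) ∧ (1 ∈ I → j = a 1) ∧ φ ![i, j] = v := by
      intro I a v
      constructor
      · rintro ⟨ε, hε', rfl⟩
        exact ⟨ε 0, ε 1, hε' 0, hε' 1, congrArg φ (hε ε).symm⟩
      · rintro ⟨i, j, h0, h1, rfl⟩
        refine ⟨_, fun l hl => ?_, rfl⟩
        fin_cases l
        exacts [h0 hl, h1 hl]
    have hne : ∀ i j i' j', ¬ (i = i' ∧ j = j') → φ ![i, j] ≠ φ ![i', j'] := by
      intro i j i' j' h h'
      have := hφ.injective h'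
      exact h ⟨congrFun this 0, congrFun this 1⟩
    have hcube : ∀ {s s' : Set V}, s ∈ X.cubes → (∀ x, x ∈ s ↔ x ∈ s') → s' ∈ X.cubes :=
      fun hs h => (Set.ext h) ▸ hs
    have hsq : {φ ![false, false], φ ![true, false], φ ![false, true], φ ![true, true]} ∈
        X.cubes := hcube (hface ∅ fun _ => true) fun v => by
      rw [himg]
      simp only [Set.mem_empty_iff_false, false_imp_iff, true_and, Bool.exists_bool,
        Set.mem_insert_iff, Set.mem_singleton_iff]
      grind
    have ha0 : ∀ j, X.graph.Adj (φ ![false, j]) (φ ![true, j]) := fun j =>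
      ⟨hne _ _ _ _ (by simp), hcube (hface {1} fun _ => j) fun v => by
        rw [himg]; simp [eq_comm]⟩
    have ha1 : ∀ i, X.graph.Adj (φ ![i, false]) (φ ![i, true]) := fun i =>
      ⟨hne _ _ _ _ (by simp), hcube (hface {0} fun _ => i) fun v => by
        rw [himg]; simp [eq_comm]⟩
    obtain ⟨w, k, hl⟩ := D.exists_labelling hsq (hne _ _ _ _ (by simp)) (hne _ _ _ _ (by simp))
      (ha0 false) (ha1 false) (ha1 true) (ha0 true)
    -- Each of the eight labellings corresponds to an isometry `f` of the unit square.
    have key : ∃ f : ℝ → ℝ → ℝ × ℝ,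
        (∀ a ∈ Set.Icc (0 : ℝ) 1, ∀ b ∈ Set.Icc (0 : ℝ) 1,
          (f a b).1 ∈ Set.Icc (0 : ℝ) 1 ∧ (f a b).2 ∈ Set.Icc (0 : ℝ) 1) ∧
        (∀ a b a' b', (a - a') ^ 2 + (b - b') ^ 2 =
          ((f a b).1 - (f a' b').1) ^ 2 + ((f a b).2 - (f a' b').2) ^ 2) ∧
        ∀ a b v, (1 - a) * (1 - b) * ind (φ ![false, false]) v +
          a * (1 - b) * ind (φ ![true, false]) v + (1 - a) * b * ind (φ ![false, true]) v +
          a * b * ind (φ ![true, true]) v = D.sqFun w k (f a b).1 (f a b).2 v := by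
      refine hl (fun P Q R S => ∃ f : ℝ → ℝ → ℝ × ℝ,
        (∀ a ∈ Set.Icc (0 : ℝ) 1, ∀ b ∈ Set.Icc (0 : ℝ) 1,
          (f a b).1 ∈ Set.Icc (0 : ℝ) 1 ∧ (f a b).2 ∈ Set.Icc (0 : ℝ) 1) ∧
        (∀ a b a' b', (a - a') ^ 2 + (b - b') ^ 2 =
          ((f a b).1 - (f a' b').1) ^ 2 + ((f a b).2 - (f a' b').2) ^ 2) ∧
        ∀ a b v, (1 - a) * (1 - b) * ind P v + a * (1 - b) * ind Q v + (1 - a) * b * ind R v +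
          a * b * ind S v = D.sqFun w k (f a b).1 (f a b).2 v) ?_ ?_ ?_ ?_ ?_ ?_ ?_ ?_
      · exact ⟨fun a b => (a, b), fun a ha b hb => ⟨ha, hb⟩, fun a b a' b' => by ring,
          fun a b v => by simp only [sqFun]⟩
      · exact ⟨fun a b => (1 - a, b), fun a ha b hb => ⟨mem_Icc_symm ha, hb⟩,
          fun a b a' b' => by ring, fun a b v => by simp only [sqFun]; ring⟩
      · exact ⟨fun a b => (a, 1 - b), fun a ha b hb => ⟨ha, mem_Icc_symm hb⟩,
          fun a b a' b' => by ring, fun a b v => by simp only [sqFun]; ring⟩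
      · exact ⟨fun a b => (1 - a, 1 - b), fun a ha b hb => ⟨mem_Icc_symm ha, mem_Icc_symm hb⟩,
          fun a b a' b' => by ring, fun a b v => by simp only [sqFun]; ring⟩
      · exact ⟨fun a b => (b, a), fun a ha b hb => ⟨hb, ha⟩, fun a b a' b' => by ring,
          fun a b v => by simp only [sqFun]; ring⟩
      · exact ⟨fun a b => (1 - b, a), fun a ha b hb => ⟨mem_Icc_symm hb, ha⟩,
          fun a b a' b' => by ring, fun a b v => by simp only [sqFun]; ring⟩
      · exact ⟨fun a b => (b, 1 - a), fun a ha b hb => ⟨hb, mem_Icc_symm ha⟩,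
          fun a b a' b' => by ring, fun a b v => by simp only [sqFun]; ring⟩
      · exact ⟨fun a b => (1 - b, 1 - a), fun a ha b hb => ⟨mem_Icc_symm hb, mem_Icc_symm ha⟩,
          fun a b a' b' => by ring, fun a b v => by simp only [sqFun]; ring⟩
    obtain ⟨f, f1, f2, f3⟩ := key
    refine .inl ⟨w, k, _, _, _, _, (f1 _ (hx 0) _ (hx 1)).1, (f1 _ (hx 0) _ (hx 1)).2,
      (f1 _ (hy 0) _ (hy 1)).1, (f1 _ (hy 0) _ (hy 1)).2, ?_, ?_, ?_⟩
    · ext v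
      rw [cubePoint_two, f3]
    · ext v
      rw [cubePoint_two, f3]
    · rw [edist_two, edist_complex (f2 _ _ _ _)]

theorem isStep_cases {p q : X.Realization} {l : ℝ≥0∞} (h : X.IsStep p q l) :
    (∃ w k s r s' r', s ∈ Set.Icc (0 : ℝ) 1 ∧ r ∈ Set.Icc (0 : ℝ) 1 ∧ s' ∈ Set.Icc (0 : ℝ) 1 ∧
      r' ∈ Set.Icc (0 : ℝ) 1 ∧ p.1 = D.sqFun w k s r ∧ q.1 = D.sqFun w k s' r' ∧
      l = edist (⟨s, r⟩ : ℂ) ⟨s', r'⟩) ∨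
    ∃ w s s', s ∈ Set.Icc (0 : ℝ) 1 ∧ s' ∈ Set.Icc (0 : ℝ) 1 ∧
      p.1 = D.cFun w s ∧ q.1 = D.cFun w s' ∧ l = edist s s' := by
  obtain ⟨n, φ, x, y, hφ, hx, hy, hp, hq, rfl⟩ := h
  rw [hp, hq]
  exact D.chart_cases hφ hx hy

theorem realization_cases (p : X.Realization) :
    (∃ w k s r, s ∈ Set.Icc (0 : ℝ) 1 ∧ r ∈ Set.Icc (0 : ℝ) 1 ∧ p.1 = D.sqFun w k s r) ∨
    ∃ w s, s ∈ Set.Icc (0 : ℝ) 1 ∧ p.1 = D.cFun w s := by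
  obtain ⟨n, φ, x, hφ, hx, hp⟩ := p.2
  rw [hp]
  rcases D.chart_cases hφ hx hx with ⟨w, k, s, r, _, _, hs, hr, _, _, h, _⟩ | ⟨w, s, _, hs, _, h, _⟩
  · exact .inl ⟨w, k, s, r, hs, hr, h⟩
  · exact .inr ⟨w, s, hs, h⟩

theorem isStep_square {p q : X.Realization} {w : F2} {k : ℤ} {s r s' r' : ℝ}
    (hs : s ∈ Set.Icc (0 : ℝ) 1) (hr : r ∈ Set.Icc (0 : ℝ) 1) (hs' : s' ∈ Set.Icc (0 : ℝ) 1)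
    (hr' : r' ∈ Set.Icc (0 : ℝ) 1) (hp : p.1 = D.sqFun w k s r) (hq : q.1 = D.sqFun w k s' r') :
    X.IsStep p q (edist (⟨s, r⟩ : ℂ) ⟨s', r'⟩) := by
  refine ⟨2, _, !₂[s, r], !₂[s', r'], D.isChart2 w k, fun i => ?_, fun i => ?_, ?_, ?_, ?_⟩
  · fin_cases i
    exacts [hs, hr]
  · fin_cases i
    exacts [hs', hr']
  · rw [hp, cubePoint_chart2]
  · rw [hq, cubePoint_chart2]
  · rw [edist_two]
    rfl

theorem isStep_edge {p q : X.Realization} {w : F2} {s s' : ℝ} (hs : s ∈ Set.Icc (0 : ℝ) 1)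
    (hs' : s' ∈ Set.Icc (0 : ℝ) 1) (hp : p.1 = D.cFun w s) (hq : q.1 = D.cFun w s') :
    X.IsStep p q (edist s s') := by
  refine ⟨1, _, (WithLp.toLp 2 ![s]), (WithLp.toLp 2 ![s']), D.isChart1 (D.adj_c w), fun i => ?_, fun i => ?_, ?_, ?_, ?_⟩
  · fin_cases i
    exact hs
  · fin_cases i
    exact hs'
  · rw [hp, cubePoint_chart1]
  · rw [hq, cubePoint_chart1]
  · rw [edist_one]
    rfl

theorem exists_sqPt (w : F2) (k : ℤ) {s r : ℝ} (hs : s ∈ Set.Icc (0 : ℝ) 1)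
    (hr : r ∈ Set.Icc (0 : ℝ) 1) : ∃ p : X.Realization, p.1 = D.sqFun w k s r := by
  refine ⟨⟨D.sqFun w k s r, 2, _, !₂[s, r], D.isChart2 w k, fun i => ?_,
    (D.cubePoint_chart2 w k s r).symm⟩, rfl⟩
  fin_cases i
  exacts [hs, hr]

theorem exists_cPt (w : F2) {s : ℝ} (hs : s ∈ Set.Icc (0 : ℝ) 1) :
    ∃ p : X.Realization, p.1 = D.cFun w s := by
  refine ⟨⟨D.cFun w s, 1, _, (WithLp.toLp 2 ![s]), D.isChart1 (D.adj_c w), fun i => ?_,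
    (D.cubePoint_chart1 w s).symm⟩, rfl⟩
  fin_cases i
  exact hs

end DiagModel

end DiagonalPlanes

end

noncomputable section

namespace DiagonalPlanes

variable {V : Type*} {X : CubeFamily V}

/-! ## Lengths of strings -/

/-- Sum over a string. All lower bounds for the path metric come from here. -/
theorem le_edist_of_isStep {N : Type*} [PseudoEMetricSpace N] (F : X.Realization → N)
    (h : ∀ p q l, X.IsStep p q l → edist (F p) (F q) ≤ l) (p q : X.Realization) :
    edist (F p) (F q) ≤ edist p q := by
  refine le_sInf fun l hl => ?_
  induction (show X.IsString p q l from hl) with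
  | nil p => simp
  | cons hs _ ih => exact (edist_triangle _ _ _).trans (add_le_add (h _ _ _ hs) (ih ‹_›))

theorem edist_le_of_isStep {p q : X.Realization} {l : ℝ≥0∞} (h : X.IsStep p q l) :
    edist p q ≤ l := by
  refine sInf_le ?_
  have := CubeFamily.IsString.cons h (.nil q)
  rwa [add_zero] at this

/-- The number of unit intervals with integral endpoints needed to cover a segment. -/
def span (x x' : ℝ) : ℕ := (⌈max x x'⌉ - ⌊min x x'⌋).toNat

theorem span_comm (x x' : ℝ) : span x x' = span x' x := by rw [span, max_comm, min_comm, span]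

theorem span_le_span {x x' y y' : ℝ} (h1 : max y y' ≤ max x x') (h2 : min x x' ≤ min y y') :
    span y y' ≤ span x x' :=
  Int.toNat_le_toNat (sub_le_sub (Int.ceil_mono h1) (Int.floor_mono h2))

theorem add_mul_sub_mem {x x' θ : ℝ} (hθ : θ ∈ Set.Icc (0 : ℝ) 1) :
    min x x' ≤ x + θ * (x' - x) ∧ x + θ * (x' - x) ≤ max x x' := by
  obtain ⟨h0, h1⟩ := hθ
  rcases le_total x x' with h | h
  · rw [min_eq_left h, max_eq_right h]
    constructor <;> nlinarith
  · rw [min_eq_right h, max_eq_left h]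
    constructor <;> nlinarith

theorem span_left_le {x x' θ : ℝ} (hθ : θ ∈ Set.Icc (0 : ℝ) 1) :
    span x (x + θ * (x' - x)) ≤ span x x' :=
  span_le_span (max_le (le_max_left _ _) (add_mul_sub_mem hθ).2)
    (le_min (min_le_left _ _) (add_mul_sub_mem hθ).1)

theorem span_right_le {x x' θ : ℝ} (hθ : θ ∈ Set.Icc (0 : ℝ) 1) :
    span (x + θ * (x' - x)) x' ≤ span x x' :=
  span_le_span (max_le (add_mul_sub_mem hθ).2 (le_max_right _ _))
    (le_min (add_mul_sub_mem hθ).1 (min_le_right _ _))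

/-- Assuming `x ≤ x'`, cut at the integer `⌊x⌋ + 1`, strictly between them. The cut is given by a
parameter `θ` so that it can be used for a segment of the plane. -/
theorem exists_split {x x' : ℝ} (h : 2 ≤ span x x') : ∃ θ ∈ Set.Icc (0 : ℝ) 1,
    span x (x + θ * (x' - x)) < span x x' ∧ span (x + θ * (x' - x)) x' < span x x' := by
  have key : ∀ {x x' : ℝ}, x ≤ x' → 2 ≤ span x x' → ∃ θ ∈ Set.Icc (0 : ℝ) 1,
      span x (x + θ * (x' - x)) < span x x' ∧ span (x + θ * (x' - x)) x' < span x x' := by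
    intro x x' hx h
    have hs : span x x' = (⌈x'⌉ - ⌊x⌋).toNat := by rw [span, max_eq_right hx, min_eq_left hx]
    have h2 : ⌊x⌋ + 2 ≤ ⌈x'⌉ := by omega
    have h3 : ((⌊x⌋ : ℝ) + 1) < x' := by
      have := Int.ceil_lt_add_one x'
      have h2' : (⌊x⌋ : ℝ) + 2 ≤ ⌈x'⌉ := by exact_mod_cast h2
      linarith
    have h4 := Int.lt_floor_add_one x
    have h5 : 0 < x' - x := by linarith
    have hm : x + ((⌊x⌋ : ℝ) + 1 - x) / (x' - x) * (x' - x) = ((⌊x⌋ + 1 : ℤ) : ℝ) := by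
      rw [div_mul_cancel₀ _ h5.ne']
      push_cast
      ring
    refine ⟨((⌊x⌋ : ℝ) + 1 - x) / (x' - x), ⟨div_nonneg (by linarith) h5.le,
      (div_le_one h5).2 (by linarith)⟩, ?_, ?_⟩
    · rw [hm, hs, span, max_eq_right (by push_cast; linarith), min_eq_left (by push_cast; linarith),
        Int.ceil_intCast]
      omega
    · rw [hm, hs, span, max_eq_right (by push_cast; linarith), min_eq_left (by push_cast; linarith),
        Int.floor_intCast]
      omega
  rcases le_total x x' with hx | hx
  · exact key hx h
  · obtain ⟨θ, hθ, h1, h2⟩ := key hx (by rwa [span_comm])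
    have e : x + (1 - θ) * (x' - x) = x' + θ * (x - x') := by ring
    refine ⟨1 - θ, DiagModel.mem_Icc_symm hθ, ?_, ?_⟩
    · rwa [e, span_comm, span_comm x x']
    · rwa [e, span_comm, span_comm x x']

theorem exists_unit_interval {x x' : ℝ} (h : span x x' < 2) : ∃ i : ℤ,
    ((i : ℝ) ≤ x ∧ x ≤ i + 1) ∧ ((i : ℝ) ≤ x' ∧ x' ≤ i + 1) := by
  have h1 : ⌈max x x'⌉ ≤ ⌊min x x'⌋ + 1 := by
    rw [span] at h
    omega
  have h2 : max x x' ≤ ⌊min x x'⌋ + 1 := (Int.le_ceil _).trans (by exact_mod_cast h1)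
  have h3 := Int.floor_le (min x x')
  exact ⟨_, ⟨h3.trans (min_le_left _ _), (le_max_left _ _).trans h2⟩,
    ⟨h3.trans (min_le_right _ _), (le_max_right _ _).trans h2⟩⟩

theorem edist_segment (a b : ℂ) {θ : ℝ} (hθ : θ ∈ Set.Icc (0 : ℝ) 1) :
    edist a (a + θ * (b - a)) + edist (a + θ * (b - a)) b = edist a b := by
  rw [edist_dist, edist_dist, edist_dist, ← ENNReal.ofReal_add dist_nonneg dist_nonneg]
  congr 1
  have h1 : dist a (a + θ * (b - a)) = θ * dist a b := by
    rw [dist_self_add_right, norm_mul, Complex.norm_real, Real.norm_of_nonneg hθ.1, dist_comm,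
      dist_eq_norm]
  have h2 : dist (a + θ * (b - a)) b = (1 - θ) * dist a b := by
    have : a + θ * (b - a) - b = ((1 - θ : ℝ) : ℂ) * (a - b) := by push_cast; ring
    rw [dist_eq_norm, this, norm_mul, Complex.norm_real,
      Real.norm_of_nonneg (sub_nonneg.2 hθ.2), dist_eq_norm]
  rw [h1, h2]
  ring

namespace DiagModel

variable (D : DiagModel X)

/-! ## Points of the planes and of the edges joining them -/

theorem fract_mem (x : ℝ) : Int.fract x ∈ Set.Icc (0 : ℝ) 1 :=
  ⟨Int.fract_nonneg x, (Int.fract_lt_one x).le⟩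

/-- The point of the plane `T` with given coordinates. -/
def flatPt (a : ℂ) : X.Realization :=
  (D.exists_sqPt (t ^ ⌊a.im⌋) (⌊a.re⌋ - ⌊a.im⌋) (fract_mem a.re) (fract_mem a.im)).choose

theorem flatPt_val (a : ℂ) : (D.flatPt a).1 =
    D.sqFun (t ^ ⌊a.im⌋) (⌊a.re⌋ - ⌊a.im⌋) (Int.fract a.re) (Int.fract a.im) :=
  (D.exists_sqPt _ _ (fract_mem a.re) (fract_mem a.im)).choose_spec

theorem clamp_mem (s : ℝ) : max 0 (min s 1) ∈ Set.Icc (0 : ℝ) 1 :=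
  ⟨le_max_left _ _, max_le zero_le_one (min_le_right _ _)⟩

/-- The point with coordinate `s` of the edge from `1` to `c`. -/
def cPt (s : ℝ) : X.Realization := (D.exists_cPt 1 (clamp_mem s)).choose

theorem cPt_val {s : ℝ} (hs : s ∈ Set.Icc (0 : ℝ) 1) : (D.cPt s).1 = D.cFun 1 s := by
  refine (D.exists_cPt 1 (clamp_mem s)).choose_spec.trans ?_
  rw [min_eq_left hs.2, max_eq_right hs.1]

theorem floor_eq_or {x : ℝ} {i : ℤ} (h1 : (i : ℝ) ≤ x) (h2 : x ≤ i + 1) :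
    ⌊x⌋ = i ∧ Int.fract x = x - i ∨ x = i + 1 ∧ ⌊x⌋ = i + 1 ∧ Int.fract x = 0 := by
  rcases h2.eq_or_lt with h | h
  · exact .inr ⟨h, by rw [h, Int.floor_add_one, Int.floor_intCast],
      by rw [h, Int.fract_add_one, Int.fract_intCast]⟩
  · have : ⌊x⌋ = i := Int.floor_eq_iff.2 ⟨h1, h⟩
    exact .inl ⟨this, by rw [Int.fract, this]⟩

/-- The floors in `flatPt` choose one square, but any closed square containing the point gives the
same value: on the far sides the floor is one larger, and neighbouring squares are glued there. -/
theorem flatPt_val_of_mem {a : ℂ} {i j : ℤ} (h1 : (i : ℝ) ≤ a.re) (h2 : a.re ≤ i + 1)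
    (h3 : (j : ℝ) ≤ a.im) (h4 : a.im ≤ j + 1) :
    (D.flatPt a).1 = D.sqFun (t ^ j) (i - j) (a.re - i) (a.im - j) := by
  have hx : ∀ (w : F2) (j : ℤ) (r : ℝ),
      D.sqFun w (⌊a.re⌋ - j) (Int.fract a.re) r = D.sqFun w (i - j) (a.re - i) r := by
    intro w j r
    rcases floor_eq_or h1 h2 with ⟨e1, e2⟩ | ⟨e1, e2, e3⟩
    · rw [e1, e2]
    · rw [e2, e3, e1, add_sub_cancel_left, sqFun_one_left, sub_add_eq_add_sub]
  have hy : ∀ (k : ℤ) (s : ℝ), D.sqFun (t ^ ⌊a.im⌋) (k - ⌊a.im⌋) s (Int.fract a.im) =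
      D.sqFun (t ^ j) (k - j) s (a.im - j) := by
    intro k s
    rcases floor_eq_or h3 h4 with ⟨e1, e2⟩ | ⟨e1, e2, e3⟩
    · rw [e1, e2]
    · rw [e2, e3, e1, add_sub_cancel_left, sqFun_one_right, zpow_add_one, sub_sub]
  rw [flatPt_val, hx, hy]

theorem tr_zpow_flatPt (n : ℤ) (a : ℂ) : (D.tr (t ^ n)).flatPt a = D.flatPt (a + ⟨n, n⟩) := by
  refine Subtype.ext ?_
  rw [flatPt_val, flatPt_val, tr_sqFun, ← zpow_add]
  simp only [Complex.add_re, Complex.add_im, Int.floor_add_intCast, Int.fract_add_intCast]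
  rw [add_comm n, add_sub_add_right_eq_sub]

theorem cPt_zero : D.cPt 0 = D.flatPt 0 := by
  refine Subtype.ext ?_
  rw [D.cPt_val ⟨le_rfl, zero_le_one⟩, flatPt_val]
  ext v
  simp [cFun, sqFun]

theorem cPt_one : D.cPt 1 = (D.tr c).flatPt 0 := by
  refine Subtype.ext ?_
  rw [D.cPt_val ⟨zero_le_one, le_rfl⟩, flatPt_val]
  ext v
  simp [cFun, sqFun]

theorem eq_flatPt {p : X.Realization} {w : F2} {k : ℤ} {s r : ℝ} (hs : s ∈ Set.Icc (0 : ℝ) 1)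
    (hr : r ∈ Set.Icc (0 : ℝ) 1) (hp : p.1 = D.sqFun w k s r) :
    p = (D.tr w).flatPt ⟨k + s, r⟩ := by
  refine Subtype.ext ?_
  rw [hp, (D.tr w).flatPt_val_of_mem (i := k) (j := 0), tr_sqFun]
  · simp
  · simpa using hs.1
  · simpa using hs.2
  · simpa using hr.1
  · simpa using hr.2

theorem eq_cPt {p : X.Realization} {w : F2} {s : ℝ} (hs : s ∈ Set.Icc (0 : ℝ) 1)
    (hp : p.1 = D.cFun w s) : p = (D.tr w).cPt s := by
  refine Subtype.ext ?_
  rw [hp, cPt_val _ hs, tr_cFun, mul_one]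

theorem point_cases (p : X.Realization) : (∃ w a, p = (D.tr w).flatPt a) ∨
    ∃ w, ∃ s ∈ Set.Icc (0 : ℝ) 1, p = (D.tr w).cPt s := by
  rcases D.realization_cases p with ⟨w, k, s, r, hs, hr, hp⟩ | ⟨w, s, hs, hp⟩
  · exact .inl ⟨w, _, D.eq_flatPt hs hr hp⟩
  · exact .inr ⟨w, s, hs, D.eq_cPt hs hp⟩

/-! ## Projections -/

/-- The projection to the plane `T`. -/
def rho (p : X.Realization) : ℂ := ⟨ev (fun v => (D.x v : ℝ)) p.1, ev (fun v => (D.y v : ℝ)) p.1⟩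

/-- The projection to the edge from `1` to `c`. -/
def zb (p : X.Realization) : ℝ := ev (fun v => (D.z v : ℝ)) p.1

theorem rho_of_mem {p : X.Realization} {w : F2} {k : ℤ} {s r : ℝ} (hp : p.1 = D.sqFun w k s r)
    (hw : w ∈ T) : D.rho p = ⟨tau w + k + s, tau w + r⟩ := by
  rw [rho, hp, ev_sqFun, ev_sqFun]
  simp only [x_pt_of_mem _ hw, x_pt_of_mem _ (mul_t_mem.2 hw), y_pt, tau_mul_t_of_mem hw]
  push_cast
  congr 1 <;> ring

theorem rho_of_notMem {p : X.Realization} {w : F2} {k : ℤ} {s r : ℝ} (hp : p.1 = D.sqFun w k s r)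
    (hw : w ∉ T) : D.rho p = ⟨tau w, tau w⟩ := by
  rw [rho, hp, ev_sqFun, ev_sqFun]
  simp only [x_pt_of_notMem _ hw, x_pt_of_notMem _ (mt mul_t_mem.1 hw), y_pt,
    tau_mul_t_of_notMem hw]
  congr 1 <;> ring

theorem rho_of_cFun {p : X.Realization} {w : F2} {s : ℝ} (hp : p.1 = D.cFun w s) :
    D.rho p = ⟨tau w, tau w⟩ := by
  rw [rho, hp, ev_cFun, ev_cFun]
  simp only [x_pt_zero, y_pt, tau_mul_c]
  congr 1 <;> ring

theorem zb_of_sqFun {p : X.Realization} {w : F2} {k : ℤ} {s r : ℝ} (hp : p.1 = D.sqFun w k s r) :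
    D.zb p = DiagonalPlanes.z w := by
  rw [zb, hp, ev_sqFun]
  simp only [z_pt, z_mul_t]
  ring

theorem zb_of_cFun {p : X.Realization} {w : F2} {s : ℝ} (hp : p.1 = D.cFun w s) (hw : w ≠ 1) :
    D.zb p = DiagonalPlanes.z w := by
  rw [zb, hp, ev_cFun]
  simp only [z_pt, z_mul_c hw]
  ring

theorem zb_of_cFun_one {p : X.Realization} {s : ℝ} (hp : p.1 = D.cFun 1 s) : D.zb p = s := by
  rw [zb, hp, ev_cFun]
  simp [z_one, z_c]

theorem rho_flatPt (a : ℂ) : D.rho (D.flatPt a) = a := by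
  rw [D.rho_of_mem (D.flatPt_val a) (t_zpow_mem _), tau_zpow]
  apply Complex.ext
  · push_cast
    rw [add_sub_cancel, Int.floor_add_fract]
  · exact Int.floor_add_fract _

theorem zb_tr_flatPt (w : F2) (a : ℂ) : D.zb ((D.tr w).flatPt a) = DiagonalPlanes.z w := by
  rw [D.zb_of_sqFun (((D.tr w).flatPt_val a).trans (D.tr_sqFun _ _ _ _ _)), z_mul_zpow]

theorem tr_zb_flatPt (w : F2) (a : ℂ) : (D.tr w).zb (D.flatPt a) = DiagonalPlanes.z w⁻¹ := by
  simpa using (D.tr w).zb_tr_flatPt w⁻¹ a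

theorem zb_flatPt (a : ℂ) : D.zb (D.flatPt a) = 0 := by
  simpa [z_one] using D.zb_tr_flatPt 1 a

theorem zb_cPt {s : ℝ} (hs : s ∈ Set.Icc (0 : ℝ) 1) : D.zb (D.cPt s) = s :=
  D.zb_of_cFun_one (D.cPt_val hs)

theorem zb_tr_cPt {w : F2} (hw : w ≠ 1) {s : ℝ} (hs : s ∈ Set.Icc (0 : ℝ) 1) :
    D.zb ((D.tr w).cPt s) = DiagonalPlanes.z w :=
  D.zb_of_cFun (((D.tr w).cPt_val hs).trans ((D.tr_cFun _ _ _).trans (by rw [mul_one]))) hw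

/-- On squares of `T`, `rho` is an isometric coordinate map, and it collapses every other cube to a
point. -/
theorem edist_rho_le (p q : X.Realization) : edist (D.rho p) (D.rho q) ≤ edist p q := by
  refine le_edist_of_isStep D.rho (fun p q l h => ?_) p q
  rcases D.isStep_cases h with ⟨w, k, s, r, s', r', -, -, -, -, hp, hq, rfl⟩ |
    ⟨w, s, s', -, -, hp, hq, rfl⟩
  · by_cases hw : w ∈ T
    · rw [D.rho_of_mem hp hw, D.rho_of_mem hq hw]
      exact (edist_complex (by ring)).le
    · rw [D.rho_of_notMem hp hw, D.rho_of_notMem hq hw, edist_self]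
      exact bot_le
  · rw [D.rho_of_cFun hp, D.rho_of_cFun hq, edist_self]
    exact bot_le

theorem edist_zb_le (p q : X.Realization) : edist (D.zb p) (D.zb q) ≤ edist p q := by
  refine le_edist_of_isStep D.zb (fun p q l h => ?_) p q
  rcases D.isStep_cases h with ⟨w, k, s, r, s', r', -, -, -, -, hp, hq, rfl⟩ |
    ⟨w, s, s', -, -, hp, hq, rfl⟩
  · rw [D.zb_of_sqFun hp, D.zb_of_sqFun hq, edist_self]
    exact bot_le
  · by_cases hw : w = 1
    · subst hw
      rw [D.zb_of_cFun_one hp, D.zb_of_cFun_one hq]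
    · rw [D.zb_of_cFun hp hw, D.zb_of_cFun hq hw, edist_self]
      exact bot_le

/-! ## Distances in planes and edges -/

/-- Cut the straight segment at grid lines until each piece lies in one square; the induction is on
the sum of the two spans. -/
theorem edist_flatPt_le (a b : ℂ) : edist (D.flatPt a) (D.flatPt b) ≤ edist a b := by
  induction hn : span a.re b.re + span a.im b.im using Nat.strong_induction_on generalizing a b with
  | _ n ih =>
    have split : ∀ θ ∈ Set.Icc (0 : ℝ) 1,
        span a.re (a + θ * (b - a)).re + span a.im (a + θ * (b - a)).im < n →
        span (a + θ * (b - a)).re b.re + span (a + θ * (b - a)).im b.im < n →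
        edist (D.flatPt a) (D.flatPt b) ≤ edist a b := by
      intro θ hθ h1 h2
      rw [← edist_segment a b hθ]
      exact (edist_triangle _ _ _).trans (add_le_add (ih _ h1 _ _ rfl) (ih _ h2 _ _ rfl))
    have hre : ∀ θ : ℝ, (a + θ * (b - a)).re = a.re + θ * (b.re - a.re) := fun θ => by simp
    have him : ∀ θ : ℝ, (a + θ * (b - a)).im = a.im + θ * (b.im - a.im) := fun θ => by simp
    by_cases h1 : 2 ≤ span a.re b.re
    · obtain ⟨θ, hθ, h2, h3⟩ := exists_split h1
      have h4 := span_left_le (x := a.im) (x' := b.im) hθ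
      have h5 := span_right_le (x := a.im) (x' := b.im) hθ
      refine split θ hθ ?_ ?_ <;> rw [hre, him] <;> omega
    · by_cases h1' : 2 ≤ span a.im b.im
      · obtain ⟨θ, hθ, h2, h3⟩ := exists_split h1'
        have h4 := span_left_le (x := a.re) (x' := b.re) hθ
        have h5 := span_right_le (x := a.re) (x' := b.re) hθ
        refine split θ hθ ?_ ?_ <;> rw [hre, him] <;> omega
      · obtain ⟨i, ⟨ha1, ha2⟩, hb1, hb2⟩ := exists_unit_interval (not_le.1 h1)
        obtain ⟨j, ⟨ha3, ha4⟩, hb3, hb4⟩ := exists_unit_interval (not_le.1 h1')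
        have := D.isStep_square (s := a.re - i) (r := a.im - j) (s' := b.re - i) (r' := b.im - j)
          ⟨by linarith, by linarith⟩ ⟨by linarith, by linarith⟩ ⟨by linarith, by linarith⟩
          ⟨by linarith, by linarith⟩ (D.flatPt_val_of_mem ha1 ha2 ha3 ha4)
          (D.flatPt_val_of_mem hb1 hb2 hb3 hb4)
        refine (edist_le_of_isStep this).trans (le_of_eq ?_)
        exact edist_complex (by ring)

theorem edist_flatPt (a b : ℂ) : edist (D.flatPt a) (D.flatPt b) = edist a b := by
  refine le_antisymm (D.edist_flatPt_le a b) ?_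
  have := D.edist_rho_le (D.flatPt a) (D.flatPt b)
  rwa [rho_flatPt, rho_flatPt] at this

theorem edist_cPt {s s' : ℝ} (hs : s ∈ Set.Icc (0 : ℝ) 1) (hs' : s' ∈ Set.Icc (0 : ℝ) 1) :
    edist (D.cPt s) (D.cPt s') = edist s s' := by
  refine le_antisymm (edist_le_of_isStep (D.isStep_edge hs hs' (D.cPt_val hs) (D.cPt_val hs'))) ?_
  have := D.edist_zb_le (D.cPt s) (D.cPt s')
  rwa [D.zb_cPt hs, D.zb_cPt hs'] at this

/-! ## Cut points -/

/-- Points with different projections to the edge from `1` to `c` are separated by the points in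
between. -/
theorem edist_cut {p q : X.Realization} (h : D.zb q ≠ D.zb p) :
    edist p q = edist p (D.cPt (D.zb p)) + edist (D.cPt (D.zb p)) q := by
  refine le_antisymm (edist_triangle _ _ _) (le_sInf fun l hl => ?_)
  generalize hθ : D.zb p = θ at *
  induction (show X.IsString p q l from hl) with
  | nil p => exact absurd hθ h
  | @cons p p' q r l hs hstr ih =>
    by_cases hp' : D.zb p' = θ
    · refine (add_le_add_left (edist_triangle p p' _) _).trans ?_
      rw [add_assoc]
      exact add_le_add (edist_le_of_isStep hs) (ih hstr hp' h)
    -- Only a step inside the edge from `1` to `c` changes `zb`, so the first step leaving the level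
    -- `θ` starts at `cPt θ`.
    · have hp : p = D.cPt θ := by
        rcases D.isStep_cases hs with ⟨w, k, s, r, s', r', -, -, -, -, hp, hq, rfl⟩ |
          ⟨w, s, s', hs0, -, hp, hq, rfl⟩
        · rw [D.zb_of_sqFun hq] at hp'
          rw [D.zb_of_sqFun hp] at hθ
          exact absurd hθ hp'
        · by_cases hw : w = 1
          · subst hw
            rw [D.zb_of_cFun_one hp] at hθ
            subst hθ
            exact Subtype.ext (hp.trans (D.cPt_val hs0).symm)
          · rw [D.zb_of_cFun hq hw] at hp'
            rw [D.zb_of_cFun hp hw] at hθ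
            exact absurd hθ hp'
      rw [← hp, edist_self, zero_add]
      exact sInf_le (.cons hs hstr)

/-! ## The metric -/

theorem edist_ne_top (D : DiagModel X) (p q : X.Realization) : edist p q ≠ ⊤ := by
  have flat : ∀ (D : DiagModel X) (a b : ℂ), edist (D.flatPt a) (D.flatPt b) ≠ ⊤ := fun D a b => by
    rw [edist_flatPt]
    exact _root_.edist_ne_top _ _
  have edge : ∀ (D : DiagModel X) {s s' : ℝ}, s ∈ Set.Icc (0 : ℝ) 1 → s' ∈ Set.Icc (0 : ℝ) 1 →
      edist (D.cPt s) (D.cPt s') ≠ ⊤ := fun D s s' hs hs' => by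
    rw [D.edist_cPt hs hs']
    exact _root_.edist_ne_top _ _
  have trans : ∀ {p q r : X.Realization}, edist p q ≠ ⊤ → edist q r ≠ ⊤ → edist p r ≠ ⊤ :=
    fun h1 h2 => ne_top_of_le_ne_top (ENNReal.add_ne_top.2 ⟨h1, h2⟩) (edist_triangle _ _ _)
  have symm : ∀ {p q : X.Realization}, edist p q ≠ ⊤ → edist q p ≠ ⊤ := fun h => by
    rwa [edist_comm]
  have h0 : (0 : ℝ) ∈ Set.Icc (0 : ℝ) 1 := ⟨le_rfl, zero_le_one⟩
  have h1 : (1 : ℝ) ∈ Set.Icc (0 : ℝ) 1 := ⟨zero_le_one, le_rfl⟩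
  have key : ∀ w, edist (D.flatPt 0) ((D.tr w).flatPt 0) ≠ ⊤ := by
    intro w
    have := eq_of_invariant (f := fun w => edist (D.flatPt 0) ((D.tr w).flatPt 0) ≠ ⊤)
      (fun w => ?_) (fun w => ?_) w
    · rw [this, tr_one]
      exact flat D 0 0
    · have e : edist ((D.tr w).flatPt 0) ((D.tr (w * t)).flatPt 0) ≠ ⊤ := by
        have := (D.tr w).tr_zpow_flatPt 1 0
        rw [zpow_one, tr_tr] at this
        rw [this]
        exact flat _ _ _
      exact propext ⟨fun h => trans h (symm e), fun h => trans h e⟩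
    · have e : edist ((D.tr w).flatPt 0) ((D.tr (w * c)).flatPt 0) ≠ ⊤ := by
        rw [← cPt_zero, ← tr_tr, ← cPt_one]
        exact edge _ h0 h1
      exact propext ⟨fun h => trans h (symm e), fun h => trans h e⟩
  have base : ∀ p, edist (D.flatPt 0) p ≠ ⊤ := by
    intro p
    rcases D.point_cases p with ⟨w, a, rfl⟩ | ⟨w, s, hs, rfl⟩
    · exact trans (key w) (flat _ _ _)
    · refine trans (key w) ?_
      rw [← cPt_zero]
      exact edge _ h0 hs
  exact trans (symm (base p)) (base q)

theorem abs_mul_sub_mul_le {s r s' r' d : ℝ} (hs : s ∈ Set.Icc (0 : ℝ) 1)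
    (hr' : r' ∈ Set.Icc (0 : ℝ) 1) (h1 : |s - s'| ≤ d) (h2 : |r - r'| ≤ d) :
    |s * r - s' * r'| ≤ 2 * d := by
  have e : s * r - s' * r' = s * (r - r') + (s - s') * r' := by ring
  rw [e]
  refine (abs_add_le _ _).trans ?_
  rw [abs_mul, abs_mul, abs_of_nonneg hs.1, abs_of_nonneg hr'.1]
  have := abs_nonneg (s - s')
  have := abs_nonneg (r - r')
  nlinarith [hs.1, hs.2, hr'.1, hr'.2]

theorem abs_mul_ind_le {a d : ℝ} (h : |a| ≤ d) (u v : V) : |a * ind u v| ≤ d := by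
  unfold ind
  split_ifs
  · rwa [mul_one]
  · rw [mul_zero, abs_zero]
    exact (abs_nonneg a).trans h

/-- In a square each of the four weights changes by at most twice the length of the step, whence the
constant 8. These functions separate points, so the pseudometric is a metric. -/
theorem edist_eval_le (D : DiagModel X) (v : V) (p q : X.Realization) :
    edist (p.1 v / 8) (q.1 v / 8) ≤ edist p q := by
  refine le_edist_of_isStep (fun p => p.1 v / 8) (fun p q l h => ?_) p q
  rcases D.isStep_cases h with ⟨w, k, s, r, s', r', hs, hr, hs', hr', hp, hq, rfl⟩ |
    ⟨w, s, s', hs, hs', hp, hq, rfl⟩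
  · rw [edist_dist, edist_dist]
    refine ENNReal.ofReal_le_ofReal ?_
    have h1 : |s - s'| ≤ dist (⟨s, r⟩ : ℂ) ⟨s', r'⟩ := by
      rw [dist_eq_norm]
      exact Complex.abs_re_le_norm ((⟨s, r⟩ : ℂ) - ⟨s', r'⟩)
    have h2 : |r - r'| ≤ dist (⟨s, r⟩ : ℂ) ⟨s', r'⟩ := by
      rw [dist_eq_norm]
      exact Complex.abs_im_le_norm ((⟨s, r⟩ : ℂ) - ⟨s', r'⟩)
    generalize dist (⟨s, r⟩ : ℂ) ⟨s', r'⟩ = d at *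
    have h1' : |(1 - s) - (1 - s')| ≤ d := by
      rw [sub_sub_sub_cancel_left, abs_sub_comm]; exact h1
    have h2' : |(1 - r) - (1 - r')| ≤ d := by
      rw [sub_sub_sub_cancel_left, abs_sub_comm]; exact h2
    have k1 := abs_mul_ind_le (abs_mul_sub_mul_le (mem_Icc_symm hs) (mem_Icc_symm hr') h1' h2')
      (D.pt w k) v
    have k2 := abs_mul_ind_le (abs_mul_sub_mul_le hs (mem_Icc_symm hr') h1 h2') (D.pt w (k + 1)) v
    have k3 := abs_mul_ind_le (abs_mul_sub_mul_le (mem_Icc_symm hs) hr' h1' h2)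
      (D.pt (w * t) (k - 1)) v
    have k4 := abs_mul_ind_le (abs_mul_sub_mul_le hs hr' h1 h2) (D.pt (w * t) k) v
    rw [Real.dist_eq, hp, hq, abs_le]
    rw [abs_le] at k1 k2 k3 k4
    simp only [sqFun]
    constructor <;> nlinarith
  · rw [edist_dist, edist_dist]
    refine ENNReal.ofReal_le_ofReal ?_
    rw [Real.dist_eq, Real.dist_eq, hp, hq]
    have k1 := abs_mul_ind_le (a := (1 - s) - (1 - s')) (d := |s - s'|)
      (by rw [sub_sub_sub_cancel_left, abs_sub_comm]) (D.pt w 0) v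
    have k2 := abs_mul_ind_le (le_refl |s - s'|) (D.pt (w * c) 0) v
    have k3 := abs_nonneg (s - s')
    generalize hd : |s - s'| = d at *
    rw [abs_le] at k1 k2 ⊢
    simp only [cFun]
    constructor <;> nlinarith

theorem eq_of_edist_eq_zero (D : DiagModel X) (p q : X.Realization) (h : edist p q = 0) :
    p = q := by
  refine Subtype.ext (funext fun v => ?_)
  have := D.edist_eval_le v p q
  rw [h, nonpos_iff_eq_zero, edist_eq_zero] at this
  linarith

end DiagModel

end DiagonalPlanes

end

noncomputable section

namespace DiagonalPlanes

variable {V : Type*} {X : CubeFamily V}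

namespace DiagModel

variable (D : DiagModel X)

/-! ## Distances and cut points -/

theorem rd_flatPt (a b : ℂ) : rd (D.flatPt a) (D.flatPt b) = dist a b := by
  rw [rd, edist_flatPt, edist_dist, ENNReal.toReal_ofReal dist_nonneg]

theorem rd_cPt {s s' : ℝ} (hs : s ∈ Set.Icc (0 : ℝ) 1) (hs' : s' ∈ Set.Icc (0 : ℝ) 1) :
    rd (D.cPt s) (D.cPt s') = |s - s'| := by
  rw [rd, D.edist_cPt hs hs', edist_dist, ENNReal.toReal_ofReal dist_nonneg, Real.dist_eq]

theorem rd_cut {p q : X.Realization} {θ : ℝ} (hp : D.zb p = θ) (hq : D.zb q ≠ θ) :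
    rd p q = rd p (D.cPt θ) + rd (D.cPt θ) q := by
  subst hp
  rw [rd, D.edist_cut hq, ENNReal.toReal_add (D.edist_ne_top _ _) (D.edist_ne_top _ _), rd, rd]

theorem zb_cases (p : X.Realization) :
    (D.zb p = 0 ∨ D.zb p = 1) ∨ ∃ s ∈ Set.Icc (0 : ℝ) 1, p = D.cPt s := by
  have hz : ∀ w : F2, (DiagonalPlanes.z w : ℝ) = 0 ∨ (DiagonalPlanes.z w : ℝ) = 1 := fun w =>
    (z_eq_zero_or_one w).imp (fun h => by exact_mod_cast h) fun h => by exact_mod_cast h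
  rcases D.point_cases p with ⟨w, a, rfl⟩ | ⟨w, s, hs, rfl⟩
  · rw [zb_tr_flatPt]
    exact .inl (hz w)
  · by_cases hw : w = 1
    · exact .inr ⟨s, hs, by rw [hw, tr_one]⟩
    · rw [D.zb_tr_cPt hw hs]
      exact .inl (hz w)

theorem mem_Icc_of_eq {θ : ℝ} (h : θ = 0 ∨ θ = 1) : θ ∈ Set.Icc (0 : ℝ) 1 := by
  rcases h with rfl | rfl <;> simp

/-- The plane `g' T` is adjacent to the plane `g T`, and farther from `T`. -/
def IsNext (g g' : F2) : Prop :=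
  ∃ (E : DiagModel X) (θ : ℝ), (θ = 0 ∨ θ = 1) ∧ E.cPt θ = (D.tr g).flatPt 0 ∧
    E.cPt (1 - θ) = (D.tr g').flatPt 0 ∧ (∀ a, E.zb (D.flatPt a) = θ) ∧
    ∀ a, E.zb ((D.tr g').flatPt a) = 1 - θ

/-- The edge from `g` to `g * c` points away from `1`, so `T` is on the side of its end `0`. For
`c⁻¹` the edge starts at `g * c⁻¹`, and the roles of its ends are exchanged. -/
theorem isNext_mul_c {g : F2} (h : g.norm < (g * c).norm) : D.IsNext g (g * c) := by
  refine ⟨D.tr g, 0, .inl rfl, cPt_zero _, ?_, fun a => ?_, fun a => ?_⟩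
  · rw [sub_zero, cPt_one, tr_tr]
  · rw [tr_zb_flatPt, z_inv_eq_zero h, Int.cast_zero]
  · rw [← tr_tr, zb_tr_flatPt, z_c, Int.cast_one, sub_zero]

theorem isNext_mul_c_inv {g : F2} (h : g.norm < (g * c⁻¹).norm) : D.IsNext g (g * c⁻¹) := by
  refine ⟨D.tr (g * c⁻¹), 1, .inr rfl, ?_, ?_, fun a => ?_, fun a => ?_⟩
  · rw [cPt_one, tr_tr, inv_mul_cancel_right]
  · rw [sub_self, cPt_zero]
  · rw [tr_zb_flatPt, mul_inv_rev, inv_inv, z_c_mul_inv_eq_one h, Int.cast_one]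
  · rw [zb_flatPt, sub_self]

/-- Induction on word length: a last letter `t` or `t⁻¹` stays in the plane, a last letter `c` or
`c⁻¹` leads to the next plane. -/
theorem plane_induction {P : F2 → Prop} (h1 : P 1) (ht : ∀ g n, P g → P (g * t ^ (n : ℤ)))
    (hnext : ∀ g g', D.IsNext g g' → P g → P g') (g : F2) : P g := by
  induction hn : g.norm using Nat.strong_induction_on generalizing g with
  | _ n ih =>
    by_cases hg : g = 1
    · rwa [hg]
    · obtain ⟨g', hlt, rfl | rfl | rfl | rfl⟩ := exists_shorter hg
      · simpa using ht g' 1 (ih _ (hn ▸ hlt) _ rfl)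
      · simpa using ht g' (-1) (ih _ (hn ▸ hlt) _ rfl)
      · exact hnext _ _ (D.isNext_mul_c hlt) (ih _ (hn ▸ hlt) _ rfl)
      · exact hnext _ _ (D.isNext_mul_c_inv hlt) (ih _ (hn ▸ hlt) _ rfl)

/-- `p` has a gate in the plane `T`. -/
def HasGate (p : X.Realization) : Prop :=
  ∃ b, ∀ a, rd p (D.flatPt a) = rd p (D.flatPt b) + rd (D.flatPt b) (D.flatPt a)

theorem HasGate.of_cut {p o : X.Realization} (ho : D.HasGate o)
    (h : ∀ a, rd p (D.flatPt a) = rd p o + rd o (D.flatPt a)) : D.HasGate p := by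
  obtain ⟨b, hb⟩ := ho
  refine ⟨b, fun a => ?_⟩
  rw [h a, h b, hb a]
  ring

/-- The attaching point in the nearer plane separates the farther plane from `T`, so its gate serves
for the farther plane. -/
theorem hasGate_flatPt (g : F2) (a : ℂ) : D.HasGate ((D.tr g).flatPt a) := by
  induction g using D.plane_induction generalizing a with
  | h1 => exact ⟨a, fun b => by rw [tr_one, rd_self, zero_add]⟩
  | ht g n ih =>
    rw [← tr_tr, tr_zpow_flatPt]
    exact ih _
  | hnext g g' h ih =>
    obtain ⟨E, θ, hθ, h1, -, h3, h4⟩ := h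
    refine HasGate.of_cut D (ih 0) fun b => ?_
    rw [← h1, rd_comm, E.rd_cut (h3 b) (by rw [h4]; rcases hθ with rfl | rfl <;> norm_num),
      rd_comm (E.cPt θ), rd_comm (E.cPt θ), add_comm]

theorem hasGate (p : X.Realization) : D.HasGate p := by
  rcases D.point_cases p with ⟨w, a, rfl⟩ | ⟨w, s, hs, rfl⟩
  · exact D.hasGate_flatPt w a
  · have h0 : D.HasGate ((D.tr w).cPt 0) := by
      rw [cPt_zero]
      exact D.hasGate_flatPt _ _
    have h1 : D.HasGate ((D.tr w).cPt 1) := by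
      rw [cPt_one, tr_tr]
      exact D.hasGate_flatPt _ _
    -- `θ` is the end of the edge on the side of `T`.
    obtain ⟨θ, hθ, hz⟩ : ∃ θ : ℝ, (θ = 0 ∨ θ = 1) ∧ ∀ a, (D.tr w).zb (D.flatPt a) = θ := by
      refine ⟨DiagonalPlanes.z w⁻¹, ?_, fun a => D.tr_zb_flatPt w a⟩
      exact (z_eq_zero_or_one w⁻¹).imp (fun h => by exact_mod_cast h) fun h => by exact_mod_cast h
    have ho : D.HasGate ((D.tr w).cPt θ) := by rcases hθ with rfl | rfl <;> assumption
    by_cases hsθ : s = θ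
    · rwa [hsθ]
    · refine HasGate.of_cut D ho fun b => ?_
      rw [rd_comm, (D.tr w).rd_cut (hz b) (by rwa [zb_cPt _ hs]), rd_comm (D.flatPt b),
        rd_comm _ ((D.tr w).cPt s), add_comm]

/-! ## The CAT(0) inequality -/

/-- For points of the plane the comparison is an equality, by Stewart's formula; gates extend it to
all points. -/
theorem good_flatPt (a b : ℂ) : Good (D.flatPt a) (D.flatPt b) := by
  refine good_of_gate D.edist_ne_top (A := Set.range D.flatPt) (fun p => ?_) ⟨a, rfl⟩ ⟨b, rfl⟩
    fun s hs => ⟨_, ⟨(1 - s) * a + s * b, rfl⟩, ?_⟩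
  · obtain ⟨b, hb⟩ := D.hasGate p
    refine ⟨_, ⟨b, rfl⟩, ?_⟩
    rintro _ ⟨a, rfl⟩
    exact hb a
  · rintro _ ⟨p, rfl⟩
    simp only [rd_flatPt, dist_eq_norm, Complex.sq_norm, Complex.normSq_apply, Complex.sub_re,
      Complex.sub_im, Complex.add_re, Complex.add_im, Complex.mul_re, Complex.mul_im,
      Complex.ofReal_re, Complex.ofReal_im, Complex.one_re, Complex.one_im]
    exact le_of_eq (by ring)

/-- The gate of a point off the edge is the end `cPt (zb p)`. -/
theorem good_cPt {r r' : ℝ} (hr : r ∈ Set.Icc (0 : ℝ) 1) (hr' : r' ∈ Set.Icc (0 : ℝ) 1) :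
    Good (D.cPt r) (D.cPt r') := by
  refine good_of_gate D.edist_ne_top (A := D.cPt '' Set.Icc (0 : ℝ) 1) (fun p => ?_) ⟨r, hr, rfl⟩
    ⟨r', hr', rfl⟩ fun s hs => ?_
  · rcases D.zb_cases p with h | ⟨s, hs, rfl⟩
    · refine ⟨_, ⟨_, mem_Icc_of_eq h, rfl⟩, ?_⟩
      rintro _ ⟨s, hs, rfl⟩
      by_cases hsp : s = D.zb p
      · rw [hsp, rd_self, add_zero]
      · exact D.rd_cut rfl (by rwa [zb_cPt _ hs])
    · exact ⟨_, ⟨s, hs, rfl⟩, fun q _ => by rw [rd_self, zero_add]⟩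
  · have hm : (1 - s) * r + s * r' ∈ Set.Icc (0 : ℝ) 1 := by
      have := convex_Icc (0 : ℝ) 1 hr hr' (sub_nonneg.2 hs.2) hs.1 (sub_add_cancel 1 s)
      simpa using this
    refine ⟨_, ⟨_, hm, rfl⟩, ?_⟩
    rintro _ ⟨p, hp, rfl⟩
    rw [D.rd_cPt hp hm, D.rd_cPt hp hr, D.rd_cPt hp hr', D.rd_cPt hr hr', sq_abs, sq_abs, sq_abs,
      sq_abs]
    exact le_of_eq (by ring)

/-- A third point with `zb = θ` is separated from `y` by `cPt θ`, and any other one is separated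
from `x`. -/
theorem good_of_cut {x y : X.Realization} {θ : ℝ} (hx : D.zb x = θ) (hy : D.zb y ≠ θ)
    (h1 : Good x (D.cPt θ)) (h2 : Good (D.cPt θ) y) : Good x y := by
  refine h1.concat D.edist_ne_top h2 (D.rd_cut hx hy) fun p => ?_
  by_cases hp : D.zb p = θ
  · exact .inr (D.rd_cut hp hy)
  · left
    rw [rd_comm, D.rd_cut hx hp, rd_comm x, rd_comm _ p, add_comm]

theorem good_planes (g : F2) (a b : ℂ) : Good (D.flatPt a) ((D.tr g).flatPt b) := by
  induction g using D.plane_induction generalizing b with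
  | h1 =>
    rw [tr_one]
    exact D.good_flatPt a b
  | ht g n ih =>
    rw [← tr_tr, tr_zpow_flatPt]
    exact ih _
  | hnext g g' h ih =>
    obtain ⟨E, θ, hθ, h1, h2, h3, h4⟩ := h
    have hne : 1 - θ ≠ θ := by rcases hθ with rfl | rfl <;> norm_num
    have hm := mem_Icc_of_eq hθ
    -- The geodesic runs through the plane `g T` to `E.cPt θ`, along the edge to `E.cPt (1 - θ)`,
    -- then inside the plane `g' T`.
    refine E.good_of_cut (h3 a) (by rwa [h4]) (h1 ▸ ih 0) (Good.symm ?_)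
    refine E.good_of_cut (h4 b) ?_ ?_ (E.good_cPt (mem_Icc_symm hm) hm)
    · rw [E.zb_cPt hm]
      exact hne.symm
    · rw [h2]
      exact good_flatPt _ _ _

theorem good_cPt_right {x : X.Realization} (h0 : Good x (D.cPt 0)) (h1 : Good x (D.cPt 1)) {s : ℝ}
    (hs : s ∈ Set.Icc (0 : ℝ) 1) : Good x (D.cPt s) := by
  rcases D.zb_cases x with h | ⟨r, hr, rfl⟩
  · have hm := mem_Icc_of_eq h
    have hg : Good x (D.cPt (D.zb x)) := by rcases h with h | h <;> rwa [h]
    by_cases hsx : s = D.zb x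
    · rwa [hsx]
    · exact D.good_of_cut rfl (by rwa [D.zb_cPt hs]) hg (D.good_cPt hm hs)
  · exact D.good_cPt hr hs

theorem good (D : DiagModel X) (x y : X.Realization) : Good x y := by
  have key : ∀ x, (∀ w a, Good x ((D.tr w).flatPt a)) → ∀ y, Good x y := by
    intro x hx y
    rcases D.point_cases y with ⟨w, a, rfl⟩ | ⟨w, s, hs, rfl⟩
    · exact hx w a
    · refine (D.tr w).good_cPt_right ?_ ?_ hs
      · rw [cPt_zero]
        exact hx _ _
      · rw [cPt_one, tr_tr]
        exact hx _ _
  refine key x (fun w a => (key _ (fun u b => ?_) x).symm) y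
  have := (D.tr w).good_planes (w⁻¹ * u) a b
  rwa [tr_tr, mul_inv_cancel_left] at this

theorem isCAT0 (D : DiagModel X) : IsCAT0 X.Realization :=
  isCAT0_of_good D.edist_ne_top D.eq_of_edist_eq_zero D.good

theorem isCAT0CubeComplex (D : DiagModel X) : X.IsCAT0CubeComplex :=
  ⟨D.isCubicalComplex, D.isCAT0⟩

/-! ## The action on the realization and on its visual boundary -/

@[simp] theorem x_isomTo (D' : DiagModel X) (v : V) : D'.x ((D.isomTo D').1 v) = D.x v := by
  obtain ⟨w, k, rfl⟩ := D.exists_pt v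
  rw [isomTo_pt]
  by_cases hw : w ∈ T
  · rw [x_pt_of_mem _ hw, x_pt_of_mem _ hw]
  · rw [x_pt_of_notMem _ hw, x_pt_of_notMem _ hw]

@[simp] theorem z_isomTo (D' : DiagModel X) (v : V) : D'.z ((D.isomTo D').1 v) = D.z v := by
  obtain ⟨w, k, rfl⟩ := D.exists_pt v
  rw [isomTo_pt, z_pt, z_pt]

theorem isomTo_tr (D' : DiagModel X) (w : F2) : (D.tr w).isomTo (D'.tr w) = D.isomTo D' := by
  refine Subtype.ext (Equiv.ext fun v => ?_)
  obtain ⟨u, k, rfl⟩ := (D.tr w).exists_pt v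
  rw [isomTo_pt, tr_pt, tr_pt, isomTo_pt]

theorem zb_isomTo (D' : DiagModel X) (p : X.Realization) : D'.zb (D.isomTo D' • p) = D.zb p := by
  simp only [zb, ev_smul, z_isomTo]

theorem isomTo_cPt (D' : DiagModel X) {s : ℝ} (hs : s ∈ Set.Icc (0 : ℝ) 1) :
    D.isomTo D' • D.cPt s = D'.cPt s := by
  refine Subtype.ext (funext fun v => ?_)
  have hi : ∀ u, ind u ((D.isomTo D').1⁻¹ v) = ind ((D.isomTo D').1 u) v := fun u => by
    have : u = (D.isomTo D').1⁻¹ v ↔ (D.isomTo D').1 u = v := Equiv.Perm.eq_inv_iff_eq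
    by_cases h : (D.isomTo D').1 u = v
    · rw [ind, ind, if_pos h, if_pos (this.2 h)]
    · rw [ind, ind, if_neg h, if_neg (mt this.1 h)]
  change (D.cPt s).1 ((D.isomTo D').1⁻¹ v) = _
  rw [D.cPt_val hs, D'.cPt_val hs]
  simp only [cFun, hi, isomTo_pt]

/-- The weights of a point of the realization sum to one. -/
theorem ev_add_const (D : DiagModel X) (f : V → ℝ) (r : ℝ) (p : X.Realization) :
    ev (fun v => f v + r) p.1 = ev f p.1 + r := by
  rcases D.realization_cases p with ⟨w, k, s, r', -, -, hp⟩ | ⟨w, s, -, hp⟩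
  · rw [hp, ev_sqFun, ev_sqFun]
    ring
  · rw [hp, ev_cFun, ev_cFun]
    ring

theorem rho_re_isomTo (D' : DiagModel X) (p : X.Realization) :
    (D'.rho (D.isomTo D' • p)).re = (D.rho p).re := by
  simp only [rho, ev_smul, x_isomTo]

theorem rho_re_tr_zpow (n : ℤ) (p : X.Realization) :
    ((D.tr (t ^ n)).rho p).re = (D.rho p).re - n := by
  simp only [rho, tr_t_zpow_x, Int.cast_sub]
  simp only [sub_eq_add_neg]
  exact D.ev_add_const _ _ _

theorem rho_re_eq_zero {p : X.Realization} (h : D.zb p ≠ 0) : (D.rho p).re = 0 := by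
  have hτ : ∀ w : F2, (DiagonalPlanes.z w : ℝ) ≠ 0 → (tau w : ℝ) = 0 := fun w hw => by
    by_contra hne
    exact hw (by exact_mod_cast z_eq_zero_of_tau_ne (by exact_mod_cast hne))
  rcases D.realization_cases p with ⟨w, k, s, r, -, -, hp⟩ | ⟨w, s, -, hp⟩
  · rw [D.zb_of_sqFun hp] at h
    by_cases hw : w ∈ T
    · rw [eq_zpow_tau hw, ← one_mul (t ^ _), z_mul_zpow, z_one] at h
      simp at h
    · rw [D.rho_of_notMem hp hw]
      exact hτ w h
  · rw [D.rho_of_cFun hp]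
    by_cases hw : w = 1
    · simp [hw, tau_one]
    · rw [D.zb_of_cFun hp hw] at h
      exact hτ w h

theorem rho_re_tr_c_eq_zero {p : X.Realization} (h : D.zb p ≠ 1) : ((D.tr c).rho p).re = 0 := by
  have hτ : ∀ w : F2, (DiagonalPlanes.z (c * w) : ℝ) ≠ 1 → (tau w : ℝ) = 0 := fun w hw => by
    by_contra hne
    exact hw (by exact_mod_cast z_c_mul_eq_one_of_tau_ne (by exact_mod_cast hne))
  rcases (D.tr c).realization_cases p with ⟨w, k, s, r, -, -, hp⟩ | ⟨w, s, -, hp⟩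
  · rw [D.zb_of_sqFun (hp.trans (D.tr_sqFun _ _ _ _ _))] at h
    by_cases hw : w ∈ T
    · rw [eq_zpow_tau hw, z_mul_zpow, z_c] at h
      simp at h
    · rw [(D.tr c).rho_of_notMem hp hw]
      exact hτ w h
  · rw [(D.tr c).rho_of_cFun hp]
    by_cases hw : c * w = 1
    · rw [eq_inv_of_mul_eq_one_right hw]
      have := tau_mul_c_inv 1
      rw [one_mul, tau_one] at this
      simp [this]
    · rw [D.zb_of_cFun (hp.trans (D.tr_cFun _ _ _)) hw] at h
      exact hτ w h

/-- The translation by `n` along the diagonal of the plane `u T`. -/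
def shift (u : F2) (n : ℤ) : X.isom := D.isomTo (D.tr (u * t ^ n * u⁻¹))

theorem rho_re_shift (u : F2) (n : ℤ) (p : X.Realization) :
    ((D.tr u).rho (D.shift u n • p)).re = ((D.tr u).rho p).re + n := by
  have h := (D.tr u).rho_re_isomTo ((D.tr (u * t ^ n * u⁻¹)).tr u) p
  rw [isomTo_tr, tr_tr, inv_mul_cancel_right, ← tr_tr, rho_re_tr_zpow] at h
  rw [← h, shift, sub_add_cancel]

/-- Points on one side of the edge from `1` to `c` are moved far apart by the translations along
the plane on the other side. -/
theorem edist_cPt_le {u : F2} {θ : ℝ} (hθ : θ ∈ Set.Icc (0 : ℝ) 1)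
    (hu : ∀ (D : DiagModel X) (p : X.Realization), D.zb p ≠ θ → ((D.tr u).rho p).re = 0)
    {p : X.Realization} (hp : D.zb p ≠ θ) {i j : ℤ} (hij : i ≠ j) :
    edist (D.cPt θ) p ≤ edist (D.shift u i • p) (D.shift u j • p) := by
  -- With respect to the edge translated by `shift u i`, the image of `p` under `shift u i` lies off
  -- the level `θ`, while the image under `shift u j` lies on it; otherwise its first coordinate in
  -- the plane `u T` would be both `i` and `j`. Hence the translate of `cPt θ` separates the two
  -- images.
  have h1 : (D.tr (u * t ^ i * u⁻¹)).zb (D.shift u i • p) ≠ θ := by rwa [shift, zb_isomTo]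
  have h2 : (D.tr (u * t ^ i * u⁻¹)).zb (D.shift u j • p) = θ := by
    by_contra h
    have := hu _ _ h
    rw [tr_tr, inv_mul_cancel_right, ← tr_tr, rho_re_tr_zpow, rho_re_shift, hu D p hp, zero_add,
      sub_eq_zero] at this
    exact hij (by exact_mod_cast this.symm)
  have h3 := (D.tr (u * t ^ i * u⁻¹)).edist_cut (p := D.shift u j • p) (q := D.shift u i • p)
    (by rwa [h2])
  rw [h2, ← D.isomTo_cPt _ hθ] at h3
  change _ = _ + edist (D.shift u i • D.cPt θ) _ at h3
  rw [edist_smul_left] at h3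
  rw [edist_comm (D.shift u i • p), h3]
  exact le_add_self

/-- A finite orbit makes two distinct shifts agree on `ξ`, so the two translated rays stay at
bounded distance, which bounds the part of the ray off the level `θ`. -/
theorem exists_edist_cPt_le {u : F2} {θ : ℝ} (hθ : θ ∈ Set.Icc (0 : ℝ) 1)
    (hu : ∀ (D : DiagModel X) (p : X.Realization), D.zb p ≠ θ → ((D.tr u).rho p).re = 0)
    {ξ : VisualBoundary X.Realization} (h : (MulAction.orbit X.isom ξ).Finite)
    {γ : GeodesicRay X.Realization} (hγ : ξ = Quotient.mk _ γ) :
    ∃ C : ℝ≥0, ∀ s, D.zb (γ.1 s) ≠ θ → edist (D.cPt θ) (γ.1 s) ≤ C := by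
  have : ¬ Function.Injective fun n => D.shift u n • ξ := fun hi =>
    Set.infinite_of_injective_forall_mem hi (fun n => MulAction.mem_orbit ξ (D.shift u n)) h
  simp only [Function.Injective, not_forall] at this
  obtain ⟨i, j, he, hij⟩ := this
  subst hγ
  obtain ⟨C, hC⟩ := Quotient.exact he
  exact ⟨C, fun s hs => (D.edist_cPt_le hθ hu hs hij).trans (hC s)⟩

theorem not_isElementaryAction (D : DiagModel X) : ¬ IsElementaryAction X.isom X.Realization := by
  have m0 : (0 : ℝ) ∈ Set.Icc (0 : ℝ) 1 := ⟨le_rfl, zero_le_one⟩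
  have m1 : (1 : ℝ) ∈ Set.Icc (0 : ℝ) 1 := ⟨zero_le_one, le_rfl⟩
  rintro (⟨p, hp⟩ | ⟨ξ, hξ⟩)
  · refine Set.infinite_of_injective_forall_mem (f := fun n => D.shift 1 n • p) (fun i j h => ?_)
      (fun n => MulAction.mem_orbit p (D.shift 1 n)) hp
    have hi := D.rho_re_shift 1 i p
    have hj := D.rho_re_shift 1 j p
    rw [show D.shift 1 i • p = D.shift 1 j • p from h, hj] at hi
    exact_mod_cast (add_left_cancel hi).symm
  · induction ξ using Quotient.inductionOn with
    | h γ =>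
      -- The planes `T` and `c T` bound the parts of the ray with `zb ≠ 0` and `zb ≠ 1`
      -- respectively, and every point of the ray belongs to one of them.
      obtain ⟨C, hC⟩ := D.exists_edist_cPt_le (u := 1) m0
        (fun D p hp => by rw [tr_one]; exact D.rho_re_eq_zero hp) hξ rfl
      obtain ⟨C', hC'⟩ := D.exists_edist_cPt_le m1 (fun D p hp => D.rho_re_tr_c_eq_zero hp) hξ rfl
      have hb : ∀ s, edist (D.cPt 0) (γ.1 s) ≤ C + (1 + C') := fun s => by
        by_cases h0 : D.zb (γ.1 s) = 0
        · refine ((edist_triangle _ (D.cPt 1) _).trans (add_le_add ?_ (hC' s (by simp [h0])))).trans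
            le_add_self
          rw [D.edist_cPt m0 m1, edist_dist]
          simp
        · exact (hC s h0).trans le_self_add
      -- All points of the ray are within `C + (1 + C')` of `cPt 0`; a time exceeding twice this
      -- bound gives the contradiction.
      have h1 := (edist_triangle_left (γ.1 0) (γ.1 (C + (1 + C') + (C + (1 + C')) + 1))
        (D.cPt 0)).trans (add_le_add (hb _) (hb _))
      rw [γ.2.edist_eq, edist_nndist, NNReal.nndist_zero_eq_val] at h1
      norm_cast at h1
      exact absurd h1 (not_le.2 (lt_add_one _))

end DiagModel

end DiagonalPlanes

end

noncomputable section

namespace DiagonalPlanes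

/-! # The subcomplex of the universal cover of the Salvetti complex -/

open SalvettiExample (Z2Z salvettiCover a b)

theorem a_zpow_mul_b_zpow (i j : ℤ) :
    a ^ i * b ^ j = Monoid.Coprod.inl (Multiplicative.ofAdd (i, j)) := by
  have h : (i, j) = i • ((1, 0) : ℤ × ℤ) + j • (0, 1) := by simp
  rw [h, ofAdd_add, ofAdd_zsmul, ofAdd_zsmul, map_mul, map_zpow, map_zpow, a, b]

theorem a_mul_b_comm : a * b = b * a := by
  rw [a, b, ← map_mul Monoid.Coprod.inl, ← map_mul Monoid.Coprod.inl, mul_comm]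

/-- The homomorphism from `F2` with values `a * b` and `c` on the generators. -/
def iota : F2 →* Z2Z := FreeGroup.lift fun i => if i then SalvettiExample.c else a * b

@[simp] theorem iota_t : iota t = a * b := by simp [iota, t]

@[simp] theorem iota_c : iota c = SalvettiExample.c := by simp [iota, c]

/-- The vertex of the universal cover with given coordinates. -/
def vertex (x : F2 × ℤ) : Z2Z := iota x.1 * a ^ x.2

theorem vertex_mul_a (w : F2) (k : ℤ) : vertex (w, k) * a = vertex (w, k + 1) := by
  simp only [vertex, zpow_add_one, mul_assoc]

theorem vertex_mul_b (w : F2) (k : ℤ) : vertex (w, k) * b = vertex (w * t, k - 1) := by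
  have h : Commute (a ^ k) b := (show Commute a b from a_mul_b_comm).zpow_left k
  have h' : Commute a (a ^ (k - 1)) := Commute.zpow_right rfl _
  rw [vertex, vertex, map_mul, iota_t, mul_assoc, mul_assoc, h.eq, a_mul_b_comm, mul_assoc,
    ← zpow_one_add]
  simp

theorem vertex_mul_c (w : F2) : vertex (w, 0) * SalvettiExample.c = vertex (w * c, 0) := by
  simp [vertex]

/-! ### The right action of the free product and the coordinates it defines -/

/-- The action of an element of `ℤ²` on the coordinates. -/
def planeShift (m : ℤ × ℤ) : Equiv.Perm (F2 × ℤ) where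
  toFun x := (x.1 * t ^ m.2, x.2 + (m.1 - m.2))
  invFun x := (x.1 * (t ^ m.2)⁻¹, x.2 - (m.1 - m.2))
  left_inv x := by simp
  right_inv x := by simp

/-- The action of `c` on the coordinates, which fixes the vertices outside the diagonals. -/
def edgeShift : Equiv.Perm (F2 × ℤ) where
  toFun x := (if x.2 = 0 then x.1 * c else x.1, x.2)
  invFun x := (if x.2 = 0 then x.1 * c⁻¹ else x.1, x.2)
  left_inv x := by by_cases h : x.2 = 0 <;> simp [h, Prod.ext_iff]
  right_inv x := by by_cases h : x.2 = 0 <;> simp [h, Prod.ext_iff]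

/-- The right action on the coordinates. -/
def rightAction : Z2Z →* (Equiv.Perm (F2 × ℤ))ᵐᵒᵖ :=
  Monoid.Coprod.lift
    { toFun := fun m => MulOpposite.op (planeShift m.toAdd)
      map_one' := by
        rw [MulOpposite.op_eq_one_iff]
        ext x <;> simp [planeShift]
      map_mul' := fun m n => by
        rw [← MulOpposite.op_mul]
        congr 1
        ext x
        · simp only [planeShift, Equiv.coe_fn_mk, Equiv.Perm.mul_apply, toAdd_mul, Prod.snd_add,
            zpow_add, mul_assoc]
        · simp only [planeShift, Equiv.coe_fn_mk, Equiv.Perm.mul_apply, toAdd_mul, Prod.snd_add,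
            Prod.fst_add]
          ring }
    (zpowersHom _ (MulOpposite.op edgeShift))

/-- The coordinates of the nearest vertex of the subcomplex. -/
def coord (g : Z2Z) : F2 × ℤ := (rightAction g).unop (1, 0)

theorem coord_mul (g h : Z2Z) : coord (g * h) = (rightAction h).unop (coord g) := by
  simp [coord]

theorem coord_mul_a (g : Z2Z) : coord (g * a) = ((coord g).1, (coord g).2 + 1) := by
  simp [coord_mul, a, rightAction, planeShift]

theorem coord_mul_b (g : Z2Z) : coord (g * b) = ((coord g).1 * t, (coord g).2 - 1) := by
  simp [coord_mul, b, rightAction, planeShift, sub_eq_add_neg]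

theorem coord_mul_c (g : Z2Z) : coord (g * SalvettiExample.c) =
    (if (coord g).2 = 0 then (coord g).1 * c else (coord g).1, (coord g).2) := by
  simp [coord_mul, SalvettiExample.c, rightAction, edgeShift]

theorem coord_one : coord 1 = (1, 0) := by simp [coord]

theorem coord_mul_a_zpow (g : Z2Z) (k : ℤ) :
    coord (g * a ^ k) = ((coord g).1, (coord g).2 + k) := by
  have := a_zpow_mul_b_zpow k 0
  rw [zpow_zero, mul_one] at this
  simp [coord_mul, this, rightAction, planeShift]

/-- On the orbit of `(1, 0)` under the image of `iota`, the second coordinate stays zero, so `a * b`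
and `c` act as right multiplication by `t` and `c`. -/
theorem coord_iota (w : F2) : coord (iota w) = (w, 0) := by
  have hab : ∀ g, coord (g * (a * b)) = ((coord g).1 * t, (coord g).2) := fun g => by
    rw [← mul_assoc, coord_mul_b, coord_mul_a]
    simp
  have hz : ∀ w, (coord (iota w)).2 = 0 := fun w => by
    induction w using induction_right with
    | h1 => rw [map_one, coord_one]
    | ht u h => rw [map_mul, iota_t, hab, h]
    | ht' u h =>
      rw [← h, ← inv_mul_cancel_right u t, map_mul _ (u * t⁻¹), iota_t, hab,
        inv_mul_cancel_right]
    | hc u h => rw [map_mul, iota_c, coord_mul_c, h]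
    | hc' u h =>
      rw [← h, ← inv_mul_cancel_right u c, map_mul _ (u * c⁻¹), iota_c, coord_mul_c,
        inv_mul_cancel_right]
  have key := eq_of_invariant (f := fun w => (coord (iota w)).1 * w⁻¹)
    (fun u => by rw [map_mul, iota_t, hab]; group)
    (fun u => by rw [map_mul, iota_c, coord_mul_c, if_pos (hz u)]; group) w
  rw [map_one, coord_one, inv_one, mul_one, mul_inv_eq_one] at key
  exact Prod.ext key (hz w)

theorem coord_vertex (x : F2 × ℤ) : coord (vertex x) = x := by
  simp [vertex, coord_mul_a_zpow, coord_iota]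

theorem vertex_injective : Function.Injective vertex :=
  Function.LeftInverse.injective coord_vertex

theorem ne_mul_a (g : Z2Z) : g ≠ g * a := fun h => by
  have := coord_mul_a g
  rw [← h] at this
  simpa using congrArg Prod.snd this

theorem ne_mul_b (g : Z2Z) : g ≠ g * b := fun h => by
  have := coord_mul_b g
  rw [← h] at this
  have := congrArg Prod.snd this
  simp only at this
  omega

theorem mul_a_ne_mul_b (g : Z2Z) : g * a ≠ g * b := fun h => by
  have h1 := coord_mul_a g
  rw [h, coord_mul_b] at h1
  have := congrArg Prod.snd h1
  simp only at this
  omega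

theorem ne_mul_c (g : Z2Z) : g ≠ g * SalvettiExample.c := fun h => by
  have h1 : SalvettiExample.c = 1 := (left_eq_mul.1 h)
  have := coord_mul_c 1
  rw [h1, mul_one, coord_one] at this
  simpa [c_ne_one] using (congrArg Prod.fst this).symm

/-- The vertices of the subcomplex. -/
def vertices : Set Z2Z := Set.range vertex

theorem vertex_coord {g : Z2Z} (h : g ∈ vertices) : vertex (coord g) = g := by
  obtain ⟨x, rfl⟩ := h
  rw [coord_vertex]

/-- An edge with label `c` of the subcomplex starts at a diagonal vertex. -/
theorem snd_eq_zero_of_mul_c_mem {w : F2} {k : ℤ}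
    (h : vertex (w, k) * SalvettiExample.c ∈ vertices) : k = 0 := by
  by_contra hk
  have h1 := vertex_coord h
  rw [coord_mul_c, coord_vertex, if_neg hk] at h1
  exact ne_mul_c _ h1

/-- The coordinates on the vertices of the subcomplex. -/
def vertexEquiv : F2 × ℤ ≃ vertices := Equiv.ofInjective vertex vertex_injective

theorem vertexEquiv_val (x : F2 × ℤ) : (vertexEquiv x : Z2Z) = vertex x := rfl

/-- The subcomplex is made of planes joined by edges at their diagonal vertices. -/
def model : DiagModel (salvettiCover.induce vertices) where
  e := vertexEquiv
  mem_cubes_iff s := by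
    have hinj : ∀ u : Set vertices, Subtype.val '' s = Subtype.val '' u ↔ s = u := fun u =>
      Set.image_eq_image Subtype.val_injective
    simp only [← hinj, Set.image_insert_eq, Set.image_singleton, vertexEquiv_val]
    change (∃ g : Z2Z, _) ↔ _
    constructor
    · rintro ⟨g, h⟩
      have hs : ∀ v ∈ Subtype.val '' s, v ∈ vertices := by
        rintro _ ⟨v, -, rfl⟩
        exact v.2
      have hg : g ∈ vertices := hs g (by
        rcases h with h | h | h | h | h <;> rw [h] <;> simp)
      obtain ⟨⟨w, k⟩, rfl⟩ := hg
      refine ⟨w, k, ?_⟩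
      rcases h with h | h | h | h | h
      · exact .inl h
      · rw [vertex_mul_a] at h
        exact .inr (.inl h)
      · rw [vertex_mul_b] at h
        exact .inr (.inr (.inl h))
      · obtain rfl : k = 0 := snd_eq_zero_of_mul_c_mem 
          (hs (vertex (w, k) * SalvettiExample.c) (by rw [h]; simp))
        rw [vertex_mul_c] at h
        exact .inr (.inr (.inr (.inl h)))
      · rw [vertex_mul_a, vertex_mul_b, vertex_mul_b, add_sub_cancel_right] at h
        exact .inr (.inr (.inr (.inr h)))
    · rintro ⟨w, k, h | h | h | h | h⟩
      · exact ⟨_, .inl h⟩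
      · rw [← vertex_mul_a] at h
        exact ⟨_, .inr (.inl h)⟩
      · rw [← vertex_mul_b] at h
        exact ⟨_, .inr (.inr (.inl h))⟩
      · rw [← vertex_mul_c] at h
        exact ⟨_, .inr (.inr (.inr (.inl h)))⟩
      · refine ⟨vertex (w, k), .inr (.inr (.inr (.inr ?_)))⟩
        rw [vertex_mul_a, vertex_mul_b, vertex_mul_b, add_sub_cancel_right]
        exact h

/-! ## Convexity -/

theorem adj_cases {g h : Z2Z} (hgh : salvettiCover.graph.Adj g h) :
    ∃ s, (s = a ∨ s = b ∨ s = SalvettiExample.c) ∧ (h = g * s ∨ g = h * s) := by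
  obtain ⟨hne, x, hx⟩ := hgh
  have pair : ∀ y, ({g, h} : Set Z2Z) = {x, y} → g = x ∧ h = y ∨ h = x ∧ g = y := fun y hy => by
    rcases Set.pair_eq_pair_iff.1 hy with ⟨h1, h2⟩ | ⟨h1, h2⟩
    · exact .inl ⟨h1, h2⟩
    · exact .inr ⟨h2, h1⟩
  rcases hx with hx | hx | hx | hx | hx
  · have h1 : g ∈ ({x} : Set Z2Z) := hx ▸ (by simp)
    have h2 : h ∈ ({x} : Set Z2Z) := hx ▸ (by simp)
    exact absurd (h1.trans h2.symm) hne
  · rcases pair _ hx with ⟨rfl, rfl⟩ | ⟨rfl, rfl⟩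
    · exact ⟨_, .inl rfl, .inl rfl⟩
    · exact ⟨_, .inl rfl, .inr rfl⟩
  · rcases pair _ hx with ⟨rfl, rfl⟩ | ⟨rfl, rfl⟩
    · exact ⟨_, .inr (.inl rfl), .inl rfl⟩
    · exact ⟨_, .inr (.inl rfl), .inr rfl⟩
  · rcases pair _ hx with ⟨rfl, rfl⟩ | ⟨rfl, rfl⟩
    · exact ⟨_, .inr (.inr rfl), .inl rfl⟩
    · exact ⟨_, .inr (.inr rfl), .inr rfl⟩
  · have h0 : x ∈ ({g, h} : Set Z2Z) := hx ▸ (by simp)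
    have h1 : x * a ∈ ({g, h} : Set Z2Z) := hx ▸ (by simp)
    have h2 : x * b ∈ ({g, h} : Set Z2Z) := hx ▸ (by simp)
    have n1 := ne_mul_a x
    have n2 := ne_mul_b x
    have n3 := mul_a_ne_mul_b x
    rcases h0 with h0 | h0 <;> rcases h1 with h1 | h1 <;> rcases h2 with h2 | h2 <;>
      simp_all

theorem adj_mul {g s : Z2Z} (hs : s = a ∨ s = b ∨ s = SalvettiExample.c) :
    salvettiCover.graph.Adj g (g * s) := by
  rcases hs with rfl | rfl | rfl
  · exact ⟨ne_mul_a g, g, .inr (.inl rfl)⟩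
  · exact ⟨ne_mul_b g, g, .inr (.inr (.inl rfl))⟩
  · exact ⟨ne_mul_c g, g, .inr (.inr (.inr (.inl rfl)))⟩

/-- The retraction to the subcomplex. -/
def retract (g : Z2Z) : Z2Z := vertex (coord g)

/-- The retraction maps edges to edges or to vertices, and edges leaving the subcomplex to
vertices. -/
theorem retract_mul (g : Z2Z) {s : Z2Z} (hs : s = a ∨ s = b ∨ s = SalvettiExample.c) :
    retract (g * s) = retract g * s ∨
      retract (g * s) = retract g ∧ retract g * s ∉ vertices := by
  rcases hs with rfl | rfl | rfl
  · left
    rw [retract, coord_mul_a, retract, vertex_mul_a]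
  · left
    rw [retract, coord_mul_b, retract, vertex_mul_b]
  · by_cases hk : (coord g).2 = 0
    · left
      rw [retract, coord_mul_c, if_pos hk, retract, hk, ← vertex_mul_c, ← hk]
    · refine .inr ⟨by rw [retract, coord_mul_c, if_neg hk, retract], fun h => hk ?_⟩
      exact snd_eq_zero_of_mul_c_mem h

theorem retract_mem (g : Z2Z) : retract g ∈ vertices := ⟨_, rfl⟩

theorem retract_adj {g h : Z2Z} (hgh : salvettiCover.graph.Adj g h) :
    retract g = retract h ∨ salvettiCover.graph.Adj (retract g) (retract h) := by
  obtain ⟨s, hs, rfl | rfl⟩ := adj_cases hgh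
  · rcases retract_mul g hs with h | h
    · rw [h]
      exact .inr (adj_mul hs)
    · exact .inl h.1.symm
  · rcases retract_mul h hs with h' | h'
    · rw [h']
      exact .inr (adj_mul hs).symm
    · exact .inl h'.1

theorem retract_eq_of_adj {g h : Z2Z} (hgh : salvettiCover.graph.Adj g h) (hg : g ∈ vertices)
    (hh : h ∉ vertices) : retract g = retract h := by
  have hg' : retract g = g := vertex_coord hg
  obtain ⟨s, hs, rfl | rfl⟩ := adj_cases hgh
  · rcases retract_mul g hs with h | h
    · rw [hg'] at h
      exact absurd (h ▸ retract_mem _) hh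
    · exact h.1.symm
  · rcases retract_mul h hs with h' | h'
    · rw [hg'] at h'
      exact absurd (mul_right_cancel h' ▸ retract_mem h) hh
    · exact h'.1

/-- Retract edge by edge. An edge leaving `vertices` is collapsed, so a walk starting inside and
ending outside loses at least one edge. -/
theorem exists_walk_retract {u v : Z2Z} (p : salvettiCover.graph.Walk u v) :
    ∃ q : salvettiCover.graph.Walk (retract u) (retract v), q.length ≤ p.length ∧
      (u ∈ vertices → v ∉ vertices → q.length < p.length) := by
  induction p with
  | nil => exact ⟨.nil, le_rfl, fun h1 h2 => absurd h1 h2⟩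
  | @cons u v w h p ih =>
    obtain ⟨q, h1, h2⟩ := ih
    by_cases he : retract u = retract v
    · rw [he]
      exact ⟨q, h1.trans (Nat.le_succ _), fun _ _ => Nat.lt_succ_of_le h1⟩
    · refine ⟨.cons ((retract_adj h).resolve_left he) q, Nat.succ_le_succ h1, fun hu hw =>
        Nat.succ_lt_succ (h2 ?_ hw)⟩
      by_contra hv
      exact he (retract_eq_of_adj h hu hv)

theorem salvettiCover_connected : salvettiCover.graph.Connected := by
  have hgen : ∀ {s : Z2Z}, (s = a ∨ s = b ∨ s = SalvettiExample.c) →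
      ∀ g, salvettiCover.graph.Reachable g (g * s) := fun hs g => (adj_mul hs).reachable
  -- The elements by which right multiplication stays in a connected component form a subgroup; it
  -- contains the generators.
  let K : Subgroup Z2Z :=
    { carrier := {s | ∀ g, salvettiCover.graph.Reachable g (g * s)}
      one_mem' := fun g => by rw [mul_one]
      mul_mem' := fun {s s'} h h' g => by
        rw [← mul_assoc]
        exact (h g).trans (h' _)
      inv_mem' := fun {s} h g => by simpa using (h (g * s⁻¹)).symm }
  have ha : a ∈ K := hgen (.inl rfl)
  have hb : b ∈ K := hgen (.inr (.inl rfl))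
  have hc : SalvettiExample.c ∈ K := hgen (.inr (.inr rfl))
  have hK : ∀ g, g ∈ K := fun g => by
    induction g using Monoid.Coprod.induction_on with
    | inl m =>
      rw [show Monoid.Coprod.inl m = _ from (a_zpow_mul_b_zpow m.toAdd.1 m.toAdd.2).symm]
      exact mul_mem (zpow_mem ha _) (zpow_mem hb _)
    | inr n =>
      have : Monoid.Coprod.inr n = SalvettiExample.c ^ n.toAdd := by
        rw [SalvettiExample.c, ← map_zpow, ← ofAdd_zsmul]
        simp
      rw [this]
      exact zpow_mem hc _
    | mul x y hx hy => exact mul_mem hx hy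
  have : Nonempty Z2Z := ⟨1⟩
  exact ⟨fun g h => by simpa using hK (g⁻¹ * h) g⟩

/-- The retraction fixes `x` and `y` and would strictly shorten a geodesic passing through a vertex
outside. -/
theorem isConvex_vertices : salvettiCover.IsConvex vertices := by
  intro x hx y hy v hv
  by_contra hv'
  obtain ⟨p, hp⟩ := salvettiCover_connected.exists_walk_length_eq_dist x v
  obtain ⟨q, hq⟩ := salvettiCover_connected.exists_walk_length_eq_dist v y
  obtain ⟨p', -, hp'⟩ := exists_walk_retract p
  obtain ⟨q', hq', -⟩ := exists_walk_retract q
  have h1 := hp' hx hv'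
  have h2 := SimpleGraph.dist_le (p'.append q')
  rw [SimpleGraph.Walk.length_append] at h2
  have h3 : salvettiCover.graph.dist (retract x) (retract y) = salvettiCover.graph.dist x y := by
    rw [show retract x = x from vertex_coord hx, show retract y = y from vertex_coord hy]
  omega

theorem countable_vertices : Countable vertices := by
  have : Countable F2 := Function.Surjective.countable (f := FreeGroup.mk (α := Bool)) fun u =>
    ⟨u.toWord, FreeGroup.mk_toWord⟩
  exact Set.countable_range vertex

end DiagonalPlanes

end

theorem proposition6p13 :
    ∃ S : Set SalvettiExample.Z2Z, SalvettiExample.salvettiCover.IsConvex S ∧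
      ∃ X : CubeFamily S, X = SalvettiExample.salvettiCover.induce S ∧
        X.IsCAT0CubeComplex ∧ X.IsFiniteDimensional ∧ Countable S ∧
        X.IsEssential ∧ ¬ IsElementaryAction X.isom X.Realization ∧
        X.regularBoundary ≠ X.nonterminatingBoundary ∧
        ¬ X.IsMinimalOn X.nonterminatingBoundary :=
  ⟨DiagonalPlanes.vertices, DiagonalPlanes.isConvex_vertices, _, rfl,
    DiagonalPlanes.model.isCAT0CubeComplex, DiagonalPlanes.model.isFiniteDimensional,
    DiagonalPlanes.countable_vertices, DiagonalPlanes.model.isEssential,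
    DiagonalPlanes.model.not_isElementaryAction, DiagonalPlanes.model.regularBoundary_ne,
    DiagonalPlanes.model.not_isMinimalOn⟩
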